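/- Let $N\ge 2$ be an even integer, $\kappa_N=(-1)^{1+N/2}$, and let $p(t;\cdot)$, $t>0$, be the elementary solution of $\partial_t u=\kappa_N\,\partial_x^N u$, i.e. $\int_{\mathbb R} e^{i\mu x}p(t;x)\,dx=e^{\kappa_N t(-i\mu)^N}$. Let $X$ be the associated pseudo-process started at $0$. A tame function is a bounded Borel function $F$ of finitely many observations $X(1/2^n),\dots,X(k/2^n)$, with pseudo-expectation $$\mathbb E(F)=\int_{\mathbb R^k}F(x_1,\dots,x_k)\prod_{j=1}^k p(2^{-n};x_{j-1}-x_j)\,dx_1\cdots dx_k,\qquad x_0=0 .$$ Let $X_n(t)=X(k/2^n)$ for $k/2^n\le t<(k+1)/2^n$, and $T_n(t)=\int_0^t \mathbf 1_{[0,\infty)}(X_n(s))\,ds$. For $\lambda,\nu>0$ and $\mu\in\mathbb R$ let $$E_n(\lambda,\mu,\nu)=\sum_{k=0}^\infty \mathbb E\Big[\int_{k/2^n}^{(k+1)/2^n}e^{-\lambda t+i\mu X_n(t)-\nu T_n(t)}\,dt\Big],\qquad E(\lambda,\mu,\nu)=\lim_{n\to\infty}E_n(\lambda,\mu,\nu),$$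 which is the meaning of $\mathbb E\big[\int_0^\infty e^{-\lambda t+i\mu X(t)-\nu T(t)}dt\big]$, where $T(t)=\int_0^t\mathbf 1_{[0,\infty)}(X(s))\,ds$. The Laplace transform in $t$ of the density in $x$ of $(T(t),X(t))$, $$g(x)=\int_0^\infty e^{-\lambda t}\,\big[\mathbb E\big(e^{-\nu T(t)},X(t)\in dx\big)/dx\big]\,dt ,$$ denotes the density with $\int_{\mathbb R} e^{i\mu x}g(x)\,dx=E(\lambda,\mu,\nu)$ for all $\mu\in\mathbb R$. Let $J$ and $K$ index the $N$-th roots $\theta_i$ of $\kappa_N$ with positive, respectively negative, real part, and let $A_j=\prod_{i\in J\setminus\{j\}}\frac{\theta_i}{\theta_i-\theta_j}$ for $j\in J$ and $B_k=\prod_{i\in K\setminus\{k\}}\frac{\theta_i}{\theta_i-\theta_k}$ for $k\in K$. **Theorem.** Let $\lambda,\nu>0$. For all $\mu\in\mathbb R$ and $n$ the series $E_n(\lambda,\mu,\nu)$ converges absolutely, and the limit $E(\lambda,\mu,\nu)$ exists. There is an integrable function $g:\mathbb R\to\mathbb R$ with $\int_{\mathbb R} e^{i\mu x}g(x)\,dx=E(\lambda,\mu,\nu)$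 for all $\mu\in\mathbb R$; it is unique up to null sets, and its continuous version is $$g(x)=\frac{1}{\lambda^{\frac{\#K-1}{N}}(\lambda+\nu)^{\frac{\#J-1}{N}}}\sum_{j\in J}A_j\theta_j\Big(\sum_{k\in K}\frac{B_k\theta_k}{\theta_k\lambda^{1/N}-\theta_j(\lambda+\nu)^{1/N}}\Big)e^{-\theta_j(\lambda+\nu)^{1/N}x}\qquad\text{for } x\ge 0,$$ $$g(x)=\frac{1}{\lambda^{\frac{\#K-1}{N}}(\lambda+\nu)^{\frac{\#J-1}{N}}}\sum_{k\in K}B_k\theta_k\Big(\sum_{j\in J}\frac{A_j\theta_j}{\theta_k\lambda^{1/N}-\theta_j(\lambda+\nu)^{1/N}}\Big)e^{-\theta_k\lambda^{1/N}x}\qquad\text{for } x\le 0.$$ -/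

import Mathlib

open MeasureTheory Filter Topology

noncomputable section

namespace PseudoProcess

/-- The constant `κ_N = (-1)^(1 + N/2)` of the equation `∂u/∂t = κ_N ∂^N u/∂x^N`, for even `N`. -/
def kappa (N : ℕ) : ℝ := (-1) ^ (1 + N / 2)

/-- The elementary solution `p(t; x)` of `∂u/∂t = κ_N ∂^N u/∂x^N`: the function whose Fourier
transform `∫ exp(i μ x) p(t; x) dx` is `exp(κ_N t (-i μ)^N)`, written through Fourier inversion.
The quantity in brackets is real, since `N` is even. -/
def kernel (N : ℕ) (t x : ℝ) : ℝ :=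
  ((1 / (2 * (Real.pi : ℂ))) * ∫ μ : ℝ,
    Complex.exp (-(Complex.I * μ * x)) *
      Complex.exp ((kappa N : ℂ) * t * (-(Complex.I * μ)) ^ N)).re

/-- The first `k` observations, at the times `j / 2^n` with `1 ≤ j ≤ k`, of a path `ω`, where
`ω j` stands for the position at time `j / 2^n`. -/
def observations (k : ℕ) (ω : ℕ → ℝ) : Fin k → ℝ := fun i => ω (i + 1)

/-- The path that starts at `0` and has the given first `k` observations (its later values are
immaterial and set to `0`). -/
def pathOf {k : ℕ} (x : Fin k → ℝ) : ℕ → ℝ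
  | 0 => 0
  | j + 1 => if h : j < k then x ⟨j, h⟩ else 0

/-- A tame function: a bounded Borel function of `k` observations. -/
def IsTame {k : ℕ} (F : (Fin k → ℝ) → ℂ) : Prop :=
  Measurable F ∧ ∃ C : ℝ, ∀ x, ‖F x‖ ≤ C

/-- The pseudo-expectation of a tame function of the observations at the times `j / 2^n`,
`1 ≤ j ≤ k`, of the pseudo-process started at `x_0 = 0`:
`∫ F(x_1, …, x_k) ∏_{1 ≤ j ≤ k} p(1/2^n; x_{j-1} - x_j) dx_1 … dx_k`. -/
def tameExpectation (N n : ℕ) {k : ℕ} (F : (Fin k → ℝ) → ℂ) : ℂ :=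
  ∫ x : Fin k → ℝ,
    F x * ((∏ i : Fin k, kernel N (1 / 2 ^ n) (pathOf x i - pathOf x (i + 1)) : ℝ) : ℂ)

/-- `Φ` is a function of the discrete observations at the times `j / 2^n`: it is the sum of the
series of tame functions `F k`, the pseudo-expectations of which form an absolutely convergent
series with sum `e`.  The series is part of the data, because the sum of the pseudo-expectations
depends on it. -/
structure HasDiscreteExpectation (N n : ℕ) (Φ : (ℕ → ℝ) → ℂ)
    (F : (k : ℕ) → (Fin k → ℝ) → ℂ) (e : ℂ) : Prop where
  tame : ∀ k, IsTame (F k)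
  series : ∀ ω : ℕ → ℝ, ω 0 = 0 → HasSum (fun k => F k (observations k ω)) (Φ ω)
  summable : Summable fun k => ‖tameExpectation N n (F k)‖
  expectation_eq : e = ∑' k, tameExpectation N n (F k)

/-- The limit as `n → ∞` of the functions `Φ n` of the discrete observations is an admissible
function of the pseudo-process, with pseudo-expectation `e`. -/
def HasAdmissibleExpectation (N : ℕ) (Φ : ℕ → (ℕ → ℝ) → ℂ)
    (F : ℕ → (k : ℕ) → (Fin k → ℝ) → ℂ) (e : ℂ) : Prop :=
  ∃ E : ℕ → ℂ, (∀ n, HasDiscreteExpectation N n (Φ n) (F n) (E n)) ∧ Tendsto E atTop (𝓝 e)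

/-- The step process `X_n(t) = X(k/2^n)` for `k/2^n ≤ t < (k+1)/2^n`. -/
def stepProcess (n : ℕ) (ω : ℕ → ℝ) (t : ℝ) : ℝ := ω ⌊2 ^ n * t⌋₊

/-- The sojourn time `T_n(t) = ∫_0^t 1_{[0,∞)}(X_n(s)) ds` of the step process. -/
def sojournTime (n : ℕ) (ω : ℕ → ℝ) (t : ℝ) : ℝ :=
  ∫ s in (0 : ℝ)..t, Set.indicator (Set.Ici (0 : ℝ)) (fun _ => (1 : ℝ)) (stepProcess n ω s)

/-- `exp(-lam t + i μ X_n(t) - nu T_n(t))`. -/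
def laplaceFourierIntegrand (lam μ nu : ℝ) (n : ℕ) (ω : ℕ → ℝ) (t : ℝ) : ℂ :=
  Complex.exp (-(lam * t : ℂ) + Complex.I * μ * stepProcess n ω t - nu * sojournTime n ω t)

/-- `F_n(lam, μ, nu) = ∫_0^∞ exp(-lam t + i μ X_n(t) - nu T_n(t)) dt`. -/
def laplaceFourier (lam μ nu : ℝ) (n : ℕ) (ω : ℕ → ℝ) : ℂ :=
  ∫ t in Set.Ioi (0 : ℝ), laplaceFourierIntegrand lam μ nu n ω t

/-- The part of `F_n(lam, μ, nu)` over `[k/2^n, (k+1)/2^n]`, a function of the first `k`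
observations. -/
def laplaceFourierPiece (lam μ nu : ℝ) (n k : ℕ) (x : Fin k → ℝ) : ℂ :=
  ∫ t in ((k : ℝ) / 2 ^ n)..(((k : ℝ) + 1) / 2 ^ n),
    laplaceFourierIntegrand lam μ nu n (pathOf x) t

/-- `g` is a version of the density `∫_0^∞ exp(-lam t) [𝔼(exp(-nu T(t)), X(t) ∈ dx)/dx] dt`:
for every real `μ`, the functional `∫_0^∞ exp(-lam t + i μ X(t) - nu T(t)) dt`, the limit of the
`F_n(lam, μ, nu)`, is admissible with pseudo-expectation `∫ exp(i μ x) g(x) dx`. -/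
def IsLaplaceDensity (N : ℕ) (lam nu : ℝ) (g : ℝ → ℝ) : Prop :=
  Integrable g ∧ ∀ μ : ℝ,
    HasAdmissibleExpectation N (laplaceFourier lam μ nu) (laplaceFourierPiece lam μ nu)
      (∫ x : ℝ, Complex.exp (Complex.I * μ * x) * (g x : ℂ))

/-- The `N`-th roots `θ` of `κ_N` with positive real part; the roots serve as their own
indices. -/
def rootsJ (N : ℕ) : Finset ℂ :=
  (Polynomial.nthRootsFinset N (kappa N : ℂ)).filter fun θ => 0 < θ.re

/-- The `N`-th roots `θ` of `κ_N` with negative real part. -/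
def rootsK (N : ℕ) : Finset ℂ :=
  (Polynomial.nthRootsFinset N (kappa N : ℂ)).filter fun θ => θ.re < 0

/-- `A_j = ∏_{i ∈ J \ {j}} θ_i / (θ_i - θ_j)`. -/
def coeffA (N : ℕ) (θ : ℂ) : ℂ := ∏ η ∈ (rootsJ N).erase θ, η / (η - θ)

/-- `B_k = ∏_{i ∈ K \ {k}} θ_i / (θ_i - θ_k)`. -/
def coeffB (N : ℕ) (θ : ℂ) : ℂ := ∏ η ∈ (rootsK N).erase θ, η / (η - θ)

/-- The `N`-th root of a positive real number. -/
def nthRoot (N : ℕ) (r : ℝ) : ℝ := r ^ (1 / (N : ℝ))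

/-- The factor `1 / (lam^((#K - 1)/N) (lam + nu)^((#J - 1)/N))`. -/
def prefactor (N : ℕ) (lam nu : ℝ) : ℝ :=
  1 / (lam ^ ((((rootsK N).card : ℝ) - 1) / N) * (lam + nu) ^ ((((rootsJ N).card : ℝ) - 1) / N))

end PseudoProcess

end

/-!
The joint law of `X(t)` and of its sojourn time in `[0, ∞)` is found by a Wiener–Hopf
factorization that is carried out exactly at each dyadic level and then passed to the limit.

Put `h = 1 / 2 ^ n`, `a = exp(-lam h)`, `b = exp(-(lam + nu) h)`, and let `U_k⁺(μ)`, `U_k⁻(μ)` be the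
Fourier transforms of the restrictions to `[0, ∞)` and `(-∞, 0)` of the law of `X(k h)`, weighted by
`exp(-lam k h - nu T_n(k h))`. Integrating out the last observation gives
`U_{k+1}⁺ + U_{k+1}⁻ = exp(-h μ ^ N) (b U_k⁺ + a U_k⁻)` (`posTransform_add_negTransform_succ`). The
Fourier transforms of finite signed measures on `[0, ∞)` and those on `(-∞, 0)` have only `0` in
common (`eq_of_add_eq_add`), so that this recursion determines both sequences. With
`Ψ⁺(t, μ)`, `Ψ⁻(t, μ)` the transforms of the restrictions of `p(t; ·)` to the two half-lines, the
power series `R = exp(∑ (b^k - a^k) Ψ⁺(k h) z^k / k)` and `M = exp(∑ (a^k - b^k) Ψ⁻(k h) z^k / k)`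
solve a common linear differential equation up to the factors `1 - b p z` and `1 - a p z`, where
`p = exp(-h μ ^ N)` (`one_sub_mul_expCoeff`). This gives the solution
`(a - b) U⁺ = a - b R` and `(a - b) U⁻ = b (M - 1)` (`posTransform_negTransform_eq`). Since `p(t; ·)`
has the same total variation for all `t`, the exponents decay geometrically, and the series converge
absolutely at `z = 1` for all `n` (`tsum_expCoeff`), although the total variation of the weighted laws
themselves may grow exponentially in `k`.

As `n → ∞` the exponents are Riemann sums of
`∫ (exp(-lam t) - exp(-(lam + nu) t)) / t Ψ(t) dt` over `(0, ∞)` (`tendsto_exponent`). The Laplace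
transform of `Ψ⁺(·, μ)` is the part carried by `[0, ∞)` of the partial fraction expansion of
`1 / (s + μ ^ N)` (`laplace_halfTransform`), and integrating it in `s` from `lam` to `lam + nu` turns
`R` and `M` into finite products over the roots (`exp_logFactor`). The limit of the
pseudo-expectations is `(M - R) / nu`, which reduces to
`1 / ∏ (lam^(1/N) - i μ / θ_k) ∏ ((lam + nu)^(1/N) - i μ / θ_j)`, the products being over `K` and `J`.
Its partial fraction expansion is the Fourier transform of the asserted density
(`fourier_density`).
-/

noncomputable section

namespace PseudoProcess

/-! ### Fourier transforms of signed measures carried by a set -/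

/-- `F` is the Fourier transform of a finite signed measure carried by `S`; the signed measure is
given as a difference of two finite measures. -/
def IsTransformOn (S : Set ℝ) (F : ℝ → ℂ) : Prop :=
  ∃ m₁ m₂ : Measure ℝ, IsFiniteMeasure m₁ ∧ IsFiniteMeasure m₂ ∧
    (∀ᵐ x ∂m₁, x ∈ S) ∧ (∀ᵐ x ∂m₂, x ∈ S) ∧ ∀ t, F t = charFun m₁ t - charFun m₂ t

theorem charFun_add_measure (m₁ m₂ : Measure ℝ) [IsFiniteMeasure m₁] [IsFiniteMeasure m₂] (t : ℝ) :
    charFun (m₁ + m₂) t = charFun m₁ t + charFun m₂ t := by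
  have h (m : Measure ℝ) [IsFiniteMeasure m] :
      Integrable (fun x : ℝ => Complex.exp (inner ℝ x t * Complex.I)) m :=
    (integrable_const (1 : ℝ)).mono (by fun_prop)
      (ae_of_all _ fun x => by rw [Complex.norm_exp_ofReal_mul_I]; simp)
  simp only [charFun_apply]
  exact integral_add_measure (h m₁) (h m₂)

theorem charFun_nnreal_smul (c : NNReal) (m : Measure ℝ) (t : ℝ) :
    charFun (c • m) t = (c : ℝ) * charFun m t := by
  simp only [charFun_apply, integral_smul_nnreal_measure]
  simp [NNReal.smul_def]

theorem ae_mem_conv {S : Set ℝ} (hS : ∀ x ∈ S, ∀ y ∈ S, x + y ∈ S) (hm : MeasurableSet S)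
    {m₁ m₂ : Measure ℝ} [IsFiniteMeasure m₁] [IsFiniteMeasure m₂]
    (h₁ : ∀ᵐ x ∂m₁, x ∈ S) (h₂ : ∀ᵐ x ∂m₂, x ∈ S) : ∀ᵐ x ∂(m₁ ∗ m₂), x ∈ S := by
  unfold Measure.conv
  refine (ae_map_iff (by fun_prop) hm).2 ?_
  have h1 : ∀ᵐ p ∂(m₁.prod m₂), p.1 ∈ S := Measure.quasiMeasurePreserving_fst.ae h₁
  have h2 : ∀ᵐ p ∂(m₁.prod m₂), p.2 ∈ S := Measure.quasiMeasurePreserving_snd.ae h₂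
  filter_upwards [h1, h2] with p hp hq using hS _ hp _ hq

namespace IsTransformOn

variable {S T : Set ℝ} {F G : ℝ → ℂ}

theorem congr (hF : IsTransformOn S F) (h : ∀ t, G t = F t) : IsTransformOn S G := by
  rwa [show G = F from funext h]

theorem zero : IsTransformOn S (fun _ => 0) :=
  ⟨0, 0, inferInstance, inferInstance, by simp, by simp, fun t => by simp⟩

theorem neg (hF : IsTransformOn S F) : IsTransformOn S (fun t => -F t) := by
  obtain ⟨m₁, m₂, i₁, i₂, h₁, h₂, h⟩ := hF
  exact ⟨m₂, m₁, i₂, i₁, h₂, h₁, fun t => by simp only [h]; ring⟩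

theorem add (hF : IsTransformOn S F) (hG : IsTransformOn S G) :
    IsTransformOn S (fun t => F t + G t) := by
  obtain ⟨m₁, m₂, i₁, i₂, h₁, h₂, h⟩ := hF
  obtain ⟨m₃, m₄, i₃, i₄, h₃, h₄, h'⟩ := hG
  refine ⟨m₁ + m₃, m₂ + m₄, inferInstance, inferInstance, ?_, ?_, fun t => ?_⟩
  · exact ae_add_measure_iff.2 ⟨h₁, h₃⟩
  · exact ae_add_measure_iff.2 ⟨h₂, h₄⟩
  · rw [charFun_add_measure, charFun_add_measure]; simp only [h, h']; ring

theorem sub (hF : IsTransformOn S F) (hG : IsTransformOn S G) :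
    IsTransformOn S (fun t => F t - G t) :=
  (hF.add hG.neg).congr fun t => by ring

theorem real_smul (c : ℝ) (hF : IsTransformOn S F) : IsTransformOn S (fun t => (c : ℂ) * F t) := by
  have key (c : NNReal) : IsTransformOn S (fun t => ((c : ℝ) : ℂ) * F t) := by
    obtain ⟨m₁, m₂, i₁, i₂, h₁, h₂, h⟩ := hF
    refine ⟨c • m₁, c • m₂, inferInstance, inferInstance, Measure.ae_smul_measure h₁ c,
      Measure.ae_smul_measure h₂ c, fun t => ?_⟩
    rw [charFun_nnreal_smul, charFun_nnreal_smul]; simp only [h]; ring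
  rcases le_total 0 c with hc | hc
  · exact (key c.toNNReal).congr fun t => by rw [Real.coe_toNNReal c hc]
  · refine (key (-c).toNNReal).neg.congr fun t => ?_
    rw [Real.coe_toNNReal (-c) (by linarith)]
    push_cast
    ring

theorem mul (hS : ∀ x ∈ S, ∀ y ∈ S, x + y ∈ S) (hm : MeasurableSet S)
    (hF : IsTransformOn S F) (hG : IsTransformOn S G) : IsTransformOn S (fun t => F t * G t) := by
  obtain ⟨m₁, m₂, i₁, i₂, h₁, h₂, h⟩ := hF
  obtain ⟨m₃, m₄, i₃, i₄, h₃, h₄, h'⟩ := hG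
  refine ⟨m₁ ∗ m₃ + m₂ ∗ m₄, m₁ ∗ m₄ + m₂ ∗ m₃, inferInstance, inferInstance, ?_, ?_, fun t => ?_⟩
  · exact ae_add_measure_iff.2 ⟨ae_mem_conv hS hm h₁ h₃, ae_mem_conv hS hm h₂ h₄⟩
  · exact ae_add_measure_iff.2 ⟨ae_mem_conv hS hm h₁ h₄, ae_mem_conv hS hm h₂ h₃⟩
  · rw [charFun_add_measure, charFun_add_measure, charFun_conv, charFun_conv, charFun_conv,
      charFun_conv]
    simp only [h, h']
    ring

theorem sum {ι : Type*} (s : Finset ι) {f : ι → ℝ → ℂ} (h : ∀ i ∈ s, IsTransformOn S (f i)) :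
    IsTransformOn S (fun t => ∑ i ∈ s, f i t) := by
  classical
  induction s using Finset.induction_on with
  | empty => simpa using zero
  | insert i s hi ih =>
    simp only [Finset.sum_insert hi]
    exact (h i (by simp)).add (ih fun j hj => h j (by simp [hj]))

/-- If `S` and `T` are disjoint, only `0` is both a transform carried by `S` and one carried
by `T`. -/
theorem eq_zero_of_disjoint (hST : Disjoint S T)
    (hF : IsTransformOn S F) (hG : IsTransformOn T F) (t : ℝ) : F t = 0 := by
  obtain ⟨m₁, m₂, i₁, i₂, h₁, h₂, h⟩ := hF
  obtain ⟨m₃, m₄, i₃, i₄, h₃, h₄, h'⟩ := hG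
  have e : m₁ + m₄ = m₃ + m₂ := by
    refine Measure.ext_of_charFun (funext fun t => ?_)
    rw [charFun_add_measure, charFun_add_measure]
    linear_combination (h t) * (-1) + h' t
  have z (m : Measure ℝ) (hm : ∀ᵐ x ∂m, x ∈ T) : m.restrict S = 0 := by
    rw [Measure.restrict_eq_zero]
    refine measure_mono_null (fun x hx => ?_) hm
    exact fun hxT => Set.disjoint_left.1 hST hx hxT
  have e2 : m₁ = m₂ := by
    have := congrArg (fun m => Measure.restrict m S) e
    simpa only [Measure.restrict_add, z _ h₃, z _ h₄, add_zero, zero_add,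
      Measure.restrict_eq_self_of_ae_mem h₁, Measure.restrict_eq_self_of_ae_mem h₂] using this
  rw [h, e2, sub_self]

end IsTransformOn

/-- The Wiener–Hopf principle in additive form: the splitting of a function into a transform
carried by `[0, ∞)` and a transform carried by `(-∞, 0)` is unique. -/
theorem eq_of_add_eq_add {P P' Q Q' : ℝ → ℂ} (hP : IsTransformOn (Set.Ici 0) P)
    (hP' : IsTransformOn (Set.Ici 0) P') (hQ : IsTransformOn (Set.Iio 0) Q)
    (hQ' : IsTransformOn (Set.Iio 0) Q') (h : ∀ t, P t + Q t = P' t + Q' t) (t : ℝ) :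
    P t = P' t ∧ Q t = Q' t := by
  have hd : Disjoint (Set.Ici (0 : ℝ)) (Set.Iio 0) :=
    Set.disjoint_left.2 fun x hx hx' => not_lt.2 (Set.mem_Ici.1 hx) (Set.mem_Iio.1 hx')
  have := (hP.sub hP').eq_zero_of_disjoint hd
    ((hQ'.sub hQ).congr fun t => by linear_combination h t) t
  exact ⟨sub_eq_zero.1 this, by linear_combination h t - this⟩

theorem charFun_withDensity (f : ℝ → ℝ) (hf : Measurable f) (t : ℝ) :
    charFun (volume.withDensity fun x => ENNReal.ofReal (f x)) t
      = ∫ x : ℝ, Complex.exp (Complex.I * t * x) * ((max (f x) 0 : ℝ) : ℂ) := by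
  rw [charFun_apply_real, integral_withDensity_eq_integral_toReal_smul (by fun_prop) (by simp)]
  refine integral_congr_ae (ae_of_all _ fun x => ?_)
  simp only [ENNReal.toReal_ofReal', Complex.real_smul]
  rw [mul_comm]
  congr 2
  ring

theorem integrable_exp_mul {f : ℝ → ℝ} (hf : Integrable f) (t : ℝ) :
    Integrable fun x : ℝ => Complex.exp (Complex.I * t * x) * (f x : ℂ) := by
  refine hf.ofReal.bdd_mul (c := 1) (by fun_prop) (ae_of_all _ fun x => ?_)
  rw [show Complex.I * t * x = ((t * x : ℝ) : ℂ) * Complex.I by push_cast; ring,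
    Complex.norm_exp_ofReal_mul_I]

theorem isFiniteMeasure_withDensity_real {f : ℝ → ℝ} (hf : Integrable f) :
    IsFiniteMeasure (volume.withDensity fun x => ENNReal.ofReal (f x)) :=
  isFiniteMeasure_withDensity_ofReal hf.2

/-- The signed measure with density `f` is the difference of the measures whose densities are the
positive and the negative part of `f`; its Fourier transform is that of `f`. -/
theorem charFun_withDensity_sub {f : ℝ → ℝ} (hf : Integrable f) (hm : Measurable f) (t : ℝ) :
    charFun (volume.withDensity fun x => ENNReal.ofReal (f x)) t
      - charFun (volume.withDensity fun x => ENNReal.ofReal (-f x)) t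
      = ∫ x : ℝ, Complex.exp (Complex.I * t * x) * (f x : ℂ) := by
  rw [charFun_withDensity f hm, charFun_withDensity (fun x => -f x) hm.neg, ← integral_sub]
  · refine integral_congr_ae (ae_of_all _ fun x => ?_)
    simp only
    rw [← mul_sub, ← Complex.ofReal_sub]
    congr 2
    rcases le_total 0 (f x) with h | h
    · rw [max_eq_left h, max_eq_right (by linarith), sub_zero]
    · rw [max_eq_right h, max_eq_left (by linarith)]; ring
  · exact integrable_exp_mul hf.pos_part t
  · exact integrable_exp_mul hf.neg_part t

theorem isTransformOn_of_density {S : Set ℝ} {f : ℝ → ℝ} (hS : MeasurableSet S)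
    (hf : IntegrableOn f S) (hm : Measurable f) :
    IsTransformOn S fun t => ∫ x in S, Complex.exp (Complex.I * t * x) * (f x : ℂ) := by
  have hi : Integrable (S.indicator f) := hf.integrable_indicator hS
  have hmi : Measurable (S.indicator f) := hm.indicator hS
  have carried (g : ℝ → ℝ) (hgm : Measurable g) (hg : ∀ x ∉ S, g x = 0) :
      ∀ᵐ x ∂(volume.withDensity fun x => ENNReal.ofReal (g x)), x ∈ S := by
    rw [ae_withDensity_iff (by fun_prop)]
    refine ae_of_all _ fun x hx => ?_
    by_contra hxS
    exact hx (by simp [hg x hxS])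
  refine ⟨_, _, isFiniteMeasure_withDensity_real hi,
    isFiniteMeasure_withDensity_real hi.neg, carried _ hmi fun x hx => by simp [hx],
    carried _ hmi.neg fun x hx => by simp [hx], fun t => ?_⟩
  refine Eq.trans ?_ (charFun_withDensity_sub hi hmi t).symm
  refine (integral_indicator hS).symm.trans (integral_congr_ae (ae_of_all _ fun x => ?_))
  by_cases hx : x ∈ S <;> simp [hx]

/-- An integrable function is determined almost everywhere by its Fourier transform. -/
theorem ae_eq_of_fourier_eq {f g : ℝ → ℝ} (hf : Integrable f) (hg : Integrable g)
    (h : ∀ t : ℝ, ∫ x : ℝ, Complex.exp (Complex.I * t * x) * (f x : ℂ)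
      = ∫ x : ℝ, Complex.exp (Complex.I * t * x) * (g x : ℂ)) : f =ᵐ[volume] g := by
  -- pass to a measurable representative of the difference
  obtain ⟨u, hu, hfu⟩ := (hf.sub hg).aemeasurable
  have hui : Integrable u := (hf.sub hg).congr hfu
  have hz (t : ℝ) : ∫ x : ℝ, Complex.exp (Complex.I * t * x) * (u x : ℂ) = 0 := by
    have : ∫ x : ℝ, Complex.exp (Complex.I * t * x) * (u x : ℂ)
        = ∫ x : ℝ, (Complex.exp (Complex.I * t * x) * (f x : ℂ)
          - Complex.exp (Complex.I * t * x) * (g x : ℂ)) := by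
      refine integral_congr_ae (hfu.mono fun x hx => ?_)
      simp only [← hx, Pi.sub_apply]
      push_cast
      ring
    rw [this, integral_sub (integrable_exp_mul hf t) (integrable_exp_mul hg t), h, sub_self]
  have := isFiniteMeasure_withDensity_real hui
  have := isFiniteMeasure_withDensity_real hui.neg
  have e : volume.withDensity (fun x => ENNReal.ofReal (u x))
      = volume.withDensity (fun x => ENNReal.ofReal (-u x)) := by
    refine Measure.ext_of_charFun (funext fun t => ?_)
    rw [← sub_eq_zero, charFun_withDensity_sub hui hu, hz]
  rw [withDensity_eq_iff (by fun_prop) (by fun_prop) hui.lintegral_lt_top.ne] at e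
  filter_upwards [e, hfu] with x hx hxu
  have hx0 : u x = 0 := by
    rcases le_total 0 (u x) with h0 | h0
    · rw [ENNReal.ofReal_of_nonpos (p := -u x) (by linarith), ENNReal.ofReal_eq_zero] at hx
      linarith
    · rw [ENNReal.ofReal_of_nonpos (p := u x) h0, eq_comm, ENNReal.ofReal_eq_zero] at hx
      linarith
  rw [hx0, Pi.sub_apply] at hxu
  linarith

/-! ### The elementary solution -/

theorem kappa_mul_pow {N : ℕ} (hN : Even N) (z : ℂ) :
    (kappa N : ℂ) * (-(Complex.I * z)) ^ N = -z ^ N := by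
  obtain ⟨r, rfl⟩ := hN
  have h1 : (r + r) / 2 = r := by omega
  have h2 : (-(Complex.I * z)) ^ (r + r) = (-1) ^ r * z ^ (r + r) := by
    rw [← two_mul, pow_mul, pow_mul, ← mul_pow]
    congr 1
    rw [neg_sq, mul_pow, Complex.I_sq]
  rw [h2, kappa, h1]
  push_cast
  rw [← mul_assoc, ← pow_add, show 1 + r + r = 2 * r + 1 by ring, pow_succ, pow_mul]
  simp

theorem kernel_eq {N : ℕ} (hN : Even N) (t x : ℝ) :
    kernel N t x = ((1 / (2 * (Real.pi : ℂ))) * ∫ v : ℝ,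
      Complex.exp (-(Complex.I * v * x)) * Complex.exp (-(t * v ^ N))).re := by
  unfold kernel
  congr 3
  ext v
  rw [mul_right_comm (kappa N : ℂ), kappa_mul_pow hN]
  congr 2
  ring

theorem kernel_neg {N : ℕ} (hN : Even N) (t x : ℝ) : kernel N t (-x) = kernel N t x := by
  rw [kernel_eq hN, kernel_eq hN, ← integral_neg_eq_self]
  congr 3
  ext v
  push_cast
  rw [hN.neg_pow]
  congr 2
  ring

/-- The scaling relation of the elementary solution. -/
theorem kernel_scale {N : ℕ} (hN : Even N) {c : ℝ} (hc : 0 < c) (x : ℝ) :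
    kernel N (c ^ N) x = c⁻¹ * kernel N 1 (c⁻¹ * x) := by
  rw [kernel_eq hN, kernel_eq hN, ← Complex.re_ofReal_mul]
  congr 1
  have := Measure.integral_comp_mul_left (fun v : ℝ =>
    Complex.exp (-(Complex.I * v * (c⁻¹ * x : ℝ))) * Complex.exp (-((1 : ℝ) * v ^ N))) c
  rw [abs_of_pos (inv_pos.2 hc), Complex.real_smul] at this
  rw [mul_left_comm, ← this]
  congr 2
  ext v
  have hc' : (c : ℂ) ≠ 0 := by exact_mod_cast hc.ne'
  push_cast
  congr 2
  · field_simp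
  · ring

/-- The symbol `exp(-v^N)` of the elementary solution at time `1`. -/
def symbol (N : ℕ) (v : ℝ) : ℂ := ((Real.exp (-v ^ N) : ℝ) : ℂ)

theorem integrable_pow_mul_exp_neg_pow {N : ℕ} (hN : Even N) (hN2 : 2 ≤ N) (k : ℕ) :
    Integrable fun v : ℝ => v ^ k * Real.exp (-v ^ N) := by
  have h := (integrable_rpow_mul_exp_neg_mul_sq (b := 1) one_pos (s := (k : ℝ))
    (by linarith [Nat.cast_nonneg (α := ℝ) k])).const_mul (Real.exp 1)
  refine h.mono (by fun_prop) (ae_of_all _ fun v => ?_)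
  rw [Real.rpow_natCast, norm_mul, norm_mul, norm_mul, mul_left_comm]
  refine mul_le_mul_of_nonneg_left ?_ (norm_nonneg _)
  rw [Real.norm_of_nonneg (Real.exp_pos _).le, Real.norm_of_nonneg (Real.exp_pos _).le,
    Real.norm_of_nonneg (Real.exp_pos _).le, ← Real.exp_add]
  refine Real.exp_le_exp.2 ?_
  -- `v ^ N ≥ v ^ 2 - 1`, by comparing `|v|` with `1`
  have hv : v ^ 2 - 1 ≤ v ^ N := by
    rcases le_total |v| 1 with h1 | h1
    · have : v ^ 2 ≤ 1 := by rwa [sq_le_one_iff_abs_le_one]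
      linarith [hN.pow_nonneg v]
    · have : |v| ^ 2 ≤ |v| ^ N := pow_le_pow_right₀ h1 hN2
      rw [hN.pow_abs, sq_abs] at this
      linarith
  linarith

theorem integrable_symbol {N : ℕ} (hN : Even N) (hN2 : 2 ≤ N) : Integrable (symbol N) := by
  have := (integrable_pow_mul_exp_neg_pow hN hN2 0).ofReal (𝕜 := ℂ)
  exact this.congr (ae_of_all _ fun v => by simp [symbol])

theorem continuous_symbol (N : ℕ) : Continuous (symbol N) := by
  unfold symbol
  fun_prop

theorem continuous_fourier_symbol {N : ℕ} (hN : Even N) (hN2 : 2 ≤ N) :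
    Continuous (FourierTransform.fourier (symbol N)) :=
  VectorFourier.fourierIntegral_continuous Real.continuous_fourierChar
    (by fun_prop) (integrable_symbol hN hN2)

/-- The second derivative of the symbol is integrable, so that its Fourier transform is
`O(1 / (1 + ξ ^ 2))`. -/
theorem integrable_fourier_symbol {N : ℕ} (hN : Even N) (hN2 : 2 ≤ N) :
    Integrable (FourierTransform.fourier (symbol N)) := by
  set f1 : ℝ → ℂ := fun v => ((-(N * (v ^ (N - 1) * Real.exp (-v ^ N))) : ℝ) : ℂ) with hf1
  set f2 : ℝ → ℂ := fun v => ((N * N * (v ^ (2 * (N - 1)) * Real.exp (-v ^ N))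
    - N * (N - 1 : ℕ) * (v ^ (N - 2) * Real.exp (-v ^ N)) : ℝ) : ℂ) with hf2
  have hexp (v : ℝ) : HasDerivAt (fun v : ℝ => Real.exp (-v ^ N))
      (Real.exp (-v ^ N) * -(N * v ^ (N - 1))) v := (hasDerivAt_pow N v).neg.exp
  have d1 (v : ℝ) : HasDerivAt (symbol N) (f1 v) v := by
    refine (hexp v).ofReal_comp.congr_deriv ?_
    rw [hf1]
    congr 1
    ring
  have d2 (v : ℝ) : HasDerivAt f1 (f2 v) v := by
    have := (((hasDerivAt_pow (N - 1) v).mul (hexp v)).const_mul (N : ℝ)).neg.ofReal_comp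
    refine this.congr_deriv ?_
    rw [hf2]
    congr 1
    rw [two_mul, pow_add, show N - 1 - 1 = N - 2 by omega]
    ring
  have i0 := integrable_symbol hN hN2
  have i1 : Integrable f1 :=
    (((integrable_pow_mul_exp_neg_pow hN hN2 (N - 1)).const_mul (N : ℝ)).neg).ofReal
  have i2 : Integrable f2 :=
    (((integrable_pow_mul_exp_neg_pow hN hN2 (2 * (N - 1))).const_mul (N * N : ℝ)).sub
      ((integrable_pow_mul_exp_neg_pow hN hN2 (N - 2)).const_mul (N * (N - 1 : ℕ) : ℝ))).ofReal
  have e1 : deriv (symbol N) = f1 := funext fun v => (d1 v).deriv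
  have e2 : deriv f1 = f2 := funext fun v => (d2 v).deriv
  have F1 := Real.fourier_deriv i0 (fun v => (d1 v).differentiableAt) (by rwa [e1])
  have F2 := Real.fourier_deriv i1 (fun v => (d2 v).differentiableAt) (by rwa [e2])
  rw [e1] at F1
  rw [e2, F1] at F2
  have bound (f : ℝ → ℂ) (x : ℝ) : ‖FourierTransform.fourier f x‖ ≤ ∫ v, ‖f v‖ :=
    VectorFourier.norm_fourierIntegral_le_integral_norm _ _ _ _ _
  refine ((integrable_inv_one_add_sq.const_mul ((∫ v, ‖symbol N v‖) + ∫ v, ‖f2 v‖)).mono'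
    (continuous_fourier_symbol hN hN2).aestronglyMeasurable (ae_of_all _ fun x => ?_))
  have b0 := bound (symbol N) x
  have b2 := bound f2 x
  rw [F2] at b2
  simp only [norm_smul, norm_mul, Complex.norm_real, Complex.norm_I, Complex.norm_ofNat,
    Real.norm_eq_abs, mul_one, abs_of_pos Real.pi_pos] at b2
  rw [← div_eq_mul_inv, le_div_iff₀ (by positivity)]
  have hpi : 1 ≤ (2 * Real.pi) * (2 * Real.pi) := by nlinarith [Real.pi_gt_three]
  have hx : x ^ 2 * ‖FourierTransform.fourier (symbol N) x‖ ≤ ∫ v, ‖f2 v‖ := by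
    refine le_trans ?_ b2
    have : 0 ≤ x ^ 2 * ‖FourierTransform.fourier (symbol N) x‖ := by positivity
    calc x ^ 2 * ‖FourierTransform.fourier (symbol N) x‖
        ≤ ((2 * Real.pi) * (2 * Real.pi)) * (x ^ 2 * ‖FourierTransform.fourier (symbol N) x‖) :=
          le_mul_of_one_le_left this hpi
      _ = _ := by rw [← sq_abs x]; ring
  linarith

theorem kernel_one_eq {N : ℕ} (hN : Even N) (x : ℝ) :
    (kernel N 1 x : ℂ)
      = 1 / (2 * (Real.pi : ℂ)) * FourierTransform.fourier (symbol N) (x / (2 * Real.pi)) := by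
  have hpi : (Real.pi : ℂ) ≠ 0 := by exact_mod_cast Real.pi_ne_zero
  have e : (∫ v : ℝ, Complex.exp (-(Complex.I * v * x)) * Complex.exp (-((1 : ℝ) * v ^ N)))
      = FourierTransform.fourier (symbol N) (x / (2 * Real.pi)) := by
    rw [Real.fourier_real_eq_integral_exp_smul]
    refine integral_congr_ae (ae_of_all _ fun v => ?_)
    simp only [symbol, smul_eq_mul]
    push_cast
    congr 2
    · field_simp
    · ring
  -- the transform of the even symbol is real
  have hreal : (starRingEnd ℂ) (FourierTransform.fourier (symbol N) (x / (2 * Real.pi)))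
      = FourierTransform.fourier (symbol N) (x / (2 * Real.pi)) := by
    rw [← e, ← integral_conj, ← integral_neg_eq_self]
    refine integral_congr_ae (ae_of_all _ fun v => ?_)
    simp only [map_mul, ← Complex.exp_conj, map_neg, map_pow, Complex.conj_I, Complex.conj_ofReal]
    push_cast
    rw [hN.neg_pow]
    congr 2
    ring
  rw [kernel_eq hN, e]
  refine (Complex.conj_eq_iff_re.1 ?_)
  rw [map_mul, hreal]
  simp [Complex.conj_ofNat]

theorem continuous_kernel_one {N : ℕ} (hN : Even N) (hN2 : 2 ≤ N) :
    Continuous (kernel N 1) := by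
  have : kernel N 1 = fun x => (1 / (2 * (Real.pi : ℂ))
      * FourierTransform.fourier (symbol N) (x / (2 * Real.pi))).re :=
    funext fun x => by rw [← kernel_one_eq hN, Complex.ofReal_re]
  rw [this]
  have := continuous_fourier_symbol hN hN2
  fun_prop

theorem integrable_kernel_one {N : ℕ} (hN : Even N) (hN2 : 2 ≤ N) :
    Integrable (kernel N 1) := by
  have : kernel N 1 = fun x => (1 / (2 * (Real.pi : ℂ))
      * FourierTransform.fourier (symbol N) (x / (2 * Real.pi))).re :=
    funext fun x => by rw [← kernel_one_eq hN, Complex.ofReal_re]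
  rw [this]
  exact (((integrable_fourier_symbol hN hN2).comp_div (by positivity)).const_mul _).re

theorem fourier_kernel_one {N : ℕ} (hN : Even N) (hN2 : 2 ≤ N) (u : ℝ) :
    ∫ x : ℝ, Complex.exp (Complex.I * u * x) * (kernel N 1 x : ℂ) = symbol N u := by
  have hpi : (Real.pi : ℂ) ≠ 0 := by exact_mod_cast Real.pi_ne_zero
  have h := congrFun ((continuous_symbol N).fourierInv_fourier_eq (integrable_symbol hN hN2)
    (integrable_fourier_symbol hN hN2)) u
  rw [← h, Real.fourierInv_eq_fourier_neg, Real.fourier_real_eq_integral_exp_smul]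
  have := Measure.integral_comp_div (fun v : ℝ => Complex.exp (Complex.I * u * (2 * Real.pi * v))
    * FourierTransform.fourier (symbol N) v) (2 * Real.pi)
  have e : ∀ x : ℝ, Complex.exp (Complex.I * u * x) * (kernel N 1 x : ℂ)
      = (1 / (2 * (Real.pi : ℂ))) * (Complex.exp (Complex.I * u * (2 * Real.pi * (x / (2 * Real.pi) : ℝ)))
    * FourierTransform.fourier (symbol N) (x / (2 * Real.pi))) := by
    intro x
    rw [kernel_one_eq hN, mul_left_comm]
    push_cast
    congr 3
    field_simp
  simp_rw [e]
  rw [integral_const_mul, this, abs_of_pos (by positivity), Complex.real_smul, ← mul_assoc]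
  push_cast
  rw [one_div, inv_mul_cancel₀ (by simp [hpi]), one_mul]
  refine integral_congr_ae (ae_of_all _ fun v => ?_)
  simp only [smul_eq_mul]
  congr 2
  ring

/-! ### The roots of `κ_N` -/

theorem kappa_mul_self (N : ℕ) : (kappa N : ℂ) * kappa N = 1 := by
  unfold kappa
  push_cast
  rw [← mul_pow]
  simp

theorem kappa_ne_zero (N : ℕ) : (kappa N : ℂ) ≠ 0 :=
  left_ne_zero_of_mul_eq_one (kappa_mul_self N)

theorem mem_rootsJ {N : ℕ} (hN2 : 2 ≤ N) {θ : ℂ} :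
    θ ∈ rootsJ N ↔ θ ^ N = kappa N ∧ 0 < θ.re := by
  rw [rootsJ, Finset.mem_filter, Polynomial.mem_nthRootsFinset (by omega)]

theorem mem_rootsK {N : ℕ} (hN2 : 2 ≤ N) {θ : ℂ} :
    θ ∈ rootsK N ↔ θ ^ N = kappa N ∧ θ.re < 0 := by
  rw [rootsK, Finset.mem_filter, Polynomial.mem_nthRootsFinset (by omega)]

theorem neg_mem_rootsK_iff {N : ℕ} (hN : Even N) (hN2 : 2 ≤ N) {θ : ℂ} :
    -θ ∈ rootsK N ↔ θ ∈ rootsJ N := by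
  rw [mem_rootsK hN2, mem_rootsJ hN2, hN.neg_pow]
  simp

theorem rootsK_eq_image {N : ℕ} (hN : Even N) (hN2 : 2 ≤ N) :
    rootsK N = (rootsJ N).image fun θ => -θ := by
  ext θ
  rw [Finset.mem_image]
  refine ⟨fun h => ⟨-θ, ?_, neg_neg θ⟩, ?_⟩
  · rwa [← neg_mem_rootsK_iff hN hN2, neg_neg]
  · rintro ⟨η, hη, rfl⟩
    exact (neg_mem_rootsK_iff hN hN2).2 hη

theorem conj_mem_rootsJ {N : ℕ} (hN2 : 2 ≤ N) {θ : ℂ} (h : θ ∈ rootsJ N) :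
    (starRingEnd ℂ) θ ∈ rootsJ N := by
  rw [mem_rootsJ hN2] at h ⊢
  exact ⟨by rw [← map_pow, h.1, Complex.conj_ofReal], by simpa using h.2⟩

theorem conj_mem_rootsK {N : ℕ} (hN2 : 2 ≤ N) {θ : ℂ} (h : θ ∈ rootsK N) :
    (starRingEnd ℂ) θ ∈ rootsK N := by
  rw [mem_rootsK hN2] at h ⊢
  exact ⟨by rw [← map_pow, h.1, Complex.conj_ofReal], by simpa using h.2⟩

/-- No root of `κ_N` is purely imaginary. -/
theorem re_ne_zero_of_pow_eq_kappa {N : ℕ} (hN : Even N) {θ : ℂ} (h : θ ^ N = kappa N) :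
    θ.re ≠ 0 := by
  intro h0
  have e : θ = -(Complex.I * ((-θ.im : ℝ) : ℂ)) := by
    apply Complex.ext <;> simp [h0]
  have := kappa_mul_pow hN ((-θ.im : ℝ) : ℂ)
  rw [← e, h, kappa_mul_self] at this
  have h2 : (1 : ℝ) = -(-θ.im) ^ N := by exact_mod_cast this
  linarith [hN.pow_nonneg (-θ.im)]

theorem prod_rootsJ_mul_prod_rootsK {N : ℕ} (hN : Even N) (hN2 : 2 ≤ N) (f : ℂ → ℂ) :
    (∏ θ ∈ rootsJ N, f θ) * ∏ θ ∈ rootsK N, f θ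
      = ∏ θ ∈ Polynomial.nthRootsFinset N (kappa N : ℂ), f θ := by
  have : rootsK N
      = (Polynomial.nthRootsFinset N (kappa N : ℂ)).filter fun θ => ¬ 0 < θ.re := by
    refine Finset.filter_congr fun θ hθ => ?_
    rw [Polynomial.mem_nthRootsFinset (by omega)] at hθ
    have := re_ne_zero_of_pow_eq_kappa hN hθ
    exact ⟨fun h => not_lt.2 h.le, fun h => lt_of_le_of_ne (not_lt.1 h) this⟩
  rw [this, rootsJ, Finset.prod_filter_mul_prod_filter_not]

theorem prod_roots_mul_sub {N : ℕ} (hN : Even N) (hN2 : 2 ≤ N) (y z : ℂ) :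
    (∏ θ ∈ rootsJ N, (θ * y - z)) * ∏ θ ∈ rootsK N, (θ * y - z) = z ^ N - kappa N * y ^ N := by
  classical
  rw [prod_rootsJ_mul_prod_rootsK hN hN2]
  set p : Polynomial ℂ := Polynomial.X ^ N - Polynomial.C (kappa N : ℂ) with hp
  have hsep : p.Separable := Polynomial.separable_X_pow_sub_C _
    (by exact_mod_cast (by omega : N ≠ 0)) (kappa_ne_zero N)
  have hval : (Polynomial.nthRootsFinset N (kappa N : ℂ)).val = p.roots := by
    rw [Polynomial.nthRootsFinset_def, Multiset.toFinset_val, Multiset.dedup_eq_self.2]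
    · rfl
    · exact Polynomial.nodup_roots hsep
  have hcard : (Polynomial.nthRootsFinset N (kappa N : ℂ)).card = N := by
    rw [Finset.card_def, hval, ← (IsAlgClosed.splits p).natDegree_eq_card_roots,
      Polynomial.natDegree_X_pow_sub_C]
  have heval (w : ℂ) : ∏ θ ∈ Polynomial.nthRootsFinset N (kappa N : ℂ), (w - θ)
      = w ^ N - kappa N := by
    have := (IsAlgClosed.splits p).eval_eq_prod_roots_of_monic
      (Polynomial.monic_X_pow_sub_C _ (by omega)) w
    rw [← hval] at this
    simpa [hp] using this.symm
  rcases eq_or_ne y 0 with rfl | hy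
  · simp [hcard, hN.neg_pow, show N ≠ 0 by omega]
  · have : ∀ θ : ℂ, θ * y - z = (-y) * (z / y - θ) := fun θ => by field_simp; ring
    simp_rw [this]
    rw [Finset.prod_mul_distrib, Finset.prod_const, hcard, heval, hN.neg_pow, mul_sub, ← mul_pow,
      mul_div_cancel₀ _ hy]
    ring

theorem I_mul_pow {N : ℕ} (hN : Even N) (μ : ℂ) : (Complex.I * μ) ^ N = -kappa N * μ ^ N := by
  have h := kappa_mul_pow hN μ
  rw [hN.neg_pow] at h
  linear_combination (kappa N : ℂ) * h - (Complex.I * μ) ^ N * kappa_mul_self N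

/-- The factorization of the symbol `y ^ N + μ ^ N`. -/
theorem prod_roots_mul_sub_I {N : ℕ} (hN : Even N) (hN2 : 2 ≤ N) (y μ : ℂ) :
    (∏ θ ∈ rootsJ N, (θ * y - Complex.I * μ)) * ∏ θ ∈ rootsK N, (θ * y - Complex.I * μ)
      = -kappa N * (y ^ N + μ ^ N) := by
  rw [prod_roots_mul_sub hN hN2, I_mul_pow hN]
  ring

theorem prod_roots {N : ℕ} (hN : Even N) (hN2 : 2 ≤ N) :
    (∏ θ ∈ rootsJ N, θ) * ∏ θ ∈ rootsK N, θ = -kappa N := by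
  simpa [show N ≠ 0 by omega] using prod_roots_mul_sub hN hN2 1 0

theorem rootsJ_sub_ne_zero {N : ℕ} (hN2 : 2 ≤ N) {θ : ℂ} (h : θ ∈ rootsJ N) {y : ℝ} (hy : 0 < y)
    (μ : ℝ) : θ * y - Complex.I * μ ≠ 0 := by
  intro h0
  have := congrArg Complex.re h0
  simp at this
  rcases this with h' | h'
  · exact (((mem_rootsJ hN2).1 h).2).ne' h'
  · exact hy.ne' h'

theorem rootsK_sub_ne_zero {N : ℕ} (hN2 : 2 ≤ N) {θ : ℂ} (h : θ ∈ rootsK N) {y : ℝ} (hy : 0 < y)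
    (μ : ℝ) : θ * y - Complex.I * μ ≠ 0 := by
  intro h0
  have := congrArg Complex.re h0
  simp at this
  rcases this with h' | h'
  · exact (((mem_rootsK hN2).1 h).2).ne h'
  · exact hy.ne' h'

/-- The logarithmic derivative in `y` of the factorization of `y ^ N + μ ^ N`. -/
theorem sum_roots_div {N : ℕ} (hN : Even N) (hN2 : 2 ≤ N) {y : ℝ} (hy : 0 < y) (μ : ℝ) :
    (∑ θ ∈ rootsJ N, θ / (θ * y - Complex.I * μ)) + ∑ θ ∈ rootsK N, θ / (θ * y - Complex.I * μ)
      = N * (y : ℂ) ^ (N - 1) / ((y : ℂ) ^ N + (μ : ℂ) ^ N) := by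
  have hd (θ : ℂ) : HasDerivAt (fun w : ℂ => θ * w - Complex.I * μ) θ y := by
    simpa using ((hasDerivAt_id (y : ℂ)).const_mul θ).sub_const (Complex.I * μ)
  have h1 := logDeriv_prod (s := rootsJ N) (f := fun θ (w : ℂ) => θ * w - Complex.I * μ)
    (x := (y : ℂ)) (fun θ hθ => rootsJ_sub_ne_zero hN2 hθ hy μ)
    (fun θ _ => (hd θ).differentiableAt)
  have h2 := logDeriv_prod (s := rootsK N) (f := fun θ (w : ℂ) => θ * w - Complex.I * μ)
    (x := (y : ℂ)) (fun θ hθ => rootsK_sub_ne_zero hN2 hθ hy μ)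
    (fun θ _ => (hd θ).differentiableAt)
  have h3 := logDeriv_mul (f := fun w : ℂ => ∏ θ ∈ rootsJ N, (θ * w - Complex.I * μ))
    (g := fun w : ℂ => ∏ θ ∈ rootsK N, (θ * w - Complex.I * μ)) (y : ℂ)
    (Finset.prod_ne_zero_iff.2 fun θ hθ => rootsJ_sub_ne_zero hN2 hθ hy μ)
    (Finset.prod_ne_zero_iff.2 fun θ hθ => rootsK_sub_ne_zero hN2 hθ hy μ)
    (by fun_prop) (by fun_prop)
  simp only [logDeriv_apply, (hd _).deriv] at h1 h2 h3
  have hd4 : HasDerivAt (fun w : ℂ => -kappa N * (w ^ N + (μ : ℂ) ^ N))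
      (-kappa N * (N * (y : ℂ) ^ (N - 1))) y :=
    ((hasDerivAt_pow N (y : ℂ)).add_const _).const_mul _
  rw [← h1, ← h2, ← h3, prod_roots_mul_sub_I hN hN2]
  simp_rw [prod_roots_mul_sub_I hN hN2]
  rw [hd4.deriv, mul_div_mul_left _ _ (neg_ne_zero.2 (kappa_ne_zero N))]

/-! ### Partial fractions -/

theorem sum_partial_fractions {S : Finset ℂ} (hS : S.Nonempty) {s : ℂ} (hs : ∀ θ ∈ S, θ ≠ s) :
    ∑ θ ∈ S, (∏ η ∈ S.erase θ, η / (η - θ)) * θ / (θ - s) = ∏ θ ∈ S, θ / (θ - s) := by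
  have h := congrArg (Polynomial.eval s)
    (Lagrange.sum_basis (s := S) (v := fun θ : ℂ => θ) (fun _ _ _ _ h => h) hS)
  rw [Polynomial.eval_finsetSum, Polynomial.eval_one] at h
  rw [← mul_one (∏ θ ∈ S, θ / (θ - s)), ← h, Finset.mul_sum]
  refine Finset.sum_congr rfl fun θ hθ => ?_
  rw [Lagrange.basis, Polynomial.eval_prod, ← Finset.mul_prod_erase S _ hθ, mul_assoc,
    ← Finset.prod_mul_distrib, mul_div_assoc, mul_comm]
  congr 1
  refine Finset.prod_congr rfl fun η hη => ?_
  have h1 : η - s ≠ 0 := sub_ne_zero.2 (hs η (Finset.mem_of_mem_erase hη))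
  have h2 : η - θ ≠ 0 := sub_ne_zero.2 (Finset.ne_of_mem_erase hη)
  have h3 : θ - η ≠ 0 := sub_ne_zero.2 (Finset.ne_of_mem_erase hη).symm
  simp only [Lagrange.basisDivisor, Polynomial.eval_mul, Polynomial.eval_C, Polynomial.eval_sub,
    Polynomial.eval_X]
  field_simp
  ring

theorem sum_partial_fractions_scaled {S : Finset ℂ} (hS : S.Nonempty) {y : ℝ} (hy : 0 < y) {s : ℂ}
    (hs : ∀ θ ∈ S, θ * y - s ≠ 0) :
    ∑ θ ∈ S, (∏ η ∈ S.erase θ, η / (η - θ)) * θ / (θ * y - s)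
      = ((y ^ ((S.card : ℝ) - 1) : ℝ) : ℂ) * ∏ θ ∈ S, θ / (θ * y - s) := by
  have hy' : (y : ℂ) ≠ 0 := by exact_mod_cast hy.ne'
  have hne : ∀ θ ∈ S, θ ≠ s / y := by
    intro θ hθ h
    apply hs θ hθ
    rw [h, div_mul_cancel₀ _ hy', sub_self]
  have h := sum_partial_fractions hS hne
  have e (θ : ℂ) : θ - s / y = (θ * y - s) / y := by field_simp
  simp_rw [e, div_div_eq_mul_div, mul_div_right_comm _ (y : ℂ)] at h
  rw [← Finset.sum_mul, Finset.prod_mul_distrib, Finset.prod_const] at h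
  rw [Real.rpow_sub hy, Real.rpow_natCast, Real.rpow_one]
  push_cast
  rw [div_mul_eq_mul_div, eq_div_iff hy', h, mul_comm]

theorem rootsJ_nonempty {N : ℕ} (hN : Even N) (hN2 : 2 ≤ N) : (rootsJ N).Nonempty := by
  rw [Finset.nonempty_iff_ne_empty]
  intro h
  have hK : rootsK N = ∅ := by rw [rootsK_eq_image hN hN2, h, Finset.image_empty]
  have h0 := prod_roots_mul_sub hN hN2 1 0
  have h1 := prod_roots_mul_sub hN hN2 1 1
  rw [h, hK] at h0 h1
  simp only [Finset.prod_empty, one_pow, zero_pow (show N ≠ 0 by omega)] at h0 h1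
  exact kappa_ne_zero N (by linear_combination h1)

theorem rootsK_nonempty {N : ℕ} (hN : Even N) (hN2 : 2 ≤ N) : (rootsK N).Nonempty := by
  rw [rootsK_eq_image hN hN2]
  exact (rootsJ_nonempty hN hN2).image _

/-! ### Exponential sums over the roots -/

theorem sum_eq_ofReal_re_of_conj {S : Finset ℂ} (hS : ∀ θ ∈ S, (starRingEnd ℂ) θ ∈ S) {F : ℂ → ℂ}
    (hF : ∀ θ, F ((starRingEnd ℂ) θ) = (starRingEnd ℂ) (F θ)) :
    (((∑ θ ∈ S, F θ).re : ℝ) : ℂ) = ∑ θ ∈ S, F θ := by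
  refine Complex.conj_eq_iff_re.1 ?_
  rw [map_sum]
  exact Finset.sum_nbij' (starRingEnd ℂ) (starRingEnd ℂ) hS hS (by simp) (by simp)
    fun θ _ => (hF θ).symm

theorem prod_erase_conj {S : Finset ℂ} (hS : ∀ θ ∈ S, (starRingEnd ℂ) θ ∈ S) (θ : ℂ) :
    ∏ η ∈ S.erase ((starRingEnd ℂ) θ), η / (η - (starRingEnd ℂ) θ)
      = (starRingEnd ℂ) (∏ η ∈ S.erase θ, η / (η - θ)) := by
  rw [map_prod]
  refine Finset.prod_nbij' (starRingEnd ℂ) (starRingEnd ℂ) ?_ ?_ (by simp) (by simp) ?_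
  · intro η hη
    rw [Finset.mem_erase] at hη ⊢
    exact ⟨fun h => hη.1 (by rw [← h, Complex.conj_conj]), hS η hη.2⟩
  · intro η hη
    rw [Finset.mem_erase] at hη ⊢
    exact ⟨fun h => hη.1 ((starRingEnd ℂ).injective h), hS η hη.2⟩
  · intro η _
    simp

theorem coeffA_conj {N : ℕ} (hN2 : 2 ≤ N) (θ : ℂ) :
    coeffA N ((starRingEnd ℂ) θ) = (starRingEnd ℂ) (coeffA N θ) :=
  prod_erase_conj (fun _ h => conj_mem_rootsJ hN2 h) θ

theorem coeffB_conj {N : ℕ} (hN2 : 2 ≤ N) (θ : ℂ) :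
    coeffB N ((starRingEnd ℂ) θ) = (starRingEnd ℂ) (coeffB N θ) :=
  prod_erase_conj (fun _ h => conj_mem_rootsK hN2 h) θ

/-- The function `x ↦ ∑ c(θ) exp(-θ y x)`, the sum being over `θ ∈ S`. -/
def expSum (S : Finset ℂ) (c : ℂ → ℂ) (y x : ℝ) : ℂ :=
  ∑ θ ∈ S, c θ * Complex.exp (-(θ * y * x))

theorem continuous_expSum (S : Finset ℂ) (c : ℂ → ℂ) (y : ℝ) : Continuous (expSum S c y) := by
  unfold expSum
  fun_prop

theorem expSum_eq_ofReal_re {S : Finset ℂ} (hS : ∀ θ ∈ S, (starRingEnd ℂ) θ ∈ S) {c : ℂ → ℂ}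
    (hc : ∀ θ, c ((starRingEnd ℂ) θ) = (starRingEnd ℂ) (c θ)) (y x : ℝ) :
    (((expSum S c y x).re : ℝ) : ℂ) = expSum S c y x := by
  refine sum_eq_ofReal_re_of_conj hS fun θ => ?_
  rw [hc, map_mul, ← Complex.exp_conj]
  simp

theorem integrableOn_exp_rootsJ {N : ℕ} (hN2 : 2 ≤ N) (c : ℂ → ℂ) {y : ℝ} (hy : 0 < y) (μ : ℝ) :
    IntegrableOn (fun x : ℝ => Complex.exp (Complex.I * μ * x) * expSum (rootsJ N) c y x)
      (Set.Ici 0) ∧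
    ∫ x in Set.Ici (0 : ℝ), Complex.exp (Complex.I * μ * x) * expSum (rootsJ N) c y x
      = ∑ θ ∈ rootsJ N, c θ / (θ * y - Complex.I * μ) := by
  have hre {θ : ℂ} (h : θ ∈ rootsJ N) : (-(θ * y - Complex.I * μ)).re < 0 := by
    simpa using mul_pos ((mem_rootsJ hN2).1 h).2 hy
  have e : (fun x : ℝ => Complex.exp (Complex.I * μ * x) * expSum (rootsJ N) c y x)
      = fun x : ℝ => ∑ θ ∈ rootsJ N, c θ * Complex.exp (-(θ * y - Complex.I * μ) * x) := by
    ext x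
    rw [expSum, Finset.mul_sum]
    refine Finset.sum_congr rfl fun θ _ => ?_
    rw [mul_left_comm, ← Complex.exp_add]
    congr 2
    ring
  have hi : ∀ θ ∈ rootsJ N,
      IntegrableOn (fun x : ℝ => c θ * Complex.exp (-(θ * y - Complex.I * μ) * x)) (Set.Ioi 0) :=
    fun θ hθ => (integrableOn_exp_mul_complex_Ioi (hre hθ) 0).const_mul _
  rw [e, integrableOn_Ici_iff_integrableOn_Ioi, integral_Ici_eq_integral_Ioi]
  refine ⟨integrable_finsetSum _ hi, ?_⟩
  rw [integral_finsetSum _ hi]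
  refine Finset.sum_congr rfl fun θ hθ => ?_
  rw [integral_const_mul, integral_exp_mul_complex_Ioi (hre hθ)]
  simp [div_eq_mul_inv, ← inv_neg]

theorem integrableOn_exp_rootsK {N : ℕ} (hN2 : 2 ≤ N) (c : ℂ → ℂ) {y : ℝ} (hy : 0 < y) (μ : ℝ) :
    IntegrableOn (fun x : ℝ => Complex.exp (Complex.I * μ * x) * expSum (rootsK N) c y x)
      (Set.Iio 0) ∧
    ∫ x in Set.Iio (0 : ℝ), Complex.exp (Complex.I * μ * x) * expSum (rootsK N) c y x
      = -∑ θ ∈ rootsK N, c θ / (θ * y - Complex.I * μ) := by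
  have hre {θ : ℂ} (h : θ ∈ rootsK N) : 0 < (-(θ * y - Complex.I * μ)).re := by
    simpa using mul_neg_of_neg_of_pos ((mem_rootsK hN2).1 h).2 hy
  have e : (fun x : ℝ => Complex.exp (Complex.I * μ * x) * expSum (rootsK N) c y x)
      = fun x : ℝ => ∑ θ ∈ rootsK N, c θ * Complex.exp (-(θ * y - Complex.I * μ) * x) := by
    ext x
    rw [expSum, Finset.mul_sum]
    refine Finset.sum_congr rfl fun θ _ => ?_
    rw [mul_left_comm, ← Complex.exp_add]
    congr 2
    ring
  have hi : ∀ θ ∈ rootsK N,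
      IntegrableOn (fun x : ℝ => c θ * Complex.exp (-(θ * y - Complex.I * μ) * x)) (Set.Iic 0) :=
    fun θ hθ => (integrableOn_exp_mul_complex_Iic (hre hθ) 0).const_mul _
  rw [e, ← integrableOn_Iic_iff_integrableOn_Iio, ← integral_Iic_eq_integral_Iio]
  refine ⟨integrable_finsetSum _ hi, ?_⟩
  rw [integral_finsetSum _ hi, ← Finset.sum_neg_distrib]
  refine Finset.sum_congr rfl fun θ hθ => ?_
  rw [integral_const_mul, integral_exp_mul_complex_Iic (hre hθ), Complex.ofReal_zero, mul_zero,
    Complex.exp_zero, div_neg, mul_neg, mul_one_div]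

/-! ### The density -/

/-- The coefficients of the exponential sum that gives the density on `[0, ∞)`. -/
def posCoeff (N : ℕ) (lam nu : ℝ) (θj : ℂ) : ℂ :=
  coeffA N θj * θj * ∑ θk ∈ rootsK N, coeffB N θk * θk /
    (θk * (nthRoot N lam : ℂ) - θj * (nthRoot N (lam + nu) : ℂ))

/-- The coefficients of the exponential sum that gives the density on `(-∞, 0]`. -/
def negCoeff (N : ℕ) (lam nu : ℝ) (θk : ℂ) : ℂ :=
  coeffB N θk * θk * ∑ θj ∈ rootsJ N, coeffA N θj * θj /
    (θk * (nthRoot N lam : ℂ) - θj * (nthRoot N (lam + nu) : ℂ))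

/-- The continuous density; the exponential sums are real, and only their real parts are kept. -/
def density (N : ℕ) (lam nu x : ℝ) : ℝ :=
  if 0 ≤ x then
    prefactor N lam nu * (expSum (rootsJ N) (posCoeff N lam nu) (nthRoot N (lam + nu)) x).re
  else prefactor N lam nu * (expSum (rootsK N) (negCoeff N lam nu) (nthRoot N lam) x).re

theorem nthRoot_pos (N : ℕ) {r : ℝ} (hr : 0 < r) : 0 < nthRoot N r := Real.rpow_pos_of_pos hr _

theorem nthRoot_pow {N : ℕ} (hN2 : 2 ≤ N) {r : ℝ} (hr : 0 ≤ r) : nthRoot N r ^ N = r := by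
  rw [nthRoot, one_div]
  exact Real.rpow_inv_natCast_pow hr (by omega)

theorem conj_sum_div {S : Finset ℂ} (hS : ∀ θ ∈ S, (starRingEnd ℂ) θ ∈ S) (F : ℂ → ℂ → ℂ)
    (hF : ∀ θ η, F ((starRingEnd ℂ) θ) ((starRingEnd ℂ) η) = (starRingEnd ℂ) (F θ η)) (θ : ℂ) :
    ∑ η ∈ S, F ((starRingEnd ℂ) θ) η = (starRingEnd ℂ) (∑ η ∈ S, F θ η) := by
  rw [map_sum]
  exact (Finset.sum_nbij' (starRingEnd ℂ) (starRingEnd ℂ) hS hS (by simp) (by simp)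
    fun η _ => (hF θ η).symm).symm

theorem posCoeff_conj {N : ℕ} (hN2 : 2 ≤ N) (lam nu : ℝ) (θ : ℂ) :
    posCoeff N lam nu ((starRingEnd ℂ) θ) = (starRingEnd ℂ) (posCoeff N lam nu θ) := by
  unfold posCoeff
  rw [conj_sum_div (fun _ h => conj_mem_rootsK hN2 h) (fun θj θk => coeffB N θk * θk /
    (θk * (nthRoot N lam : ℂ) - θj * (nthRoot N (lam + nu) : ℂ)))]
  · rw [coeffA_conj hN2, map_mul, map_mul]
  · intro θj θk
    simp [coeffB_conj hN2]

theorem negCoeff_conj {N : ℕ} (hN2 : 2 ≤ N) (lam nu : ℝ) (θ : ℂ) :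
    negCoeff N lam nu ((starRingEnd ℂ) θ) = (starRingEnd ℂ) (negCoeff N lam nu θ) := by
  unfold negCoeff
  rw [conj_sum_div (fun _ h => conj_mem_rootsJ hN2 h) (fun θk θj => coeffA N θj * θj /
    (θk * (nthRoot N lam : ℂ) - θj * (nthRoot N (lam + nu) : ℂ)))]
  · rw [coeffB_conj hN2, map_mul, map_mul]
  · intro θj θk
    simp [coeffA_conj hN2]

theorem expSum_zero_eq (N : ℕ) (lam nu : ℝ) :
    expSum (rootsJ N) (posCoeff N lam nu) (nthRoot N (lam + nu)) 0
      = expSum (rootsK N) (negCoeff N lam nu) (nthRoot N lam) 0 := by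
  simp only [expSum, posCoeff, negCoeff, Complex.ofReal_zero, mul_zero, neg_zero, Complex.exp_zero,
    mul_one, Finset.mul_sum]
  rw [Finset.sum_comm]
  refine Finset.sum_congr rfl fun θk _ => Finset.sum_congr rfl fun θj _ => ?_
  ring

theorem density_of_nonneg {N : ℕ} (hN2 : 2 ≤ N) (lam nu : ℝ) {x : ℝ} (hx : 0 ≤ x) :
    (density N lam nu x : ℂ) = prefactor N lam nu *
      expSum (rootsJ N) (posCoeff N lam nu) (nthRoot N (lam + nu)) x := by
  rw [density, if_pos hx, Complex.ofReal_mul, expSum_eq_ofReal_re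
    (fun _ h => conj_mem_rootsJ hN2 h) (posCoeff_conj hN2 lam nu)]

theorem density_of_nonpos {N : ℕ} (hN2 : 2 ≤ N) (lam nu : ℝ) {x : ℝ} (hx : x ≤ 0) :
    (density N lam nu x : ℂ) = prefactor N lam nu *
      expSum (rootsK N) (negCoeff N lam nu) (nthRoot N lam) x := by
  rcases hx.lt_or_eq with hx | rfl
  · rw [density, if_neg (not_le.2 hx), Complex.ofReal_mul, expSum_eq_ofReal_re
      (fun _ h => conj_mem_rootsK hN2 h) (negCoeff_conj hN2 lam nu)]
  · rw [density_of_nonneg hN2 lam nu le_rfl, expSum_zero_eq]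

theorem continuous_density (N : ℕ) (lam nu : ℝ) : Continuous (density N lam nu) := by
  unfold density
  have h1 := continuous_expSum (rootsJ N) (posCoeff N lam nu) (nthRoot N (lam + nu))
  have h2 := continuous_expSum (rootsK N) (negCoeff N lam nu) (nthRoot N lam)
  refine Continuous.if_le (by fun_prop) (by fun_prop) continuous_const continuous_id ?_
  rintro x rfl
  rw [expSum_zero_eq]

theorem integrable_density {N : ℕ} (hN2 : 2 ≤ N) {lam nu : ℝ} (hlam : 0 < lam) (hnu : 0 < nu) :
    Integrable (density N lam nu) := by
  rw [← integrableOn_univ, ← Set.Iio_union_Ici (a := (0 : ℝ)), integrableOn_union]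
  constructor
  · have h := (integrableOn_exp_rootsK hN2 (negCoeff N lam nu) (nthRoot_pos N hlam) 0).1
    refine IntegrableOn.congr_fun (h.re.const_mul (prefactor N lam nu)) ?_ measurableSet_Iio
    intro x hx
    simp [density, not_le.2 (Set.mem_Iio.1 hx)]
  · have h := (integrableOn_exp_rootsJ hN2 (posCoeff N lam nu)
      (nthRoot_pos N (add_pos hlam hnu)) 0).1
    refine IntegrableOn.congr_fun (h.re.const_mul (prefactor N lam nu)) ?_ measurableSet_Ici
    intro x hx
    simp [density, Set.mem_Ici.1 hx]

theorem prefactor_mul {N : ℕ} {lam nu : ℝ} (hlam : 0 < lam) (hnu : 0 < nu) :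
    prefactor N lam nu * (nthRoot N lam ^ (((rootsK N).card : ℝ) - 1)
      * nthRoot N (lam + nu) ^ (((rootsJ N).card : ℝ) - 1)) = 1 := by
  have h1 := Real.rpow_pos_of_pos hlam ((((rootsK N).card : ℝ) - 1) / N)
  have h2 := Real.rpow_pos_of_pos (add_pos hlam hnu) ((((rootsJ N).card : ℝ) - 1) / N)
  rw [prefactor, nthRoot, nthRoot, ← Real.rpow_mul hlam.le, ← Real.rpow_mul (add_pos hlam hnu).le,
    div_mul_eq_mul_div, one_mul, div_mul_eq_mul_div, div_mul_eq_mul_div, one_mul, one_mul]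
  exact div_self (by positivity)

/-- The Fourier transform of the density: the partial fraction expansion in `i μ` of the product
of the inverse Wiener–Hopf factors. -/
theorem fourier_density {N : ℕ} (hN : Even N) (hN2 : 2 ≤ N) {lam nu : ℝ} (hlam : 0 < lam)
    (hnu : 0 < nu) (μ : ℝ) :
    ∫ x : ℝ, Complex.exp (Complex.I * μ * x) * (density N lam nu x : ℂ)
      = -kappa N / ((∏ θ ∈ rootsJ N, (θ * nthRoot N (lam + nu) - Complex.I * μ))
        * ∏ θ ∈ rootsK N, (θ * nthRoot N lam - Complex.I * μ)) := by
  have hα := nthRoot_pos N (add_pos hlam hnu)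
  have hβ := nthRoot_pos N hlam
  set α := nthRoot N (lam + nu) with hαd
  set β := nthRoot N lam with hβd
  have hJ0 : ∀ θ ∈ rootsJ N, θ * α - Complex.I * μ ≠ 0 :=
    fun θ h => rootsJ_sub_ne_zero hN2 h hα μ
  have hK0 : ∀ θ ∈ rootsK N, θ * β - Complex.I * μ ≠ 0 :=
    fun θ h => rootsK_sub_ne_zero hN2 h hβ μ
  have hJ := (integrableOn_exp_rootsJ hN2 (posCoeff N lam nu) hα μ).2
  have hK := (integrableOn_exp_rootsK hN2 (negCoeff N lam nu) hβ μ).2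
  have hint := integrable_exp_mul (integrable_density hN2 hlam hnu) μ
  have split := integral_add_compl (measurableSet_Ici (a := (0 : ℝ))) hint
  rw [Set.compl_Ici] at split
  have e1 : ∫ x in Set.Ici (0 : ℝ), Complex.exp (Complex.I * μ * x) * (density N lam nu x : ℂ)
      = prefactor N lam nu * ∑ θ ∈ rootsJ N, posCoeff N lam nu θ / (θ * α - Complex.I * μ) := by
    rw [← hJ, ← integral_const_mul]
    refine setIntegral_congr_fun measurableSet_Ici fun x hx => ?_
    simp only [density_of_nonneg hN2 lam nu (Set.mem_Ici.1 hx)]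
    ring
  have e2 : ∫ x in Set.Iio (0 : ℝ), Complex.exp (Complex.I * μ * x) * (density N lam nu x : ℂ)
      = prefactor N lam nu * -∑ θ ∈ rootsK N, negCoeff N lam nu θ / (θ * β - Complex.I * μ) := by
    rw [← hK, ← integral_const_mul]
    refine setIntegral_congr_fun measurableSet_Iio fun x hx => ?_
    simp only [density_of_nonpos hN2 lam nu (Set.mem_Iio.1 hx).le]
    ring
  have pJ := sum_partial_fractions_scaled (rootsJ_nonempty hN hN2) hα hJ0
  have pK := sum_partial_fractions_scaled (rootsK_nonempty hN hN2) hβ hK0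
  change ∑ θ ∈ rootsJ N, coeffA N θ * θ / _ = _ at pJ
  change ∑ θ ∈ rootsK N, coeffB N θ * θ / _ = _ at pK
  have comb : (∑ θ ∈ rootsJ N, posCoeff N lam nu θ / (θ * α - Complex.I * μ))
      - ∑ θ ∈ rootsK N, negCoeff N lam nu θ / (θ * β - Complex.I * μ)
      = (∑ θ ∈ rootsJ N, coeffA N θ * θ / (θ * α - Complex.I * μ))
        * ∑ θ ∈ rootsK N, coeffB N θ * θ / (θ * β - Complex.I * μ) := by
    rw [Finset.sum_mul_sum]
    simp only [posCoeff, negCoeff, Finset.mul_sum, Finset.sum_div]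
    rw [Finset.sum_comm (s := rootsK N), ← Finset.sum_sub_distrib]
    refine Finset.sum_congr rfl fun θj hj => ?_
    rw [← Finset.sum_sub_distrib]
    refine Finset.sum_congr rfl fun θk hk => ?_
    have h1 := hJ0 θj hj
    have h2 := hK0 θk hk
    -- the poles of the two factors lie in opposite half-planes
    have h3 : θk * β - θj * α ≠ 0 := by
      intro h0
      have h := congrArg Complex.re h0
      have k1 := mul_pos ((mem_rootsJ hN2).1 hj).2 hα
      have k2 := mul_neg_of_neg_of_pos ((mem_rootsK hN2).1 hk).2 hβ
      simp at h
      linarith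
    rw [← hαd, ← hβd]
    field_simp
    ring
  have hpre : (prefactor N lam nu : ℂ) * (((β ^ (((rootsK N).card : ℝ) - 1) : ℝ) : ℂ)
      * ((α ^ (((rootsJ N).card : ℝ) - 1) : ℝ) : ℂ)) = 1 := by
    rw [← Complex.ofReal_mul, ← Complex.ofReal_mul, prefactor_mul hlam hnu, Complex.ofReal_one]
  rw [← split, e1, e2, ← mul_add, ← sub_eq_add_neg, comb, pJ, pK, Finset.prod_div_distrib,
    Finset.prod_div_distrib, ← prod_roots hN hN2, mul_div_mul_comm]
  linear_combination ((∏ θ ∈ rootsJ N, θ) / (∏ θ ∈ rootsJ N, (θ * α - Complex.I * μ))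
    * ((∏ θ ∈ rootsK N, θ) / ∏ θ ∈ rootsK N, (θ * β - Complex.I * μ))) * hpre

/-! ### The half-line transform of the elementary solution -/

/-- `∫ exp(i u x) p(1; x) dx` over `[0, ∞)`. By scaling, the integral of `exp(i μ x) p(t; x)` over
`[0, ∞)` is the value at `u = μ t^(1/N)`. -/
def halfTransform (N : ℕ) (u : ℝ) : ℂ :=
  ∫ x in Set.Ici (0 : ℝ), Complex.exp (Complex.I * u * x) * (kernel N 1 x : ℂ)

theorem norm_exp_I_mul_mul (u x : ℝ) : ‖Complex.exp (Complex.I * u * x)‖ = 1 := by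
  rw [show Complex.I * u * x = ((u * x : ℝ) : ℂ) * Complex.I by push_cast; ring,
    Complex.norm_exp_ofReal_mul_I]

theorem norm_halfTransform_le {N : ℕ} (hN : Even N) (hN2 : 2 ≤ N) (u : ℝ) :
    ‖halfTransform N u‖ ≤ ∫ x, ‖kernel N 1 x‖ := by
  refine (norm_integral_le_integral_norm _).trans ?_
  simp only [norm_mul, norm_exp_I_mul_mul, one_mul, Complex.norm_real]
  exact setIntegral_le_integral (integrable_kernel_one hN hN2).norm
    (ae_of_all _ fun x => norm_nonneg _)

theorem continuous_halfTransform {N : ℕ} (hN : Even N) (hN2 : 2 ≤ N) :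
    Continuous (halfTransform N) := by
  have hc := continuous_kernel_one hN hN2
  refine continuous_of_dominated (bound := fun x => ‖kernel N 1 x‖) (fun u => ?_) (fun u => ?_)
    (integrable_kernel_one hN hN2).norm.integrableOn (ae_of_all _ fun x => ?_)
  · exact Continuous.aestronglyMeasurable (by fun_prop)
  · refine ae_of_all _ fun x => ?_
    rw [norm_mul, norm_exp_I_mul_mul, one_mul, Complex.norm_real]
  · fun_prop

theorem halfTransform_neg {N : ℕ} (hN : Even N) (u : ℝ) :
    halfTransform N (-u)
      = ∫ x in Set.Iio (0 : ℝ), Complex.exp (Complex.I * u * x) * (kernel N 1 x : ℂ) := by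
  have := integral_comp_neg_Iic (0 : ℝ)
    fun x : ℝ => Complex.exp (Complex.I * (-u : ℝ) * x) * (kernel N 1 x : ℂ)
  rw [halfTransform, integral_Ici_eq_integral_Ioi, ← integral_Iic_eq_integral_Iio, ← neg_zero,
    ← this]
  simp only [kernel_neg hN, neg_zero]
  congr 1
  ext x
  push_cast
  congr 2
  ring

theorem halfTransform_add_neg {N : ℕ} (hN : Even N) (hN2 : 2 ≤ N) (u : ℝ) :
    halfTransform N u + halfTransform N (-u) = symbol N u := by
  have := integral_add_compl (measurableSet_Ici (a := (0 : ℝ)))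
    (integrable_exp_mul (integrable_kernel_one hN hN2) u)
  rwa [Set.compl_Ici, fourier_kernel_one hN hN2, ← halfTransform_neg hN] at this

theorem IsTransformOn.mono {S T : Set ℝ} {F : ℝ → ℂ} (hF : IsTransformOn S F) (h : S ⊆ T) :
    IsTransformOn T F := by
  obtain ⟨m₁, m₂, i₁, i₂, h₁, h₂, e⟩ := hF
  exact ⟨m₁, m₂, i₁, i₂, h₁.mono fun x hx => h hx, h₂.mono fun x hx => h hx, e⟩

theorem IsTransformOn.comp_mul {S T : Set ℝ} {F : ℝ → ℂ} (hF : IsTransformOn S F)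
    (hT : MeasurableSet T) {c : ℝ} (h : ∀ x ∈ S, c * x ∈ T) :
    IsTransformOn T fun t => F (c * t) := by
  obtain ⟨m₁, m₂, i₁, i₂, h₁, h₂, e⟩ := hF
  refine ⟨m₁.map (c * ·), m₂.map (c * ·), inferInstance, inferInstance, ?_, ?_, fun t => ?_⟩
  · exact (ae_map_iff (by fun_prop) hT).2 (h₁.mono fun x hx => h x hx)
  · exact (ae_map_iff (by fun_prop) hT).2 (h₂.mono fun x hx => h x hx)
  · simp only [charFun_map_mul, e]

theorem isTransformOn_halfTransform {N : ℕ} (hN : Even N) (hN2 : 2 ≤ N) :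
    IsTransformOn (Set.Ioi 0) (halfTransform N) :=
  (isTransformOn_of_density measurableSet_Ioi (integrable_kernel_one hN hN2).integrableOn
    (continuous_kernel_one hN hN2).measurable).congr fun _ => integral_Ici_eq_integral_Ioi

/-- A mixture of dilations of a transform carried by `(0, ∞)` is a transform carried by
`(0, ∞)`. -/
theorem IsTransformOn.mixture {F : ℝ → ℂ} (hF : IsTransformOn (Set.Ioi 0) F) {w c : ℝ → ℝ}
    (hw : IntegrableOn w (Set.Ioi 0)) (hwm : Measurable w) (hw0 : ∀ t, 0 ≤ w t)
    (hc : Measurable c) (hc0 : ∀ t, 0 < t → 0 < c t) :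
    IsTransformOn (Set.Ioi 0) fun u => ∫ t in Set.Ioi (0 : ℝ), (w t : ℂ) * F (c t * u) := by
  set ν : Measure ℝ := (volume.restrict (Set.Ioi 0)).withDensity fun t => ENNReal.ofReal (w t)
    with hν
  have hνf : IsFiniteMeasure ν := isFiniteMeasure_withDensity_ofReal hw.2
  have hνpos : ∀ᵐ t ∂ν, 0 < t :=
    (withDensity_absolutelyContinuous _ _).ae_le (ae_restrict_mem measurableSet_Ioi)
  have carried (m : Measure ℝ) [IsFiniteMeasure m] (h : ∀ᵐ x ∂m, x ∈ Set.Ioi (0 : ℝ)) :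
      ∀ᵐ x ∂((ν.prod m).map fun p => c p.1 * p.2), x ∈ Set.Ioi (0 : ℝ) := by
    refine (ae_map_iff (by fun_prop) measurableSet_Ioi).2 ?_
    filter_upwards [Measure.quasiMeasurePreserving_fst.ae hνpos,
      Measure.quasiMeasurePreserving_snd.ae h] with p h1 h2 using mul_pos (hc0 _ h1) h2
  have hval (m : Measure ℝ) [IsFiniteMeasure m] (u : ℝ) :
      IntegrableOn (fun t => (w t : ℂ) * charFun m (c t * u)) (Set.Ioi 0) ∧
      charFun ((ν.prod m).map fun p => c p.1 * p.2) u
        = ∫ t in Set.Ioi (0 : ℝ), (w t : ℂ) * charFun m (c t * u) := by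
    constructor
    · refine Integrable.mul_bdd (c := m.real Set.univ) hw.ofReal ?_
        (ae_of_all _ fun t => norm_charFun_le _)
      exact (measurable_charFun.comp (by fun_prop)).aestronglyMeasurable
    · have hint : Integrable
          (fun p : ℝ × ℝ => Complex.exp (u * (c p.1 * p.2 : ℝ) * Complex.I)) (ν.prod m) := by
        refine (integrable_const (1 : ℝ)).mono (Measurable.aestronglyMeasurable (by fun_prop))
          (ae_of_all _ fun p => ?_)
        rw [← Complex.ofReal_mul, Complex.norm_exp_ofReal_mul_I, norm_one]
      rw [charFun_apply_real, integral_map (by fun_prop) (by fun_prop), integral_prod _ hint, hν,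
        integral_withDensity_eq_integral_toReal_smul (by fun_prop) (by simp)]
      refine integral_congr_ae (ae_of_all _ fun t => ?_)
      simp only [ENNReal.toReal_ofReal (hw0 t), Complex.real_smul, charFun_apply_real]
      congr 2
      ext x
      push_cast
      congr 1
      ring
  obtain ⟨m₁, m₂, i₁, i₂, h₁, h₂, e⟩ := hF
  refine ⟨_, _, inferInstance, inferInstance, carried m₁ h₁, carried m₂ h₂, fun u => ?_⟩
  rw [(hval m₁ u).2, (hval m₂ u).2, ← integral_sub (hval m₁ u).1 (hval m₂ u).1]
  simp only [e, mul_sub]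

theorem integrableOn_exp_neg_mul {s : ℝ} (hs : 0 < s) :
    IntegrableOn (fun t : ℝ => Real.exp (-(s * t))) (Set.Ioi 0) := by
  simpa only [neg_mul] using exp_neg_integrableOn_Ioi 0 hs

theorem measurable_nthRoot (N : ℕ) : Measurable (nthRoot N) := by
  unfold nthRoot
  fun_prop

theorem integrableOn_exp_mul_halfTransform {N : ℕ} (hN : Even N) (hN2 : 2 ≤ N) {s : ℝ}
    (hs : 0 < s) (μ : ℝ) :
    IntegrableOn (fun t : ℝ => (Real.exp (-(s * t)) : ℂ) * halfTransform N (nthRoot N t * μ))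
      (Set.Ioi 0) := by
  refine Integrable.mul_bdd (c := ∫ x, ‖kernel N 1 x‖) (integrableOn_exp_neg_mul hs).ofReal ?_
    (ae_of_all _ fun t => norm_halfTransform_le hN hN2 _)
  exact ((continuous_halfTransform hN hN2).measurable.comp
    ((measurable_nthRoot N).mul_const μ)).aestronglyMeasurable

/-- The Laplace transform in time of the half-line transform. Both sides are parts carried by
`[0, ∞)` in a splitting of `1 / (s + μ ^ N)`, the explicit one coming from partial fractions. -/
theorem laplace_halfTransform {N : ℕ} (hN : Even N) (hN2 : 2 ≤ N) {s : ℝ} (hs : 0 < s) (μ : ℝ) :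
    ∫ t in Set.Ioi (0 : ℝ), (Real.exp (-(s * t)) : ℂ) * halfTransform N (nthRoot N t * μ)
      = (nthRoot N s / (N * s) : ℝ) *
        ∑ θ ∈ rootsJ N, θ / (θ * nthRoot N s - Complex.I * μ) := by
  have hy := nthRoot_pos N hs
  have hyN := nthRoot_pow hN2 hs.le
  set y := nthRoot N s with hyd
  set L : ℝ → ℂ := fun μ =>
    ∫ t in Set.Ioi (0 : ℝ), (Real.exp (-(s * t)) : ℂ) * halfTransform N (nthRoot N t * μ) with hL
  have hLt : IsTransformOn (Set.Ioi 0) L :=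
    (isTransformOn_halfTransform hN hN2).mixture (integrableOn_exp_neg_mul hs) (by fun_prop)
      (fun t => (Real.exp_pos _).le) (measurable_nthRoot N) (fun t ht => nthRoot_pos N ht)
  have hL1 : IsTransformOn (Set.Ici 0) L := hLt.mono Set.Ioi_subset_Ici_self
  have hL2 : IsTransformOn (Set.Iio 0) fun μ => L (-1 * μ) :=
    hLt.comp_mul measurableSet_Iio fun x hx => by
      rw [Set.mem_Iio]; linarith [Set.mem_Ioi.1 hx]
  have reJ (x : ℝ) := expSum_eq_ofReal_re (fun _ h => conj_mem_rootsJ hN2 h)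
    (c := fun θ => θ) (fun θ => rfl) y x
  have reK (x : ℝ) := expSum_eq_ofReal_re (fun _ h => conj_mem_rootsK hN2 h)
    (c := fun θ => θ) (fun θ => rfl) y x
  have hR1 : IsTransformOn (Set.Ici 0) fun μ => ((y / (N * s) : ℝ) : ℂ) *
      ∑ θ ∈ rootsJ N, θ / (θ * y - Complex.I * μ) := by
    refine IsTransformOn.real_smul _ ((isTransformOn_of_density measurableSet_Ici
      (f := fun x => (expSum (rootsJ N) (fun θ => θ) y x).re) ?_ ?_).congr fun μ => ?_)
    · simpa [IntegrableOn] using (integrableOn_exp_rootsJ hN2 (fun θ => θ) hy 0).1.re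
    · exact (Complex.continuous_re.comp (continuous_expSum _ _ _)).measurable
    · simp only [reJ, (integrableOn_exp_rootsJ hN2 (fun θ => θ) hy μ).2]
  have hR2 : IsTransformOn (Set.Iio 0) fun μ => ((y / (N * s) : ℝ) : ℂ) *
      ∑ θ ∈ rootsK N, θ / (θ * y - Complex.I * μ) := by
    refine IsTransformOn.real_smul _ ((isTransformOn_of_density measurableSet_Iio
      (f := fun x => (expSum (rootsK N) (fun θ => θ) y x).re) ?_ ?_).neg.congr fun μ => ?_)
    · simpa [IntegrableOn] using (integrableOn_exp_rootsK hN2 (fun θ => θ) hy 0).1.re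
    · exact (Complex.continuous_re.comp (continuous_expSum _ _ _)).measurable
    · simp only [reK, (integrableOn_exp_rootsK hN2 (fun θ => θ) hy μ).2, neg_neg]
  refine (eq_of_add_eq_add hL1 hR1 hL2 hR2 (fun μ => ?_) μ).1
  have hμN : 0 ≤ μ ^ N := hN.pow_nonneg μ
  have hsμ : ((s : ℂ) + (μ : ℂ) ^ N) ≠ 0 := by
    exact_mod_cast (add_pos_of_pos_of_nonneg hs hμN).ne'
  have hNs : (N : ℂ) ≠ 0 := by exact_mod_cast (by omega : N ≠ 0)
  have hs' : (s : ℂ) ≠ 0 := by exact_mod_cast hs.ne'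
  have right : ((y / (N * s) : ℝ) : ℂ) * (∑ θ ∈ rootsJ N, θ / (θ * y - Complex.I * μ))
      + ((y / (N * s) : ℝ) : ℂ) * ∑ θ ∈ rootsK N, θ / (θ * y - Complex.I * μ)
      = 1 / ((s : ℂ) + (μ : ℂ) ^ N) := by
    have hyc : (y : ℂ) ^ N = s := by exact_mod_cast hyN
    have hyp : (y : ℂ) * (y : ℂ) ^ (N - 1) = s := by
      rw [← pow_succ', show N - 1 + 1 = N by omega, hyc]
    rw [← mul_add, sum_roots_div hN hN2 hy, hyc]
    push_cast
    rw [div_mul_div_comm, div_eq_div_iff (by simp [hNs, hs', hsμ]) hsμ]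
    linear_combination (N * ((s : ℂ) + (μ : ℂ) ^ N)) * hyp
  rw [right]
  simp only [hL]
  rw [← integral_add (integrableOn_exp_mul_halfTransform hN hN2 hs μ)
    (integrableOn_exp_mul_halfTransform hN hN2 hs _)]
  have e : ∀ t ∈ Set.Ioi (0 : ℝ),
      (Real.exp (-(s * t)) : ℂ) * halfTransform N (nthRoot N t * μ)
        + (Real.exp (-(s * t)) : ℂ) * halfTransform N (nthRoot N t * (-1 * μ))
      = Complex.exp (-((s : ℂ) + (μ : ℂ) ^ N) * t) := by
    intro t ht
    rw [← mul_add, show nthRoot N t * (-1 * μ) = -(nthRoot N t * μ) by ring,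
      halfTransform_add_neg hN hN2, symbol, mul_pow, nthRoot_pow hN2 (Set.mem_Ioi.1 ht).le]
    push_cast
    rw [← Complex.exp_add]
    congr 1
    ring
  rw [setIntegral_congr_fun measurableSet_Ioi e, integral_exp_mul_complex_Ioi]
  · simp [div_eq_mul_inv, ← inv_neg]
  · rw [← Complex.ofReal_pow, ← Complex.ofReal_add, ← Complex.ofReal_neg, Complex.ofReal_re]
    linarith

/-- The exponent of a limiting Wiener–Hopf factor. -/
def logFactor (N : ℕ) (lam lam' μ : ℝ) : ℂ :=
  ∫ t in Set.Ioi (0 : ℝ),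
    (((Real.exp (-(lam * t)) - Real.exp (-(lam' * t))) / t : ℝ) : ℂ)
      * halfTransform N (nthRoot N t * μ)

theorem logFactor_eq_integral {N : ℕ} (hN : Even N) (hN2 : 2 ≤ N) {lam lam' : ℝ} (hlam : 0 < lam)
    (hle : lam ≤ lam') (μ : ℝ) :
    logFactor N lam lam' μ = ∫ s in lam..lam', ∫ t in Set.Ioi (0 : ℝ),
      (Real.exp (-(s * t)) : ℂ) * halfTransform N (nthRoot N t * μ) := by
  rw [intervalIntegral.integral_of_le hle, integral_integral_swap]
  · refine setIntegral_congr_fun measurableSet_Ioi fun t ht => ?_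
    have ht' : (-t : ℂ) ≠ 0 := by simpa using (Set.mem_Ioi.1 ht).ne'
    simp only [integral_mul_const]
    congr 1
    rw [← intervalIntegral.integral_of_le hle]
    have := integral_exp_mul_complex (a := lam) (b := lam') ht'
    push_cast
    simp_rw [show ∀ s : ℝ, -((s : ℂ) * t) = -t * s from fun s => by ring]
    rw [this, div_neg, ← neg_div, neg_sub]
  · have h1 : Integrable (fun _ : ℝ => (∫ x, ‖kernel N 1 x‖))
        (volume.restrict (Set.Ioc lam lam')) := integrable_const _
    refine (h1.mul_prod (integrableOn_exp_neg_mul hlam)).mono' ?_ ?_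
    · have := (continuous_halfTransform hN hN2).measurable
      have := measurable_nthRoot N
      exact Measurable.aestronglyMeasurable (by unfold Function.uncurry; fun_prop)
    · rw [Measure.prod_restrict]
      filter_upwards [ae_restrict_mem (measurableSet_Ioc.prod measurableSet_Ioi)] with p hp
      have hp1 : lam < p.1 := hp.1.1
      have hp2 : 0 < p.2 := hp.2
      rw [Function.uncurry, norm_mul, Complex.norm_real, Real.norm_of_nonneg (Real.exp_pos _).le,
        mul_comm]
      gcongr
      exact norm_halfTransform_le hN hN2 _

/-- The limiting Wiener–Hopf factor in closed form: the logarithms exist since the factors have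
positive real part. -/
theorem exp_logFactor {N : ℕ} (hN : Even N) (hN2 : 2 ≤ N) {lam lam' : ℝ} (hlam : 0 < lam)
    (hle : lam ≤ lam') (μ : ℝ) :
    Complex.exp (logFactor N lam lam' μ)
      = ∏ θ ∈ rootsJ N, (θ * nthRoot N lam' - Complex.I * μ) / (θ * nthRoot N lam - Complex.I * μ)
      := by
  have hpos {s : ℝ} (hs : s ∈ Set.uIcc lam lam') : 0 < s := by
    rw [Set.uIcc_of_le hle] at hs
    exact hlam.trans_le hs.1
  have hder : ∀ s ∈ Set.uIcc lam lam', HasDerivAt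
      (fun s : ℝ => ∑ θ ∈ rootsJ N, Complex.log (θ * nthRoot N s - Complex.I * μ))
      ((nthRoot N s / (N * s) : ℝ) * ∑ θ ∈ rootsJ N, θ / (θ * nthRoot N s - Complex.I * μ)) s := by
    intro s hs
    have hs0 := hpos hs
    rw [Finset.mul_sum]
    refine HasDerivAt.fun_sum fun θ hθ => ?_
    have h1 : HasDerivAt (nthRoot N) (nthRoot N s / (N * s)) s := by
      have := Real.hasDerivAt_rpow_const (x := s) (p := 1 / (N : ℝ)) (Or.inl hs0.ne')
      refine this.congr_deriv ?_
      rw [Real.rpow_sub hs0, Real.rpow_one, nthRoot]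
      field_simp
    have h2 := ((h1.ofReal_comp.const_mul θ).sub_const (Complex.I * μ)).clog_real ?_
    · refine h2.congr_deriv ?_
      ring
    · left
      simpa using mul_pos ((mem_rootsJ hN2).1 hθ).2 (nthRoot_pos N hs0)
  rw [logFactor_eq_integral hN hN2 hlam hle]
  rw [intervalIntegral.integral_congr fun s hs => laplace_halfTransform hN hN2 (hpos hs) μ]
  rw [intervalIntegral.integral_eq_sub_of_hasDerivAt hder, ← Finset.sum_sub_distrib,
    Complex.exp_sum]
  · refine Finset.prod_congr rfl fun θ hθ => ?_
    rw [Complex.exp_sub, Complex.exp_log (rootsJ_sub_ne_zero hN2 hθ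
      (nthRoot_pos N (hlam.trans_le hle)) μ), Complex.exp_log (rootsJ_sub_ne_zero hN2 hθ
      (nthRoot_pos N hlam) μ)]
  · refine ContinuousOn.intervalIntegrable fun s hs => ContinuousAt.continuousWithinAt ?_
    have hs0 := hpos hs
    have hc : ContinuousAt (nthRoot N) s := Real.continuousAt_rpow_const _ _ (Or.inl hs0.ne')
    have hN0 : (N : ℝ) * s ≠ 0 := mul_ne_zero (by exact_mod_cast (by omega : N ≠ 0)) hs0.ne'
    refine ContinuousAt.mul (Complex.continuous_ofReal.continuousAt.comp
      (hc.div (by fun_prop) hN0)) (tendsto_finsetSum _ fun θ hθ => ?_)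
    exact ContinuousAt.div continuousAt_const (((Complex.continuous_ofReal.continuousAt.comp hc).const_mul θ).sub
      continuousAt_const) (rootsJ_sub_ne_zero hN2 hθ (nthRoot_pos N hs0) μ)

/-! ### Exponentials of power series -/

/-- The coefficients of the power series `exp(∑ s_i z^(i+1) / (i+1))`, which solves `Y' = S Y`,
`Y(0) = 1` with `S = ∑ s_i z^i`. -/
def expCoeff (s : ℕ → ℂ) : ℕ → ℂ
  | 0 => 1
  | k + 1 => (∑ i : Fin (k + 1), s i * expCoeff s (k - i)) / (k + 1)
decreasing_by omega

theorem expCoeff_zero (s : ℕ → ℂ) : expCoeff s 0 = 1 := by rw [expCoeff]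

theorem expCoeff_succ (s : ℕ → ℂ) (k : ℕ) :
    expCoeff s (k + 1) = (∑ i ∈ Finset.range (k + 1), s i * expCoeff s (k - i)) / (k + 1) := by
  rw [expCoeff, Fin.sum_univ_eq_sum_range (fun i => s i * expCoeff s (k - i))]

open PowerSeries in
theorem derivative_mk_expCoeff (s : ℕ → ℂ) :
    d⁄dX ℂ (PowerSeries.mk (expCoeff s)) = PowerSeries.mk s * PowerSeries.mk (expCoeff s) := by
  ext k
  rw [coeff_derivative, coeff_mul, coeff_mk, expCoeff_succ,
    div_mul_cancel₀ _ (by exact_mod_cast k.succ_ne_zero),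
    Finset.Nat.sum_antidiagonal_eq_sum_range_succ_mk]
  simp

open PowerSeries in
/-- A formal power series is determined by a homogeneous linear differential equation of first
order and by its constant coefficient. -/
theorem powerSeries_eq_of_derivative {W Y Z : PowerSeries ℂ} (hY : d⁄dX ℂ Y = W * Y)
    (hZ : d⁄dX ℂ Z = W * Z) (h0 : coeff 0 Y = coeff 0 Z) : Y = Z := by
  ext k
  induction k using Nat.strong_induction_on with
  | _ k ih =>
    cases k with
    | zero => exact h0
    | succ k =>
      have h1 := congrArg (coeff k) hY
      have h2 := congrArg (coeff k) hZ
      rw [coeff_derivative, coeff_mul] at h1 h2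
      have h3 : ∑ p ∈ Finset.HasAntidiagonal.antidiagonal k, coeff p.1 W * coeff p.2 Y
          = ∑ p ∈ Finset.HasAntidiagonal.antidiagonal k, coeff p.1 W * coeff p.2 Z :=
        Finset.sum_congr rfl fun p hp => by
          rw [ih p.2 (by have := Finset.HasAntidiagonal.mem_antidiagonal.1 hp; omega)]
      have hk : ((k : ℂ) + 1) ≠ 0 := by exact_mod_cast k.succ_ne_zero
      exact mul_right_cancel₀ hk (by rw [h1, h2, h3])

open PowerSeries in
theorem coeff_succ_one_sub_mul_mk (q : ℂ) (f : ℕ → ℂ) (k : ℕ) :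
    coeff (k + 1) ((1 - C q * X) * PowerSeries.mk f) = f (k + 1) - q * f k := by
  rw [sub_mul, one_mul, mul_assoc, map_sub, coeff_C_mul, coeff_succ_X_mul, coeff_mk, coeff_mk]

open PowerSeries in
theorem one_sub_mul_mk_geometric (q : ℂ) :
    (1 - C q * X) * PowerSeries.mk (fun i => q ^ (i + 1)) = C q := by
  ext k
  rw [sub_mul, one_mul, mul_assoc, map_sub, coeff_C_mul]
  cases k with
  | zero => simp
  | succ k => simp [coeff_succ_X_mul, pow_succ']

open PowerSeries in
/-- The Wiener–Hopf identity behind the discrete problem. If `P k + Q k = p ^ k`, then the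
exponentials `M` of `∑ (a^k - b^k) (Q k) z^k / k` and `R` of `∑ (b^k - a^k) (P k) z^k / k` satisfy
`(1 - a p z) M = (1 - b p z) R`. -/
theorem one_sub_mul_expCoeff {P Q : ℕ → ℂ} {p : ℂ} (a b : ℂ)
    (h : ∀ k, P (k + 1) + Q (k + 1) = p ^ (k + 1)) :
    (1 - C (a * p) * X) * PowerSeries.mk (expCoeff fun i => (a ^ (i + 1) - b ^ (i + 1)) * Q (i + 1))
      = (1 - C (b * p) * X) * PowerSeries.mk (expCoeff fun i => (b ^ (i + 1) - a ^ (i + 1)) * P (i + 1)) := by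
  set W : PowerSeries ℂ := -PowerSeries.mk (fun i => a ^ (i + 1) * P (i + 1) + b ^ (i + 1) * Q (i + 1)) with hW
  have hd (q : ℂ) : d⁄dX ℂ (1 - C q * X) = -C q := by
    rw [map_sub]
    simp
  refine powerSeries_eq_of_derivative (W := W) ?_ ?_ ?_
  · have e : PowerSeries.mk (fun i => (a ^ (i + 1) - b ^ (i + 1)) * Q (i + 1))
        = W + PowerSeries.mk (fun i => (a * p) ^ (i + 1)) := by
      ext i
      simp only [hW, map_add, map_neg, coeff_mk, mul_pow, ← h]
      ring
    rw [Derivation.leibniz, derivative_mk_expCoeff, hd, smul_eq_mul, smul_eq_mul, e]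
    linear_combination (PowerSeries.mk (expCoeff fun i => (a ^ (i + 1) - b ^ (i + 1)) * Q (i + 1)))
      * one_sub_mul_mk_geometric (a * p)
  · have e : PowerSeries.mk (fun i => (b ^ (i + 1) - a ^ (i + 1)) * P (i + 1))
        = W + PowerSeries.mk (fun i => (b * p) ^ (i + 1)) := by
      ext i
      simp only [hW, map_add, map_neg, coeff_mk, mul_pow, ← h]
      ring
    rw [Derivation.leibniz, derivative_mk_expCoeff, hd, smul_eq_mul, smul_eq_mul, e]
    linear_combination (PowerSeries.mk (expCoeff fun i => (b ^ (i + 1) - a ^ (i + 1)) * P (i + 1)))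
      * one_sub_mul_mk_geometric (b * p)
  · simp [expCoeff_zero]

theorem exists_norm_expCoeff_le {s : ℕ → ℂ} {B a ρ : ℝ} (hB : 0 ≤ B) (ha : 0 ≤ a) (haρ : a < ρ)
    (hs : ∀ i, ‖s i‖ ≤ B * a ^ (i + 1)) : ∃ D : ℝ, 0 ≤ D ∧ ∀ k, ‖expCoeff s k‖ ≤ D * ρ ^ k := by
  have hρ : 0 < ρ := ha.trans_lt haρ
  set q := B * (1 - a / ρ)⁻¹ with hq
  obtain ⟨n, hn⟩ := exists_nat_ge q
  set D := ∑ k ∈ Finset.range (n + 1), ‖expCoeff s k‖ / ρ ^ k with hD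
  have hD0 : 0 ≤ D := Finset.sum_nonneg fun k _ => by positivity
  refine ⟨D, hD0, fun k => ?_⟩
  induction k using Nat.strong_induction_on with
  | _ k ih =>
    rcases Nat.lt_or_ge k (n + 1) with hk | hk
    · have := Finset.single_le_sum (f := fun k => ‖expCoeff s k‖ / ρ ^ k)
        (fun k _ => by positivity) (Finset.mem_range.2 hk)
      rwa [div_le_iff₀ (by positivity)] at this
    · obtain ⟨m, rfl⟩ : ∃ m, k = m + 1 := ⟨k - 1, by omega⟩
      have hm : (0 : ℝ) < m + 1 := by positivity
      rw [expCoeff_succ, norm_div, show ((m : ℂ) + 1) = ((m + 1 : ℕ) : ℂ) by push_cast; rfl,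
        Complex.norm_natCast, Nat.cast_add_one, div_le_iff₀ hm]
      have hterm : ∀ i ∈ Finset.range (m + 1), ‖s i * expCoeff s (m - i)‖
          ≤ B * D * ρ ^ (m + 1) * (a / ρ) ^ (i + 1) := by
        intro i hi
        have hi' : i < m + 1 := Finset.mem_range.1 hi
        rw [norm_mul]
        calc ‖s i‖ * ‖expCoeff s (m - i)‖ ≤ (B * a ^ (i + 1)) * (D * ρ ^ (m - i)) :=
              mul_le_mul (hs i) (ih _ (by omega)) (norm_nonneg _) (by positivity)
          _ = B * D * ρ ^ (m + 1) * (a / ρ) ^ (i + 1) := by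
              have : ρ ^ (m + 1) = ρ ^ (m - i) * ρ ^ (i + 1) := by
                rw [← pow_add, show (m - i) + (i + 1) = m + 1 by omega]
              rw [div_pow, this]
              field_simp
      refine (norm_sum_le _ _).trans ((Finset.sum_le_sum hterm).trans ?_)
      rw [← Finset.mul_sum]
      have hr0 : 0 ≤ a / ρ := by positivity
      have hr1 : a / ρ < 1 := (div_lt_one hρ).2 haρ
      have hgeo : ∑ i ∈ Finset.range (m + 1), (a / ρ) ^ (i + 1) ≤ (1 - a / ρ)⁻¹ := by
        rw [← tsum_geometric_of_lt_one hr0 hr1]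
        have hsum := summable_geometric_of_lt_one hr0 hr1
        calc ∑ i ∈ Finset.range (m + 1), (a / ρ) ^ (i + 1)
            ≤ ∑ i ∈ Finset.range (m + 1), (a / ρ) ^ i := Finset.sum_le_sum fun i _ =>
              pow_le_pow_of_le_one hr0 hr1.le (Nat.le_succ i)
          _ ≤ _ := hsum.sum_le_tsum _ fun i _ => by positivity
      have hnm : (n : ℝ) ≤ m + 1 := by exact_mod_cast (by omega : n ≤ m + 1)
      calc B * D * ρ ^ (m + 1) * ∑ i ∈ Finset.range (m + 1), (a / ρ) ^ (i + 1)
          ≤ B * D * ρ ^ (m + 1) * (1 - a / ρ)⁻¹ := by gcongr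
        _ = D * ρ ^ (m + 1) * q := by rw [hq]; ring
        _ ≤ D * ρ ^ (m + 1) * (m + 1) := by gcongr; exact hn.trans hnm

/-- When `s` decays geometrically, the series of the coefficients of
`exp(∑ s_i z^(i+1) / (i+1))` converges absolutely at `z = 1`, to the exponential of the sum. -/
theorem tsum_expCoeff {s : ℕ → ℂ} {B a : ℝ} (hB : 0 ≤ B) (ha : 0 ≤ a) (ha1 : a < 1)
    (hs : ∀ i, ‖s i‖ ≤ B * a ^ (i + 1)) :
    (Summable fun k => ‖expCoeff s k‖) ∧
      ∑' k, expCoeff s k = Complex.exp (∑' i, s i / (i + 1)) := by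
  obtain ⟨ρ, haρ, hρ1⟩ := exists_between ha1
  have hρ : 0 < ρ := ha.trans_lt haρ
  obtain ⟨D, hD, hc⟩ := exists_norm_expCoeff_le hB ha haρ hs
  -- a disc around `0` on which both series converge and whose interior contains `1`
  obtain ⟨δ, hδ1, hδ2⟩ := exists_between ((one_lt_inv₀ hρ).2 hρ1)
  have hδ : 0 < δ := one_pos.trans hδ1
  have hρδ : ρ * δ < 1 := by rwa [← lt_inv_mul_iff₀ hρ, mul_one]
  have haδ : a * δ < 1 := (mul_le_mul_of_nonneg_right haρ.le hδ.le).trans_lt hρδ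
  have hball {z : ℂ} (hz : z ∈ Metric.ball (0 : ℂ) δ) : ‖z‖ ≤ δ := by
    simpa using (Metric.mem_ball.1 hz).le
  have zero_mem : (0 : ℂ) ∈ Metric.ball (0 : ℂ) δ := Metric.mem_ball_self hδ
  have one_mem : (1 : ℂ) ∈ Metric.ball (0 : ℂ) δ := by simpa using hδ1
  have nc {z : ℂ} (hz : z ∈ Metric.ball (0 : ℂ) δ) (k : ℕ) :
      ‖expCoeff s k * z ^ k‖ ≤ D * (ρ * δ) ^ k := by
    rw [norm_mul, norm_pow, mul_pow, ← mul_assoc]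
    exact mul_le_mul (hc k) (pow_le_pow_left₀ (norm_nonneg z) (hball hz) k) (by positivity)
      (by positivity)
  have ns {z : ℂ} (hz : z ∈ Metric.ball (0 : ℂ) δ) (i : ℕ) :
      ‖s i * z ^ i‖ ≤ B * a * (a * δ) ^ i := by
    rw [norm_mul, norm_pow]
    calc ‖s i‖ * ‖z‖ ^ i ≤ (B * a ^ (i + 1)) * δ ^ i :=
          mul_le_mul (hs i) (pow_le_pow_left₀ (norm_nonneg z) (hball hz) i) (by positivity)
            (by positivity)
      _ = _ := by rw [mul_pow]; ring
  have sumc : Summable fun k : ℕ => D * (ρ * δ) ^ k :=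
    (summable_geometric_of_lt_one (by positivity) hρδ).mul_left D
  have sums : Summable fun i : ℕ => B * a * (a * δ) ^ i :=
    (summable_geometric_of_lt_one (by positivity) haδ).mul_left _
  have sc {z : ℂ} (hz : z ∈ Metric.ball (0 : ℂ) δ) : Summable fun k => ‖expCoeff s k * z ^ k‖ :=
    Summable.of_nonneg_of_le (fun _ => norm_nonneg _) (nc hz) sumc
  have ss {z : ℂ} (hz : z ∈ Metric.ball (0 : ℂ) δ) : Summable fun i => ‖s i * z ^ i‖ :=
    Summable.of_nonneg_of_le (fun _ => norm_nonneg _) (ns hz) sums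
  have hG {z : ℂ} (hz : z ∈ Metric.ball (0 : ℂ) δ) :
      HasDerivAt (fun w : ℂ => ∑' i, s i / (i + 1) * w ^ (i + 1)) (∑' i, s i * z ^ i) z := by
    refine hasDerivAt_tsum_of_isPreconnected sums Metric.isOpen_ball
      (convex_ball _ _).isPreconnected (fun i w _ => ?_) (fun i w hw => ns hw i) zero_mem ?_ hz
    · refine ((hasDerivAt_pow (i + 1) w).const_mul (s i / (i + 1))).congr_deriv ?_
      have : ((i : ℂ) + 1) ≠ 0 := by exact_mod_cast i.succ_ne_zero
      push_cast
      field_simp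
    · simp [summable_zero]
  have hF {z : ℂ} (hz : z ∈ Metric.ball (0 : ℂ) δ) :
      HasDerivAt (fun w : ℂ => ∑' k, expCoeff s k * w ^ k)
        ((∑' i, s i * z ^ i) * ∑' k, expCoeff s k * z ^ k) z := by
    have hnorm : ‖ρ * δ‖ < 1 := by rwa [Real.norm_of_nonneg (by positivity)]
    have hu0 : Summable fun k : ℕ => (k : ℝ) ^ 1 * (ρ * δ) ^ k :=
      summable_pow_mul_geometric_of_norm_lt_one 1 hnorm
    have hu : Summable fun k : ℕ => D * δ⁻¹ * ((k : ℝ) ^ 1 * (ρ * δ) ^ k) := hu0.mul_left _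
    have nd {w : ℂ} (hw : w ∈ Metric.ball (0 : ℂ) δ) (k : ℕ) :
        ‖expCoeff s k * (k * w ^ (k - 1))‖ ≤ D * δ⁻¹ * ((k : ℝ) ^ 1 * (ρ * δ) ^ k) := by
      cases k with
      | zero => simp
      | succ k =>
        rw [norm_mul, norm_mul, norm_pow, Complex.norm_natCast, Nat.add_sub_cancel]
        calc ‖expCoeff s (k + 1)‖ * (((k + 1 : ℕ) : ℝ) * ‖w‖ ^ k)
            ≤ (D * ρ ^ (k + 1)) * (((k + 1 : ℕ) : ℝ) * δ ^ k) := by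
              gcongr
              · exact hc (k + 1)
              · exact hball hw
          _ = _ := by
              rw [mul_pow, pow_succ δ]
              field_simp
    have h1 := hasDerivAt_tsum_of_isPreconnected (g := fun k (w : ℂ) => expCoeff s k * w ^ k)
      hu Metric.isOpen_ball (convex_ball _ _).isPreconnected
      (fun k w _ => (hasDerivAt_pow k w).const_mul (expCoeff s k)) (fun k w hw => nd hw k)
      zero_mem (sc zero_mem).of_norm hz
    refine h1.congr_deriv ?_
    have hsum : Summable fun k : ℕ => expCoeff s k * (k * z ^ (k - 1)) :=
      Summable.of_norm_bounded hu (nd hz)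
    rw [hsum.tsum_eq_zero_add,
      tsum_mul_tsum_eq_tsum_sum_range_of_summable_norm (ss hz) (sc hz)]
    simp only [Nat.cast_zero, zero_mul, mul_zero, zero_add, Nat.add_sub_cancel]
    refine tsum_congr fun k => ?_
    have hk : ((k : ℂ) + 1) ≠ 0 := by exact_mod_cast k.succ_ne_zero
    rw [expCoeff_succ, Nat.cast_add_one, ← mul_assoc, div_mul_cancel₀ _ hk, Finset.sum_mul]
    refine Finset.sum_congr rfl fun i hi => ?_
    have : z ^ k = z ^ i * z ^ (k - i) := by
      rw [← pow_add, show i + (k - i) = k by have := Finset.mem_range.1 hi; omega]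
    rw [this]
    ring
  have hH {z : ℂ} (hz : z ∈ Metric.ball (0 : ℂ) δ) : HasDerivAt
      (fun w : ℂ => (∑' k, expCoeff s k * w ^ k)
        * Complex.exp (-∑' i, s i / (i + 1) * w ^ (i + 1))) 0 z := by
    refine ((hF hz).mul (hG hz).neg.cexp).congr_deriv ?_
    ring
  have hconst := Metric.isOpen_ball.is_const_of_deriv_eq_zero (convex_ball _ _).isPreconnected
    (fun z hz => (hH hz).differentiableAt.differentiableWithinAt) (fun z hz => (hH hz).deriv)
    one_mem zero_mem
  have hF0 : ∑' k, expCoeff s k * (0 : ℂ) ^ k = 1 := by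
    rw [tsum_eq_single 0 fun k hk => by simp [hk]]
    simp [expCoeff_zero]
  simp only [one_pow, mul_one, hF0] at hconst
  refine ⟨by simpa using sc one_mem, ?_⟩
  simp only [ne_eq, Nat.add_eq_zero_iff, one_ne_zero, and_false, not_false_eq_true, zero_pow,
    mul_zero, tsum_zero, neg_zero, Complex.exp_zero] at hconst
  rw [mul_one, Complex.exp_neg, ← div_eq_mul_inv, div_eq_one_iff_eq (Complex.exp_ne_zero _)] at hconst
  exact hconst

theorem IsTransformOn.expCoeff_succ {S : Set ℝ} (hS : ∀ x ∈ S, ∀ y ∈ S, x + y ∈ S)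
    (hm : MeasurableSet S) {s : ℕ → ℝ → ℂ} (h : ∀ i, IsTransformOn S (s i)) (k : ℕ) :
    IsTransformOn S fun t => expCoeff (fun i => s i t) (k + 1) := by
  induction k using Nat.strong_induction_on with
  | _ k ih =>
    have e (t : ℝ) : expCoeff (fun i => s i t) (k + 1) = (((k + 1 : ℝ)⁻¹ : ℝ) : ℂ) *
        ((∑ i ∈ Finset.range k, s i t * expCoeff (fun i => s i t) (k - i)) + s k t) := by
      rw [PseudoProcess.expCoeff_succ, Finset.sum_range_succ, Nat.sub_self, expCoeff_zero, mul_one,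
        div_eq_mul_inv, mul_comm]
      push_cast
      rfl
    refine (IsTransformOn.real_smul _ ((IsTransformOn.sum _ fun i hi => ?_).add (h k))).congr e
    have hi' : i < k := Finset.mem_range.1 hi
    have := ih (k - i - 1) (by omega)
    rw [show k - i - 1 + 1 = k - i by omega] at this
    exact (h i).mul hS hm this

/-! ### The functionals of the step process -/

/-- The rate at which `lam t + nu T(t)` grows while the process is at `x`. -/
def rate (lam nu x : ℝ) : ℝ := if 0 ≤ x then lam + nu else lam

/-- The factor `exp(-h rate)` contributed by a time step of length `h` spent at `x`. -/
def weight (lam nu h x : ℝ) : ℝ := Real.exp (-(rate lam nu x * h))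

/-- The integral of `exp(-s rate)` over `0 ≤ s ≤ h`. -/
def lastWeight (lam nu h x : ℝ) : ℝ := (1 - weight lam nu h x) / rate lam nu x

theorem measurable_rate (lam nu : ℝ) : Measurable (rate lam nu) :=
  Measurable.ite measurableSet_Ici measurable_const measurable_const

theorem measurable_weight (lam nu h : ℝ) : Measurable (weight lam nu h) := by
  have := measurable_rate lam nu
  unfold weight
  fun_prop

theorem measurable_lastWeight (lam nu h : ℝ) : Measurable (lastWeight lam nu h) := by
  have := measurable_rate lam nu
  have := measurable_weight lam nu h
  unfold lastWeight
  fun_prop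

theorem le_rate (lam : ℝ) {nu : ℝ} (hnu : 0 ≤ nu) (x : ℝ) : lam ≤ rate lam nu x := by
  unfold rate
  split_ifs <;> linarith

theorem weight_pos (lam nu h x : ℝ) : 0 < weight lam nu h x := Real.exp_pos _

theorem weight_le_one {lam nu h : ℝ} (hlam : 0 ≤ lam) (hnu : 0 ≤ nu) (hh : 0 ≤ h) (x : ℝ) :
    weight lam nu h x ≤ 1 := by
  refine Real.exp_le_one_iff.2 ?_
  linarith [mul_nonneg (hlam.trans (le_rate lam hnu x)) hh]

theorem abs_lastWeight_le {lam nu h : ℝ} (hlam : 0 < lam) (hnu : 0 ≤ nu) (hh : 0 ≤ h) (x : ℝ) :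
    |lastWeight lam nu h x| ≤ 1 / lam := by
  have h1 := weight_le_one hlam.le hnu hh x
  have h2 := weight_pos lam nu h x
  have h3 := le_rate lam hnu x
  rw [lastWeight, abs_of_nonneg (div_nonneg (by linarith) (hlam.le.trans h3))]
  exact div_le_div₀ zero_le_one (by linarith) hlam h3

theorem stepProcess_eq {n k : ℕ} {t : ℝ} (ω : ℕ → ℝ) (h1 : (k : ℝ) / 2 ^ n ≤ t)
    (h2 : t < ((k : ℝ) + 1) / 2 ^ n) : stepProcess n ω t = ω k := by
  have hp : (0 : ℝ) < 2 ^ n := by positivity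
  rw [stepProcess]
  congr 1
  rw [Nat.floor_eq_iff (by have := (Nat.cast_nonneg (α := ℝ) k); rw [div_le_iff₀ hp] at h1; linarith)]
  rw [div_le_iff₀ hp] at h1
  rw [lt_div_iff₀ hp] at h2
  constructor <;> linarith

theorem measurable_stepProcess (n : ℕ) (ω : ℕ → ℝ) : Measurable (stepProcess n ω) := by
  unfold stepProcess
  exact (measurable_from_nat (f := ω)).comp (Nat.measurable_floor.comp (by fun_prop))

theorem intervalIntegrable_indicator (n : ℕ) (ω : ℕ → ℝ) (a b : ℝ) : IntervalIntegrable
    (fun s => Set.indicator (Set.Ici (0 : ℝ)) (fun _ => (1 : ℝ)) (stepProcess n ω s))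
    volume a b := by
  have hm : Measurable fun s =>
      Set.indicator (Set.Ici (0 : ℝ)) (fun _ => (1 : ℝ)) (stepProcess n ω s) :=
    (measurable_const.indicator measurableSet_Ici).comp (measurable_stepProcess n ω)
  refine (intervalIntegrable_const (c := (1 : ℝ))).mono_fun hm.aestronglyMeasurable
    (ae_of_all _ fun s => ?_)
  by_cases hs : stepProcess n ω s ∈ Set.Ici (0 : ℝ) <;> simp [hs]

/-- The functional `lam t + nu T_n(t)` is piecewise linear with slopes `rate`. -/
theorem mul_add_mul_sojournTime (lam nu : ℝ) {n k : ℕ} {t : ℝ} (ω : ℕ → ℝ)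
    (h1 : (k : ℝ) / 2 ^ n ≤ t) (h2 : t ≤ ((k : ℝ) + 1) / 2 ^ n) :
    lam * t + nu * sojournTime n ω t
      = (∑ j ∈ Finset.range k, rate lam nu (ω j) * (1 / 2 ^ n))
        + rate lam nu (ω k) * (t - k / 2 ^ n) := by
  set χ : ℝ → ℝ := Set.indicator (Set.Ici (0 : ℝ)) (fun _ => (1 : ℝ)) with hχ
  have hrate (x : ℝ) : rate lam nu x = lam + nu * χ x := by
    by_cases hx : 0 ≤ x <;> simp [rate, hχ, hx]
  have piece {j : ℕ} {s : ℝ} (hs1 : (j : ℝ) / 2 ^ n ≤ s) (hs2 : s ≤ ((j : ℝ) + 1) / 2 ^ n) :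
      ∫ u in (j : ℝ) / 2 ^ n..s, χ (stepProcess n ω u) = (s - j / 2 ^ n) * χ (ω j) := by
    rw [← smul_eq_mul, ← intervalIntegral.integral_const]
    refine intervalIntegral.integral_congr_Ioo_of_le hs1 fun u hu => ?_
    simp only [stepProcess_eq ω hu.1.le (hu.2.trans_le hs2)]
  have hsum := intervalIntegral.sum_integral_adjacent_intervals (μ := volume)
    (f := fun u => χ (stepProcess n ω u)) (a := fun j : ℕ => (j : ℝ) / 2 ^ n) (n := k)
    fun j _ => intervalIntegrable_indicator n ω _ _
  have hsplit := intervalIntegral.integral_add_adjacent_intervals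
    (intervalIntegrable_indicator n ω 0 ((k : ℝ) / 2 ^ n))
    (intervalIntegrable_indicator n ω ((k : ℝ) / 2 ^ n) t)
  simp only [Nat.cast_zero, zero_div] at hsum
  have hT : sojournTime n ω t
      = (∑ j ∈ Finset.range k, 1 / 2 ^ n * χ (ω j)) + (t - k / 2 ^ n) * χ (ω k) := by
    rw [sojournTime, ← hsplit, piece h1 h2, ← hsum]
    congr 1
    refine Finset.sum_congr rfl fun j _ => ?_
    rw [Nat.cast_add_one, piece (by gcongr; linarith) le_rfl]
    congr 1
    ring
  rw [hT]
  simp only [hrate, add_mul, Finset.sum_add_distrib, Finset.sum_const, Finset.card_range, nsmul_eq_mul]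
  rw [mul_add, Finset.mul_sum]
  have : ∑ j ∈ Finset.range k, nu * (1 / 2 ^ n * χ (ω j))
      = ∑ j ∈ Finset.range k, nu * χ (ω j) * (1 / 2 ^ n) :=
    Finset.sum_congr rfl fun j _ => by ring
  rw [this]
  ring

theorem laplaceFourierIntegrand_eq (lam μ nu : ℝ) {n k : ℕ} {t : ℝ} (ω : ℕ → ℝ)
    (h1 : (k : ℝ) / 2 ^ n ≤ t) (h2 : t < ((k : ℝ) + 1) / 2 ^ n) :
    laplaceFourierIntegrand lam μ nu n ω t
      = ((∏ j ∈ Finset.range k, weight lam nu (1 / 2 ^ n) (ω j) : ℝ) : ℂ)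
        * Complex.exp (Complex.I * μ * ω k)
        * Complex.exp (-(rate lam nu (ω k) : ℂ) * (t - k / 2 ^ n)) := by
  have h := mul_add_mul_sojournTime lam nu ω h1 h2.le
  have hw : (∏ j ∈ Finset.range k, weight lam nu (1 / 2 ^ n) (ω j))
      = Real.exp (-∑ j ∈ Finset.range k, rate lam nu (ω j) * (1 / 2 ^ n)) := by
    rw [← Finset.sum_neg_distrib, Real.exp_sum]
    rfl
  rw [laplaceFourierIntegrand, stepProcess_eq ω h1 h2, hw, Complex.ofReal_exp, ← Complex.exp_add,
    ← Complex.exp_add]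
  congr 1
  have hc := congrArg (fun r : ℝ => (r : ℂ)) h
  simp only [Complex.ofReal_add, Complex.ofReal_mul, Complex.ofReal_sub, Complex.ofReal_div,
    Complex.ofReal_natCast, Complex.ofReal_pow, Complex.ofReal_ofNat] at hc
  rw [Complex.ofReal_neg]
  linear_combination (-1 : ℂ) * hc

/-- The integral of the Laplace–Fourier integrand over a time step. -/
theorem integral_laplaceFourierIntegrand {lam nu : ℝ} (hlam : 0 < lam) (hnu : 0 ≤ nu) (μ : ℝ)
    (n k : ℕ) (ω : ℕ → ℝ) :
    ∫ t in ((k : ℝ) / 2 ^ n)..(((k : ℝ) + 1) / 2 ^ n), laplaceFourierIntegrand lam μ nu n ω t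
      = ((∏ j ∈ Finset.range k, weight lam nu (1 / 2 ^ n) (ω j) : ℝ) : ℂ)
        * ((lastWeight lam nu (1 / 2 ^ n) (ω k) : ℂ) * Complex.exp (Complex.I * μ * ω k)) := by
  have hle : (k : ℝ) / 2 ^ n ≤ ((k : ℝ) + 1) / 2 ^ n := by gcongr; linarith
  have hr : (rate lam nu (ω k) : ℂ) ≠ 0 := by
    exact_mod_cast (hlam.trans_le (le_rate lam hnu (ω k))).ne'
  have e := intervalIntegral.integral_congr_Ioo_of_le hle (μ := volume)
    (f := laplaceFourierIntegrand lam μ nu n ω) (g := fun t : ℝ =>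
      ((∏ j ∈ Finset.range k, weight lam nu (1 / 2 ^ n) (ω j) : ℝ) : ℂ)
        * Complex.exp (Complex.I * μ * ω k)
        * Complex.exp (-(rate lam nu (ω k) : ℂ) * (t - k / 2 ^ n)))
    fun t ht => laplaceFourierIntegrand_eq lam μ nu ω ht.1.le ht.2
  rw [e, intervalIntegral.integral_const_mul]
  have h2 := intervalIntegral.integral_comp_sub_right (a := (k : ℝ) / 2 ^ n)
    (b := ((k : ℝ) + 1) / 2 ^ n)
    (fun t : ℝ => Complex.exp (-(rate lam nu (ω k) : ℂ) * t)) ((k : ℝ) / 2 ^ n)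
  push_cast at h2
  rw [h2, sub_self, integral_exp_mul_complex (neg_ne_zero.2 hr), lastWeight, weight,
    ← sub_div, add_sub_cancel_left]
  push_cast
  rw [mul_zero, Complex.exp_zero, div_neg, ← neg_div, neg_sub, neg_mul]
  ring

theorem sojournTime_nonneg (n : ℕ) (ω : ℕ → ℝ) {t : ℝ} (ht : 0 ≤ t) : 0 ≤ sojournTime n ω t :=
  intervalIntegral.integral_nonneg ht fun _ _ =>
    Set.indicator_nonneg (fun _ _ => zero_le_one) _

theorem integrableOn_laplaceFourierIntegrand {lam nu : ℝ} (hlam : 0 < lam) (hnu : 0 ≤ nu) (μ : ℝ)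
    (n : ℕ) (ω : ℕ → ℝ) :
    IntegrableOn (laplaceFourierIntegrand lam μ nu n ω) (Set.Ioi 0) := by
  have hT : Continuous (sojournTime n ω) :=
    intervalIntegral.continuous_primitive (fun a b => intervalIntegrable_indicator n ω a b) 0
  have hm := measurable_stepProcess n ω
  refine (integrableOn_exp_neg_mul hlam).mono' (Measurable.aestronglyMeasurable ?_) ?_
  · have := hT.measurable
    unfold laplaceFourierIntegrand
    fun_prop
  · refine (ae_restrict_mem measurableSet_Ioi).mono fun t ht => ?_
    rw [laplaceFourierIntegrand, Complex.norm_exp]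
    refine Real.exp_le_exp.2 ?_
    have h := mul_nonneg hnu (sojournTime_nonneg n ω (Set.mem_Ioi.1 ht).le)
    simpa using h

/-- An integral over `(0, ∞)` as the sum of the integrals over the steps of a uniform
subdivision. -/
theorem hasSum_intervalIntegral {E : Type*} [NormedAddCommGroup E] [NormedSpace ℝ E] {f : ℝ → E}
    (hf : IntegrableOn f (Set.Ioi 0)) (n : ℕ) :
    HasSum (fun k : ℕ => ∫ t in ((k : ℝ) / 2 ^ n)..(((k : ℝ) + 1) / 2 ^ n), f t)
      (∫ t in Set.Ioi (0 : ℝ), f t) := by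
  have hp : (0 : ℝ) < 2 ^ n := by positivity
  have hU : ⋃ k : ℕ, Set.Ioc ((k : ℝ) / 2 ^ n) (((k : ℝ) + 1) / 2 ^ n) = Set.Ioi 0 := by
    ext t
    simp only [Set.mem_iUnion, Set.mem_Ioc, Set.mem_Ioi]
    constructor
    · rintro ⟨k, h, -⟩
      exact lt_of_le_of_lt (by positivity) h
    · intro ht
      have htp : 0 < t * 2 ^ n := mul_pos ht hp
      have hc : 0 < ⌈t * 2 ^ n⌉₊ := Nat.ceil_pos.2 htp
      refine ⟨⌈t * 2 ^ n⌉₊ - 1, ?_, ?_⟩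
      · rw [div_lt_iff₀ hp]
        exact Nat.lt_ceil.1 (by omega)
      · rw [le_div_iff₀ hp, ← Nat.cast_add_one, Nat.sub_add_cancel hc]
        exact Nat.le_ceil _
  have hd : Pairwise (Function.onFun Disjoint
      fun k : ℕ => Set.Ioc ((k : ℝ) / 2 ^ n) (((k : ℝ) + 1) / 2 ^ n)) := by
    have hmono : Monotone fun k : ℕ => (k : ℝ) / 2 ^ n := fun i j hij => by
      simp only
      gcongr
    simpa using hmono.pairwise_disjoint_on_Ioc_succ
  have h := hasSum_integral_iUnion (fun k : ℕ => measurableSet_Ioc) hd (by rwa [hU])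
  rw [hU] at h
  refine h.congr_fun fun k => ?_
  rw [intervalIntegral.integral_of_le (by gcongr; linarith)]

theorem pathOf_observations {k j : ℕ} (ω : ℕ → ℝ) (h0 : ω 0 = 0) (hj : j ≤ k) :
    pathOf (observations k ω) j = ω j := by
  cases j with
  | zero => simp [pathOf, h0]
  | succ j => simp [pathOf, observations, show j < k by omega]

theorem measurable_pathOf (k j : ℕ) : Measurable fun x : Fin k → ℝ => pathOf x j := by
  cases j with
  | zero => exact measurable_const
  | succ j =>
    by_cases h : j < k
    · simpa [pathOf, h] using measurable_pi_apply _
    · simp [pathOf, h]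

/-- A path functional: the product of the weights of the first `k` steps and a function of the
position at the last one. -/
def pathFunctional (lam nu h : ℝ) (f : ℝ → ℂ) (k : ℕ) (x : Fin k → ℝ) : ℂ :=
  ((∏ j ∈ Finset.range k, weight lam nu h (pathOf x j) : ℝ) : ℂ) * f (pathOf x k)

theorem laplaceFourierPiece_eq {lam nu : ℝ} (hlam : 0 < lam) (hnu : 0 ≤ nu) (μ : ℝ) (n k : ℕ) :
    laplaceFourierPiece lam μ nu n k = pathFunctional lam nu (1 / 2 ^ n)
      (fun x => (lastWeight lam nu (1 / 2 ^ n) x : ℂ) * Complex.exp (Complex.I * μ * x)) k :=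
  funext fun x => integral_laplaceFourierIntegrand hlam hnu μ n k (pathOf x)

theorem measurable_pathFunctional (lam nu h : ℝ) {f : ℝ → ℂ} (hf : Measurable f) (k : ℕ) :
    Measurable (pathFunctional lam nu h f k) := by
  unfold pathFunctional
  refine Measurable.mul (Complex.measurable_ofReal.comp (Finset.measurable_fun_prod _ fun j _ => ?_))
    (hf.comp (measurable_pathOf k k))
  exact (measurable_weight lam nu h).comp (measurable_pathOf k j)

theorem norm_pathFunctional_le {lam nu h : ℝ} (hlam : 0 ≤ lam) (hnu : 0 ≤ nu) (hh : 0 ≤ h)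
    {f : ℝ → ℂ} {B : ℝ} (hB : ∀ x, ‖f x‖ ≤ B) (k : ℕ) (x : Fin k → ℝ) :
    ‖pathFunctional lam nu h f k x‖ ≤ B := by
  have hp : ∏ j ∈ Finset.range k, weight lam nu h (pathOf x j) ≤ 1 :=
    Finset.prod_le_one (fun j _ => (weight_pos _ _ _ _).le)
      fun j _ => weight_le_one hlam hnu hh _
  have hp0 : 0 ≤ ∏ j ∈ Finset.range k, weight lam nu h (pathOf x j) :=
    Finset.prod_nonneg fun j _ => (weight_pos _ _ _ _).le
  rw [pathFunctional, norm_mul, Complex.norm_real, Real.norm_of_nonneg hp0]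
  exact (mul_le_of_le_one_left (norm_nonneg _) hp).trans (hB _)

theorem norm_lastWeight_mul_exp_le {lam nu h : ℝ} (hlam : 0 < lam) (hnu : 0 ≤ nu) (hh : 0 ≤ h)
    (μ x : ℝ) :
    ‖(lastWeight lam nu h x : ℂ) * Complex.exp (Complex.I * μ * x)‖ ≤ 1 / lam := by
  rw [norm_mul, norm_exp_I_mul_mul, mul_one, Complex.norm_real]
  exact abs_lastWeight_le hlam hnu hh x

theorem isTame_laplaceFourierPiece {lam nu : ℝ} (hlam : 0 < lam) (hnu : 0 ≤ nu) (μ : ℝ) (n k : ℕ) :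
    IsTame (laplaceFourierPiece lam μ nu n k) := by
  rw [laplaceFourierPiece_eq hlam hnu]
  have := measurable_lastWeight lam nu (1 / 2 ^ n)
  exact ⟨measurable_pathFunctional _ _ _ (by fun_prop) k, 1 / lam, fun x =>
    norm_pathFunctional_le hlam.le hnu (by positivity)
      (norm_lastWeight_mul_exp_le hlam hnu (by positivity) μ) k x⟩

theorem hasSum_laplaceFourierPiece {lam nu : ℝ} (hlam : 0 < lam) (hnu : 0 ≤ nu) (μ : ℝ) (n : ℕ)
    (ω : ℕ → ℝ) (h0 : ω 0 = 0) :
    HasSum (fun k => laplaceFourierPiece lam μ nu n k (observations k ω))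
      (laplaceFourier lam μ nu n ω) := by
  refine (hasSum_intervalIntegral
    (integrableOn_laplaceFourierIntegrand hlam hnu μ n ω) n).congr_fun fun k => ?_
  rw [laplaceFourierPiece, integral_laplaceFourierIntegrand hlam hnu,
    integral_laplaceFourierIntegrand hlam hnu, pathOf_observations ω h0 le_rfl]
  congr 2
  exact Finset.prod_congr rfl fun j hj => by
    rw [pathOf_observations ω h0 (Finset.mem_range.1 hj).le]

/-! ### Pseudo-expectations of path functionals -/

theorem kernel_eq_scale {N : ℕ} (hN : Even N) (hN2 : 2 ≤ N) {t : ℝ} (ht : 0 < t) (x : ℝ) :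
    kernel N t x = (nthRoot N t)⁻¹ * kernel N 1 ((nthRoot N t)⁻¹ * x) := by
  rw [← kernel_scale hN (nthRoot_pos N ht), nthRoot_pow hN2 ht.le]

theorem integrable_kernel {N : ℕ} (hN : Even N) (hN2 : 2 ≤ N) {t : ℝ} (ht : 0 < t) :
    Integrable (kernel N t) := by
  rw [show kernel N t = _ from funext (kernel_eq_scale hN hN2 ht)]
  exact ((integrable_kernel_one hN hN2).comp_mul_left'
    (inv_ne_zero (nthRoot_pos N ht).ne')).const_mul _

theorem measurable_kernel {N : ℕ} (hN : Even N) (hN2 : 2 ≤ N) {t : ℝ} (ht : 0 < t) :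
    Measurable (kernel N t) := by
  rw [show kernel N t = _ from funext (kernel_eq_scale hN hN2 ht)]
  have := (continuous_kernel_one hN hN2).measurable
  fun_prop

theorem fourier_kernel {N : ℕ} (hN : Even N) (hN2 : 2 ≤ N) {t : ℝ} (ht : 0 < t) (μ : ℝ) :
    ∫ x : ℝ, Complex.exp (Complex.I * μ * x) * (kernel N t x : ℂ)
      = ((Real.exp (-(t * μ ^ N)) : ℝ) : ℂ) := by
  have hc := nthRoot_pos N ht
  have hc' : (nthRoot N t : ℂ) ≠ 0 := by exact_mod_cast hc.ne'
  have h := fourier_kernel_one hN hN2 (nthRoot N t * μ)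
  rw [symbol, mul_pow, nthRoot_pow hN2 ht.le] at h
  rw [← h]
  have e := Measure.integral_comp_mul_left (fun x : ℝ =>
    Complex.exp (Complex.I * (nthRoot N t * μ : ℝ) * x) * (kernel N 1 x : ℂ)) (nthRoot N t)⁻¹
  rw [inv_inv, abs_of_pos hc, Complex.real_smul] at e
  rw [← mul_right_inj' hc', ← e, ← integral_const_mul]
  refine integral_congr_ae (ae_of_all _ fun x => ?_)
  simp only [kernel_eq_scale hN hN2 ht x]
  push_cast
  field_simp

/-- The density of the first `k` observations. -/
def pathDensity (N : ℕ) (t : ℝ) (k : ℕ) (x : Fin k → ℝ) : ℝ :=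
  ∏ i : Fin k, kernel N t (pathOf x i - pathOf x (i + 1))

theorem pathOf_insertNth_last {k j : ℕ} (y : ℝ) (x : Fin k → ℝ) (hj : j ≤ k) :
    pathOf ((Fin.last k).insertNth (α := fun _ => ℝ) y x) j = pathOf x j := by
  cases j with
  | zero => rfl
  | succ j =>
    have h : j < k := by omega
    rw [Fin.insertNth_last']
    simp only [pathOf, h, show j < k + 1 by omega, dif_pos]
    exact Fin.snoc_castSucc (α := fun _ => ℝ) y x ⟨j, h⟩

theorem pathOf_insertNth_last_self {k : ℕ} (y : ℝ) (x : Fin k → ℝ) :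
    pathOf ((Fin.last k).insertNth (α := fun _ => ℝ) y x) (k + 1) = y := by
  rw [Fin.insertNth_last']
  simp only [pathOf, show k < k + 1 by omega, dif_pos]
  exact Fin.snoc_last (α := fun _ => ℝ) y x

theorem pathDensity_insertNth_last (N : ℕ) (t : ℝ) {k : ℕ} (y : ℝ) (x : Fin k → ℝ) :
    pathDensity N t (k + 1) ((Fin.last k).insertNth (α := fun _ => ℝ) y x)
      = pathDensity N t k x * kernel N t (pathOf x k - y) := by
  rw [pathDensity, Fin.prod_univ_castSucc, Fin.val_last, pathOf_insertNth_last_self,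
    pathOf_insertNth_last y x le_rfl]
  congr 1
  refine Finset.prod_congr rfl fun i _ => ?_
  have hi : (i : ℕ) < k := i.2
  rw [Fin.val_castSucc, pathOf_insertNth_last y x hi.le,
    pathOf_insertNth_last y x (Nat.succ_le_of_lt hi)]

theorem measurable_pathDensity {N : ℕ} (hN : Even N) (hN2 : 2 ≤ N) {t : ℝ} (ht : 0 < t) (k : ℕ) :
    Measurable (pathDensity N t k) := by
  unfold pathDensity
  refine Finset.measurable_fun_prod _ fun i _ => (measurable_kernel hN hN2 ht).comp ?_
  exact (measurable_pathOf k i).sub (measurable_pathOf k (i + 1))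

/-- The density of one observation more, in product coordinates. -/
theorem integrable_pathDensity_mul {N : ℕ} (hN : Even N) (hN2 : 2 ≤ N) {t : ℝ} (ht : 0 < t) {k : ℕ}
    (h : Integrable (pathDensity N t k)) :
    Integrable (fun p : ℝ × (Fin k → ℝ) => pathDensity N t k p.2 * kernel N t (pathOf p.2 k - p.1))
      ((volume : Measure ℝ).prod volume) := by
  have hk := integrable_kernel hN hN2 ht
  have hm := measurable_kernel hN hN2 ht
  have hd := measurable_pathDensity hN hN2 ht k
  have hp := measurable_pathOf k k
  refine (integrable_prod_iff' (Measurable.aestronglyMeasurable ?_)).2 ⟨?_, ?_⟩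
  · fun_prop
  · exact ae_of_all _ fun x =>
      (hk.comp_sub_left (pathOf x k)).const_mul (pathDensity N t k x)
  · have e : (fun x : Fin k → ℝ => ∫ y, ‖pathDensity N t k x * kernel N t (pathOf x k - y)‖)
        = fun x => ‖pathDensity N t k x‖ * ∫ y, ‖kernel N t y‖ := by
      ext x
      simp only [norm_mul]
      rw [integral_const_mul, integral_sub_left_eq_self (fun y => ‖kernel N t y‖)]
    rw [e]
    exact h.norm.mul_const _

theorem integrable_pathDensity {N : ℕ} (hN : Even N) (hN2 : 2 ≤ N) {t : ℝ} (ht : 0 < t) (k : ℕ) :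
    Integrable (pathDensity N t k) := by
  induction k with
  | zero =>
    have : pathDensity N t 0 = fun _ => 1 := funext fun x => by simp [pathDensity]
    rw [this]
    exact Integrable.of_finite
  | succ k ih =>
    have e := volume_preserving_piFinSuccAbove (fun _ : Fin (k + 1) => ℝ) (Fin.last k)
    rw [← e.symm.integrable_comp_emb (MeasurableEquiv.measurableEmbedding _)]
    refine (integrable_pathDensity_mul hN hN2 ht ih).congr (ae_of_all _ fun p => ?_)
    exact (pathDensity_insertNth_last N t p.1 p.2).symm

/-- The transition operator of the weighted discrete process. -/
def transition (N : ℕ) (lam nu t : ℝ) (f : ℝ → ℂ) (x : ℝ) : ℂ :=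
  (weight lam nu t x : ℂ) * ∫ y, f y * (kernel N t (x - y) : ℂ)

theorem tameExpectation_eq (N n : ℕ) {k : ℕ} (F : (Fin k → ℝ) → ℂ) :
    tameExpectation N n F = ∫ x : Fin k → ℝ, F x * (pathDensity N (1 / 2 ^ n) k x : ℂ) := rfl

theorem tameExpectation_zero (N n : ℕ) (lam nu : ℝ) (f : ℝ → ℂ) :
    tameExpectation N n (pathFunctional lam nu (1 / 2 ^ n) f 0) = f 0 := by
  rw [tameExpectation_eq]
  have : volume (Set.univ : Set (Fin 0 → ℝ)) = 1 := by
    rw [← Set.pi_univ, volume_pi_pi]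
    simp
  simp [pathFunctional, pathDensity, pathOf, integral_const, Measure.real, this]

/-- The Markov property: the last observation is integrated out first. -/
theorem tameExpectation_succ {N : ℕ} (hN : Even N) (hN2 : 2 ≤ N) (n : ℕ) {lam nu : ℝ}
    (hlam : 0 ≤ lam) (hnu : 0 ≤ nu) {f : ℝ → ℂ} (hf : Measurable f) {B : ℝ} (hB : ∀ x, ‖f x‖ ≤ B)
    (k : ℕ) :
    tameExpectation N n (pathFunctional lam nu (1 / 2 ^ n) f (k + 1))
      = tameExpectation N n
        (pathFunctional lam nu (1 / 2 ^ n) (transition N lam nu (1 / 2 ^ n) f) k) := by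
  set t : ℝ := 1 / 2 ^ n with ht_def
  have ht : 0 < t := by positivity
  have e := (volume_preserving_piFinSuccAbove (fun _ : Fin (k + 1) => ℝ) (Fin.last k)).symm
  have hw := measurable_weight lam nu t
  have hp := measurable_pathOf k k
  have hcoord (p : ℝ × (Fin k → ℝ)) :
      pathFunctional lam nu t f (k + 1) ((Fin.last k).insertNth (α := fun _ => ℝ) p.1 p.2)
        * (pathDensity N t (k + 1) ((Fin.last k).insertNth (α := fun _ => ℝ) p.1 p.2) : ℂ)
      = pathFunctional lam nu t (fun x => (weight lam nu t x : ℂ)) k p.2 * f p.1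
        * ((pathDensity N t k p.2 * kernel N t (pathOf p.2 k - p.1) : ℝ) : ℂ) := by
    rw [pathDensity_insertNth_last, pathFunctional, pathFunctional, Finset.prod_range_succ,
      pathOf_insertNth_last_self, pathOf_insertNth_last p.1 p.2 le_rfl,
      Finset.prod_congr rfl fun j hj => by
        rw [pathOf_insertNth_last p.1 p.2 (Finset.mem_range.1 hj).le]]
    push_cast
    ring
  have hint : Integrable (fun p : ℝ × (Fin k → ℝ) =>
      pathFunctional lam nu t (fun x => (weight lam nu t x : ℂ)) k p.2 * f p.1
        * ((pathDensity N t k p.2 * kernel N t (pathOf p.2 k - p.1) : ℝ) : ℂ))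
      ((volume : Measure ℝ).prod volume) := by
    refine (integrable_pathDensity_mul hN hN2 ht
      (integrable_pathDensity hN hN2 ht k)).ofReal.bdd_mul (c := 1 * B) ?_ (ae_of_all _ fun p => ?_)
    · have := measurable_pathFunctional lam nu t (f := fun x => (weight lam nu t x : ℂ))
        (by fun_prop) k
      exact Measurable.aestronglyMeasurable (by fun_prop)
    · rw [norm_mul]
      refine mul_le_mul (norm_pathFunctional_le hlam hnu ht.le (fun x => ?_) k p.2) (hB _)
        (norm_nonneg _) zero_le_one
      rw [Complex.norm_real, Real.norm_of_nonneg (weight_pos _ _ _ _).le]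
      exact weight_le_one hlam hnu ht.le x
  rw [tameExpectation_eq, tameExpectation_eq, ← ht_def, ← e.integral_comp'
    (g := fun x => pathFunctional lam nu t f (k + 1) x * (pathDensity N t (k + 1) x : ℂ))]
  refine (integral_congr_ae (ae_of_all _ hcoord)).trans ((integral_prod_symm _ hint).trans ?_)
  refine integral_congr_ae (ae_of_all _ fun x => ?_)
  simp only [pathFunctional, transition]
  rw [mul_assoc _ (_ * _) _, mul_assoc _ (∫ y, _) _, ← integral_mul_const, ← integral_const_mul,
    ← integral_const_mul]
  refine integral_congr_ae (ae_of_all _ fun y => ?_)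
  push_cast
  ring

/-- The pseudo-expectations of the path functionals are integrals with respect to a finite signed
measure. -/
theorem exists_measure_tameExpectation {N : ℕ} (hN : Even N) (hN2 : 2 ≤ N) (n : ℕ) {lam nu : ℝ}
    (hlam : 0 ≤ lam) (hnu : 0 ≤ nu) (k : ℕ) :
    ∃ m₁ m₂ : Measure ℝ, IsFiniteMeasure m₁ ∧ IsFiniteMeasure m₂ ∧
      ∀ (f : ℝ → ℂ) (B : ℝ), Measurable f → (∀ x, ‖f x‖ ≤ B) →
        tameExpectation N n (pathFunctional lam nu (1 / 2 ^ n) f k)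
          = ∫ x, f x ∂m₁ - ∫ x, f x ∂m₂ := by
  induction k with
  | zero =>
    refine ⟨Measure.dirac 0, 0, inferInstance, inferInstance, fun f B hf _ => ?_⟩
    rw [tameExpectation_zero, integral_dirac, integral_zero_measure, sub_zero]
  | succ k ih =>
    obtain ⟨m₁, m₂, i₁, i₂, h⟩ := ih
    set t : ℝ := 1 / 2 ^ n with ht_def
    have ht : 0 < t := by positivity
    have hk := integrable_kernel hN hN2 ht
    have hm := measurable_kernel hN hN2 ht
    have hw := measurable_weight lam nu t
    set P₁ : Measure ℝ := volume.withDensity fun x => ENNReal.ofReal (kernel N t x) with hP₁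
    set P₂ : Measure ℝ := volume.withDensity fun x => ENNReal.ofReal (-kernel N t x) with hP₂
    have j₁ : IsFiniteMeasure P₁ := isFiniteMeasure_withDensity_real hk
    have j₂ : IsFiniteMeasure P₂ := isFiniteMeasure_withDensity_real hk.neg
    have wi (m : Measure ℝ) [IsFiniteMeasure m] : Integrable (weight lam nu t) m :=
      (integrable_const (1 : ℝ)).mono' hw.aestronglyMeasurable (ae_of_all _ fun x => by
        rw [Real.norm_of_nonneg (weight_pos _ _ _ _).le]
        exact weight_le_one hlam hnu ht.le x)
    set W : Measure ℝ → Measure ℝ :=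
      fun m => m.withDensity fun x => ENNReal.ofReal (weight lam nu t x) with hW
    have w₁ : IsFiniteMeasure (W m₁) := isFiniteMeasure_withDensity_ofReal (wi m₁).2
    have w₂ : IsFiniteMeasure (W m₂) := isFiniteMeasure_withDensity_ofReal (wi m₂).2
    have bint (m : Measure ℝ) [IsFiniteMeasure m] {f : ℝ → ℂ} {B : ℝ} (hf : Measurable f)
        (hB : ∀ x, ‖f x‖ ≤ B) : Integrable f m :=
      (integrable_const B).mono' hf.aestronglyMeasurable (ae_of_all _ hB)
    -- the transition operator against the two parts of the kernel
    have htrans {f : ℝ → ℂ} {B : ℝ} (hf : Measurable f) (hB : ∀ x, ‖f x‖ ≤ B) (x : ℝ) :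
        ∫ y, f y * (kernel N t (x - y) : ℂ)
          = ∫ y, f (x + y) ∂P₁ - ∫ y, f (x + y) ∂P₂ := by
      rw [hP₁, hP₂, integral_withDensity_eq_integral_toReal_smul (by fun_prop) (by simp),
        integral_withDensity_eq_integral_toReal_smul (by fun_prop) (by simp), ← integral_sub,
        ← integral_add_left_eq_self _ x]
      · refine integral_congr_ae (ae_of_all _ fun y => ?_)
        simp only [sub_add_cancel_left, kernel_neg hN, ENNReal.toReal_ofReal', Complex.real_smul]
        rw [← sub_mul, ← Complex.ofReal_sub, mul_comm]
        congr 2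
        rcases le_total 0 (kernel N t y) with h0 | h0
        · rw [max_eq_left h0, max_eq_right (by linarith), sub_zero]
        · rw [max_eq_right h0, max_eq_left (by linarith)]; ring
      · simp only [ENNReal.toReal_ofReal', Complex.real_smul]
        exact hk.pos_part.ofReal.mul_bdd (c := B)
          (Measurable.aestronglyMeasurable (by fun_prop)) (ae_of_all _ fun y => hB _)
      · simp only [ENNReal.toReal_ofReal', Complex.real_smul]
        exact hk.neg_part.ofReal.mul_bdd (c := B)
          (Measurable.aestronglyMeasurable (by fun_prop)) (ae_of_all _ fun y => hB _)
    have hTm {f : ℝ → ℂ} (hf : Measurable f) (P : Measure ℝ) [IsFiniteMeasure P] :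
        Measurable fun x => ∫ y, f (x + y) ∂P := by
      have h1 : StronglyMeasurable (Function.uncurry fun x y : ℝ => f (x + y)) :=
        (hf.comp (measurable_fst.add measurable_snd)).stronglyMeasurable
      exact h1.integral_prod_right.measurable
    have hTB {f : ℝ → ℂ} {B : ℝ} (hB : ∀ x, ‖f x‖ ≤ B) (P : Measure ℝ) [IsFiniteMeasure P] (x : ℝ) :
        ‖∫ y, f (x + y) ∂P‖ ≤ B * P.real Set.univ :=
      norm_integral_le_of_norm_le_const (ae_of_all _ fun y => hB _)
    have hconv (m P : Measure ℝ) [IsFiniteMeasure m] [IsFiniteMeasure P] [IsFiniteMeasure (W m)]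
        {f : ℝ → ℂ} {B : ℝ} (hf : Measurable f) (hB : ∀ x, ‖f x‖ ≤ B) :
        ∫ x, f x ∂(W m ∗ P) = ∫ x, (weight lam nu t x : ℂ) * ∫ y, f (x + y) ∂P ∂m := by
      rw [integral_conv (bint _ hf hB), hW,
        integral_withDensity_eq_integral_toReal_smul (by fun_prop) (by simp)]
      simp only [ENNReal.toReal_ofReal (weight_pos _ _ _ _).le, Complex.real_smul]
    refine ⟨W m₁ ∗ P₁ + W m₂ ∗ P₂, W m₁ ∗ P₂ + W m₂ ∗ P₁, inferInstance, inferInstance,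
      fun f B hf hB => ?_⟩
    have hTf : transition N lam nu t f = fun x => (weight lam nu t x : ℂ) *
        (∫ y, f (x + y) ∂P₁) - (weight lam nu t x : ℂ) * ∫ y, f (x + y) ∂P₂ := by
      ext x
      rw [transition, htrans hf hB, mul_sub]
    have hwB (P : Measure ℝ) [IsFiniteMeasure P] (x : ℝ) :
        ‖(weight lam nu t x : ℂ) * ∫ y, f (x + y) ∂P‖ ≤ B * P.real Set.univ := by
      rw [norm_mul, Complex.norm_real, Real.norm_of_nonneg (weight_pos _ _ _ _).le]
      exact (mul_le_of_le_one_left (norm_nonneg _) (weight_le_one hlam hnu ht.le x)).trans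
        (hTB hB P x)
    have hwm (P : Measure ℝ) [IsFiniteMeasure P] :
        Measurable fun x => (weight lam nu t x : ℂ) * ∫ y, f (x + y) ∂P := by
      have := hTm hf P
      fun_prop
    rw [tameExpectation_succ hN hN2 n hlam hnu hf hB, ← ht_def,
      h _ (B * P₁.real Set.univ + B * P₂.real Set.univ)]
    · rw [hTf, integral_sub (bint _ (hwm P₁) (hwB P₁)) (bint _ (hwm P₂) (hwB P₂)),
        integral_sub (bint _ (hwm P₁) (hwB P₁)) (bint _ (hwm P₂) (hwB P₂)),
        integral_add_measure (bint _ hf hB) (bint _ hf hB),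
        integral_add_measure (bint _ hf hB) (bint _ hf hB),
        hconv m₁ P₁ hf hB, hconv m₂ P₂ hf hB, hconv m₁ P₂ hf hB, hconv m₂ P₁ hf hB]
      ring
    · rw [hTf]
      exact (hwm P₁).sub (hwm P₂)
    · intro x
      rw [hTf]
      exact (norm_sub_le _ _).trans (add_le_add (hwB P₁ x) (hwB P₂ x))

/-! ### The discrete Wiener–Hopf problem -/

theorem tameExpectation_linear {N : ℕ} (hN : Even N) (hN2 : 2 ≤ N) (n : ℕ) {lam nu : ℝ}
    (hlam : 0 ≤ lam) (hnu : 0 ≤ nu) (k : ℕ) (c d : ℂ) {f g : ℝ → ℂ} {B B' : ℝ}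
    (hf : Measurable f) (hB : ∀ x, ‖f x‖ ≤ B) (hg : Measurable g) (hB' : ∀ x, ‖g x‖ ≤ B') :
    tameExpectation N n (pathFunctional lam nu (1 / 2 ^ n) (fun x => c * f x + d * g x) k)
      = c * tameExpectation N n (pathFunctional lam nu (1 / 2 ^ n) f k)
        + d * tameExpectation N n (pathFunctional lam nu (1 / 2 ^ n) g k) := by
  obtain ⟨m₁, m₂, i₁, i₂, h⟩ := exists_measure_tameExpectation hN hN2 n hlam hnu k
  have fi (m : Measure ℝ) [IsFiniteMeasure m] : Integrable (fun x => c * f x) m :=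
    ((integrable_const B).mono' hf.aestronglyMeasurable (ae_of_all _ hB)).const_mul c
  have gi (m : Measure ℝ) [IsFiniteMeasure m] : Integrable (fun x => d * g x) m :=
    ((integrable_const B').mono' hg.aestronglyMeasurable (ae_of_all _ hB')).const_mul d
  rw [h f B hf hB, h g B' hg hB', h _ (‖c‖ * B + ‖d‖ * B') (by fun_prop) fun x =>
    (norm_add_le _ _).trans (by rw [norm_mul, norm_mul]; gcongr; exacts [hB x, hB' x]),
    integral_add (fi m₁) (gi m₁), integral_add (fi m₂) (gi m₂)]
  simp only [integral_const_mul]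
  ring

/-- The character `exp(i μ x)`, cut off to `[0, ∞)`. -/
def posChar (μ : ℝ) : ℝ → ℂ := (Set.Ici 0).indicator fun x => Complex.exp (Complex.I * μ * x)

/-- The character `exp(i μ x)`, cut off to `(-∞, 0)`. -/
def negChar (μ : ℝ) : ℝ → ℂ := (Set.Iio 0).indicator fun x => Complex.exp (Complex.I * μ * x)

theorem measurable_posChar (μ : ℝ) : Measurable (posChar μ) :=
  Measurable.indicator (by fun_prop) measurableSet_Ici

theorem measurable_negChar (μ : ℝ) : Measurable (negChar μ) :=
  Measurable.indicator (by fun_prop) measurableSet_Iio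

theorem norm_posChar_le (μ x : ℝ) : ‖posChar μ x‖ ≤ 1 :=
  (norm_indicator_le_norm_self _ _).trans (norm_exp_I_mul_mul μ x).le

theorem norm_negChar_le (μ x : ℝ) : ‖negChar μ x‖ ≤ 1 :=
  (norm_indicator_le_norm_self _ _).trans (norm_exp_I_mul_mul μ x).le

/-- A function that is constant on both half-lines, times a character. -/
theorem mul_exp_eq (c : ℝ → ℂ) {cp cn : ℂ} (hp : ∀ x, 0 ≤ x → c x = cp) (hn : ∀ x, x < 0 → c x = cn)
    (μ : ℝ) : (fun x : ℝ => c x * Complex.exp (Complex.I * μ * x))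
      = fun x => cp * posChar μ x + cn * negChar μ x := by
  ext x
  rcases le_or_gt 0 x with hx | hx
  · simp [posChar, negChar, hx, hp x hx]
  · simp [posChar, negChar, hx, not_le.2 hx, hn x hx]

/-- The Fourier transform of the part in `[0, ∞)` of the weighted law of the `k`-th position. -/
def posTransform (N n : ℕ) (lam nu : ℝ) (k : ℕ) (μ : ℝ) : ℂ :=
  tameExpectation N n (pathFunctional lam nu (1 / 2 ^ n) (posChar μ) k)

/-- The Fourier transform of the part in `(-∞, 0)` of the weighted law of the `k`-th position. -/
def negTransform (N n : ℕ) (lam nu : ℝ) (k : ℕ) (μ : ℝ) : ℂ :=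
  tameExpectation N n (pathFunctional lam nu (1 / 2 ^ n) (negChar μ) k)

theorem integral_indicator_exp {S : Set ℝ} (hS : MeasurableSet S) (m : Measure ℝ) (μ : ℝ) :
    ∫ x, S.indicator (fun x : ℝ => Complex.exp (Complex.I * μ * x)) x ∂m
      = charFun (m.restrict S) μ := by
  rw [integral_indicator hS, charFun_apply_real]
  congr 1
  ext x
  congr 1
  ring

theorem isTransformOn_posTransform {N : ℕ} (hN : Even N) (hN2 : 2 ≤ N) (n : ℕ) {lam nu : ℝ}
    (hlam : 0 ≤ lam) (hnu : 0 ≤ nu) (k : ℕ) :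
    IsTransformOn (Set.Ici 0) (posTransform N n lam nu k) := by
  obtain ⟨m₁, m₂, i₁, i₂, h⟩ := exists_measure_tameExpectation hN hN2 n hlam hnu k
  refine ⟨m₁.restrict (Set.Ici 0), m₂.restrict (Set.Ici 0), inferInstance, inferInstance,
    ae_restrict_mem measurableSet_Ici, ae_restrict_mem measurableSet_Ici, fun μ => ?_⟩
  rw [posTransform, h _ 1 (measurable_posChar μ) (norm_posChar_le μ), posChar,
    integral_indicator_exp measurableSet_Ici, integral_indicator_exp measurableSet_Ici]

theorem isTransformOn_negTransform {N : ℕ} (hN : Even N) (hN2 : 2 ≤ N) (n : ℕ) {lam nu : ℝ}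
    (hlam : 0 ≤ lam) (hnu : 0 ≤ nu) (k : ℕ) :
    IsTransformOn (Set.Iio 0) (negTransform N n lam nu k) := by
  obtain ⟨m₁, m₂, i₁, i₂, h⟩ := exists_measure_tameExpectation hN hN2 n hlam hnu k
  refine ⟨m₁.restrict (Set.Iio 0), m₂.restrict (Set.Iio 0), inferInstance, inferInstance,
    ae_restrict_mem measurableSet_Iio, ae_restrict_mem measurableSet_Iio, fun μ => ?_⟩
  rw [negTransform, h _ 1 (measurable_negChar μ) (norm_negChar_le μ), negChar,
    integral_indicator_exp measurableSet_Iio, integral_indicator_exp measurableSet_Iio]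

theorem weight_of_nonneg (lam nu h : ℝ) {x : ℝ} (hx : 0 ≤ x) :
    weight lam nu h x = Real.exp (-((lam + nu) * h)) := by simp [weight, rate, hx]

theorem weight_of_neg (lam nu h : ℝ) {x : ℝ} (hx : x < 0) :
    weight lam nu h x = Real.exp (-(lam * h)) := by simp [weight, rate, not_le.2 hx]

/-- Characters are eigenfunctions of the unweighted transition operator. -/
theorem transition_exp {N : ℕ} (hN : Even N) (hN2 : 2 ≤ N) (lam nu : ℝ) {t : ℝ} (ht : 0 < t)
    (μ x : ℝ) : transition N lam nu t (fun x : ℝ => Complex.exp (Complex.I * μ * x)) x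
      = ((Real.exp (-(t * μ ^ N)) : ℂ) * weight lam nu t x) * Complex.exp (Complex.I * μ * x) := by
  rw [transition, ← fourier_kernel hN hN2 ht, ← integral_add_left_eq_self _ x]
  simp only [sub_add_cancel_left, kernel_neg hN]
  rw [mul_comm (∫ y, _) _, mul_assoc, ← integral_mul_const]
  congr 2
  ext y
  rw [mul_right_comm (Complex.exp (Complex.I * μ * y)), ← Complex.exp_add]
  congr 2
  push_cast
  ring

theorem posTransform_add_negTransform_succ {N : ℕ} (hN : Even N) (hN2 : 2 ≤ N) (n : ℕ)
    {lam nu : ℝ} (hlam : 0 ≤ lam) (hnu : 0 ≤ nu) (k : ℕ) (μ : ℝ) :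
    posTransform N n lam nu (k + 1) μ + negTransform N n lam nu (k + 1) μ
      = (Real.exp (-(1 / 2 ^ n * μ ^ N)) : ℂ)
        * ((Real.exp (-((lam + nu) * (1 / 2 ^ n))) : ℂ) * posTransform N n lam nu k μ
          + (Real.exp (-(lam * (1 / 2 ^ n))) : ℂ) * negTransform N n lam nu k μ) := by
  have ht : (0 : ℝ) < 1 / 2 ^ n := by positivity
  have lin (k : ℕ) (c d : ℂ) := tameExpectation_linear hN hN2 n hlam hnu k c d
    (measurable_posChar μ) (norm_posChar_le μ) (measurable_negChar μ) (norm_negChar_le μ)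
  have h1 := mul_exp_eq (fun _ => 1) (fun _ _ => rfl) (fun _ _ => rfl) μ
  have h2 := mul_exp_eq
    (fun x => (Real.exp (-(1 / 2 ^ n * μ ^ N)) : ℂ) * weight lam nu (1 / 2 ^ n) x)
    (fun x hx => by rw [weight_of_nonneg _ _ _ hx]) (fun x hx => by rw [weight_of_neg _ _ _ hx]) μ
  have l1 := lin (k + 1) 1 1
  rw [← h1] at l1
  simp only [one_mul] at l1
  have l2 := tameExpectation_succ hN hN2 n hlam hnu
    (f := fun x : ℝ => Complex.exp (Complex.I * μ * x)) (by fun_prop)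
    (fun x => (norm_exp_I_mul_mul μ x).le) k
  rw [show transition N lam nu (1 / 2 ^ n) (fun x : ℝ => Complex.exp (Complex.I * μ * x)) = _ from
    funext (transition_exp hN hN2 lam nu ht μ), h2, lin] at l2
  rw [posTransform, negTransform, ← l1, l2, posTransform, negTransform]
  ring

/-- The exponents of the factor of the discrete problem that is carried by `[0, ∞)`. -/
def posExponent (N n : ℕ) (lam nu : ℝ) (i : ℕ) (μ : ℝ) : ℂ :=
  ((Real.exp (-((lam + nu) * (1 / 2 ^ n))) : ℂ) ^ (i + 1)
    - (Real.exp (-(lam * (1 / 2 ^ n))) : ℂ) ^ (i + 1))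
      * halfTransform N (nthRoot N ((i + 1 : ℕ) * (1 / 2 ^ n)) * μ)

/-- The exponents of the factor of the discrete problem that is carried by `(-∞, 0)` up to a
constant. -/
def negExponent (N n : ℕ) (lam nu : ℝ) (i : ℕ) (μ : ℝ) : ℂ :=
  ((Real.exp (-(lam * (1 / 2 ^ n))) : ℂ) ^ (i + 1)
    - (Real.exp (-((lam + nu) * (1 / 2 ^ n))) : ℂ) ^ (i + 1))
      * halfTransform N (-(nthRoot N ((i + 1 : ℕ) * (1 / 2 ^ n)) * μ))

theorem isTransformOn_posExponent {N : ℕ} (hN : Even N) (hN2 : 2 ≤ N) (n : ℕ) (lam nu : ℝ) (i : ℕ) :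
    IsTransformOn (Set.Ici 0) (posExponent N n lam nu i) := by
  have hc := nthRoot_pos N (r := ((i + 1 : ℕ) : ℝ) * (1 / 2 ^ n)) (by positivity)
  refine (((isTransformOn_halfTransform hN hN2).comp_mul (T := Set.Ici 0) measurableSet_Ici
    fun x hx => (mul_pos hc hx).le).real_smul (Real.exp (-((lam + nu) * (1 / 2 ^ n))) ^ (i + 1)
      - Real.exp (-(lam * (1 / 2 ^ n))) ^ (i + 1))).congr fun μ => ?_
  rw [posExponent]
  push_cast
  rfl

theorem isTransformOn_negExponent {N : ℕ} (hN : Even N) (hN2 : 2 ≤ N) (n : ℕ) (lam nu : ℝ) (i : ℕ) :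
    IsTransformOn (Set.Iio 0) (negExponent N n lam nu i) := by
  have hc := nthRoot_pos N (r := ((i + 1 : ℕ) : ℝ) * (1 / 2 ^ n)) (by positivity)
  refine (((isTransformOn_halfTransform hN hN2).comp_mul (T := Set.Iio 0) measurableSet_Iio
    fun x hx => mul_neg_of_neg_of_pos (neg_lt_zero.2 hc) hx).real_smul
      (Real.exp (-(lam * (1 / 2 ^ n))) ^ (i + 1)
      - Real.exp (-((lam + nu) * (1 / 2 ^ n))) ^ (i + 1))).congr fun μ => ?_
  rw [negExponent, neg_mul]
  push_cast
  rfl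

theorem expCoeff_exponent_succ {N : ℕ} (hN : Even N) (hN2 : 2 ≤ N) (n : ℕ) (lam nu : ℝ) (k : ℕ)
    (μ : ℝ) :
    expCoeff (fun i => negExponent N n lam nu i μ) (k + 1)
      - (Real.exp (-(lam * (1 / 2 ^ n))) : ℂ) * (Real.exp (-(1 / 2 ^ n * μ ^ N)) : ℂ)
        * expCoeff (fun i => negExponent N n lam nu i μ) k
      = expCoeff (fun i => posExponent N n lam nu i μ) (k + 1)
      - (Real.exp (-((lam + nu) * (1 / 2 ^ n))) : ℂ) * (Real.exp (-(1 / 2 ^ n * μ ^ N)) : ℂ)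
        * expCoeff (fun i => posExponent N n lam nu i μ) k := by
  have h := one_sub_mul_expCoeff (p := (Real.exp (-(1 / 2 ^ n * μ ^ N)) : ℂ))
    (P := fun k => halfTransform N (nthRoot N (k * (1 / 2 ^ n)) * μ))
    (Q := fun k => halfTransform N (-(nthRoot N (k * (1 / 2 ^ n)) * μ)))
    (Real.exp (-(lam * (1 / 2 ^ n))) : ℂ) (Real.exp (-((lam + nu) * (1 / 2 ^ n))) : ℂ) fun k => by
      rw [halfTransform_add_neg hN hN2, symbol, mul_pow, nthRoot_pow hN2 (by positivity),
        ← Complex.ofReal_pow, ← Real.exp_nat_mul]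
      congr 2
      ring
  have hk := congrArg (PowerSeries.coeff (k + 1)) h
  rw [coeff_succ_one_sub_mul_mk, coeff_succ_one_sub_mul_mk] at hk
  exact hk

/-- The solution of the discrete Wiener–Hopf problem. -/
theorem posTransform_negTransform_eq {N : ℕ} (hN : Even N) (hN2 : 2 ≤ N) (n : ℕ) {lam nu : ℝ}
    (hlam : 0 < lam) (hnu : 0 < nu) (k : ℕ) (μ : ℝ) :
    ((Real.exp (-(lam * (1 / 2 ^ n))) : ℂ) - (Real.exp (-((lam + nu) * (1 / 2 ^ n))) : ℂ))
        * posTransform N n lam nu k μ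
      = (if k = 0 then (Real.exp (-(lam * (1 / 2 ^ n))) : ℂ) else 0)
        - (Real.exp (-((lam + nu) * (1 / 2 ^ n))) : ℂ)
          * expCoeff (fun i => posExponent N n lam nu i μ) k ∧
    ((Real.exp (-(lam * (1 / 2 ^ n))) : ℂ) - (Real.exp (-((lam + nu) * (1 / 2 ^ n))) : ℂ))
        * negTransform N n lam nu k μ
      = (Real.exp (-((lam + nu) * (1 / 2 ^ n))) : ℂ)
        * (expCoeff (fun i => negExponent N n lam nu i μ) k - if k = 0 then 1 else 0) := by
  induction k generalizing μ with
  | zero =>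
    rw [posTransform, negTransform, tameExpectation_zero, tameExpectation_zero, expCoeff_zero,
      expCoeff_zero]
    simp [posChar, negChar]
  | succ k ih =>
    set a : ℝ := Real.exp (-(lam * (1 / 2 ^ n))) with ha
    set b : ℝ := Real.exp (-((lam + nu) * (1 / 2 ^ n))) with hb
    have hP := (isTransformOn_posTransform hN hN2 n hlam.le hnu.le (k + 1)).real_smul (a - b)
    have hQ := (isTransformOn_negTransform hN hN2 n hlam.le hnu.le (k + 1)).real_smul (a - b)
    have hP' := (IsTransformOn.expCoeff_succ (fun x hx y hy => add_nonneg hx hy) measurableSet_Ici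
      (isTransformOn_posExponent hN hN2 n lam nu) k).real_smul (-b)
    have hQ' := (IsTransformOn.expCoeff_succ (fun x hx y hy => add_neg hx hy) measurableSet_Iio
      (isTransformOn_negExponent hN hN2 n lam nu) k).real_smul b
    have key := eq_of_add_eq_add hP hP' hQ hQ' (fun μ => ?_) μ
    · obtain ⟨k1, k2⟩ := key
      push_cast at k1 k2
      simp only [Nat.add_eq_zero_iff, one_ne_zero, and_false, if_false, k1, k2]
      constructor <;> ring
    · obtain ⟨i1, i2⟩ := ih μ
      have h1 := posTransform_add_negTransform_succ hN hN2 n hlam.le hnu.le k μ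
      have h2 := expCoeff_exponent_succ hN hN2 n lam nu k μ
      rw [← ha, ← hb] at h1 h2
      push_cast
      split_ifs at i1 i2 with hk0
      all_goals
        linear_combination ((a : ℂ) - b) * h1 - (b : ℂ) * h2
          + (Real.exp (-(1 / 2 ^ n * μ ^ N)) : ℂ) * b * i1
          + (Real.exp (-(1 / 2 ^ n * μ ^ N)) : ℂ) * a * i2

/-! ### Passage to the limit -/

/-- Convergence of dyadic Riemann sums over `(0, ∞)` under an exponential bound. -/
theorem tendsto_riemann_sum {f : ℝ → ℂ} (hf : ContinuousOn f (Set.Ioi 0)) {B c : ℝ} (hB : 0 ≤ B)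
    (hc : 0 < c) (hfB : ∀ t, 0 < t → ‖f t‖ ≤ B * Real.exp (-(c * t))) :
    Tendsto (fun n : ℕ => ∑' i : ℕ, (1 / 2 ^ n : ℂ) * f ((i + 1 : ℕ) * (1 / 2 ^ n))) atTop
      (𝓝 (∫ t in Set.Ioi (0 : ℝ), f t)) := by
  -- the step function that takes on `(k / 2 ^ n, (k + 1) / 2 ^ n]` the value at the right endpoint
  set g : ℕ → ℝ → ℂ := fun n t => f ((⌈t * 2 ^ n⌉₊ : ℝ) * (1 / 2 ^ n)) with hg
  have gm (n : ℕ) : Measurable (g n) :=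
    (measurable_from_nat (f := fun m : ℕ => f ((m : ℝ) * (1 / 2 ^ n)))).comp
      (Nat.measurable_ceil.comp (by fun_prop))
  have hceil (n : ℕ) {t : ℝ} : t ≤ (⌈t * 2 ^ n⌉₊ : ℝ) * (1 / 2 ^ n) := by
    rw [mul_one_div, le_div_iff₀ (by positivity)]
    exact Nat.le_ceil _
  have gB (n : ℕ) (t : ℝ) (ht : 0 < t) : ‖g n t‖ ≤ B * Real.exp (-(c * t)) := by
    refine (hfB _ (ht.trans_le (hceil n))).trans ?_
    gcongr
    exact hceil n
  have bint : IntegrableOn (fun t : ℝ => B * Real.exp (-(c * t))) (Set.Ioi 0) :=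
    (integrableOn_exp_neg_mul hc).const_mul B
  have gi (n : ℕ) : IntegrableOn (g n) (Set.Ioi 0) :=
    Integrable.mono' bint (gm n).aestronglyMeasurable
      ((ae_restrict_mem measurableSet_Ioi).mono fun t ht => gB n t ht)
  have hsum (n : ℕ) : ∑' i : ℕ, (1 / 2 ^ n : ℂ) * f ((i + 1 : ℕ) * (1 / 2 ^ n))
      = ∫ t in Set.Ioi (0 : ℝ), g n t := by
    rw [← (hasSum_intervalIntegral (gi n) n).tsum_eq]
    refine tsum_congr fun k => ?_
    have hp : (0 : ℝ) < 2 ^ n := by positivity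
    have e := intervalIntegral.integral_congr_Ioo_of_le (μ := volume)
      (a := (k : ℝ) / 2 ^ n) (b := ((k : ℝ) + 1) / 2 ^ n) (f := g n)
      (g := fun _ => f ((k + 1 : ℕ) * (1 / 2 ^ n))) (by gcongr; linarith) fun t ht => by
        have h1 := (div_lt_iff₀ hp).1 ht.1
        have h2 := (lt_div_iff₀ hp).1 ht.2
        have : ⌈t * 2 ^ n⌉₊ = k + 1 := by
          rw [Nat.ceil_eq_iff (by omega)]
          push_cast
          exact ⟨by simpa using h1, h2.le⟩
        simp only [hg, this]
    rw [e, intervalIntegral.integral_const, ← sub_div, add_sub_cancel_left, Complex.real_smul]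
    push_cast
    rfl
  simp_rw [hsum]
  refine tendsto_integral_of_dominated_convergence _ (fun n => (gm n).aestronglyMeasurable) bint
    (fun n => (ae_restrict_mem measurableSet_Ioi).mono fun t ht => gB n t ht)
    ((ae_restrict_mem measurableSet_Ioi).mono fun t ht => ?_)
  have ht' : 0 < t := ht
  have h2 : Tendsto (fun n : ℕ => (2 : ℝ) ^ n) atTop atTop :=
    tendsto_pow_atTop_atTop_of_one_lt one_lt_two
  have hlim : Tendsto (fun n : ℕ => (⌈t * 2 ^ n⌉₊ : ℝ) * (1 / 2 ^ n)) atTop (𝓝 t) := by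
    simpa only [mul_one_div] using! (tendsto_nat_ceil_mul_div_atTop ht'.le).comp h2
  exact ((hf.continuousAt (Ioi_mem_nhds ht')).tendsto).comp hlim

theorem exp_sub_exp_div_bounds {lam nu t : ℝ} (hnu : 0 ≤ nu) (ht : 0 < t) :
    0 ≤ (Real.exp (-(lam * t)) - Real.exp (-((lam + nu) * t))) / t ∧
      (Real.exp (-(lam * t)) - Real.exp (-((lam + nu) * t))) / t ≤ nu * Real.exp (-(lam * t)) := by
  have e : Real.exp (-((lam + nu) * t)) = Real.exp (-(lam * t)) * Real.exp (-(nu * t)) := by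
    rw [← Real.exp_add]
    congr 1
    ring
  have h1 : 1 - nu * t ≤ Real.exp (-(nu * t)) := by linarith [Real.add_one_le_exp (-(nu * t))]
  have h2 : Real.exp (-(nu * t)) ≤ 1 := Real.exp_le_one_iff.2 (by nlinarith)
  have h3 := Real.exp_pos (-(lam * t))
  rw [e]
  constructor
  · exact div_nonneg (by nlinarith) ht.le
  · rw [div_le_iff₀ ht]
    nlinarith

/-- The exponents of the discrete factors converge to that of the limiting factor. -/
theorem tendsto_exponent {N : ℕ} (hN : Even N) (hN2 : 2 ≤ N) {lam nu : ℝ} (hlam : 0 < lam)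
    (hnu : 0 ≤ nu) (μ : ℝ) :
    Tendsto (fun n : ℕ => ∑' i : ℕ, ((Real.exp (-(lam * (1 / 2 ^ n))) : ℂ) ^ (i + 1)
        - (Real.exp (-((lam + nu) * (1 / 2 ^ n))) : ℂ) ^ (i + 1))
        * halfTransform N (nthRoot N ((i + 1 : ℕ) * (1 / 2 ^ n)) * μ) / (i + 1)) atTop
      (𝓝 (logFactor N lam (lam + nu) μ)) := by
  have hq : 0 ≤ ∫ x, ‖kernel N 1 x‖ := integral_nonneg fun _ => norm_nonneg _
  have h := tendsto_riemann_sum (f := fun t : ℝ =>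
    (((Real.exp (-(lam * t)) - Real.exp (-((lam + nu) * t))) / t : ℝ) : ℂ)
      * halfTransform N (nthRoot N t * μ)) (B := nu * ∫ x, ‖kernel N 1 x‖) (c := lam) ?_
      (mul_nonneg hnu hq) hlam ?_
  · refine h.congr fun n => tsum_congr fun i => ?_
    have e (s : ℝ) : (Real.exp (-(s * (1 / 2 ^ n))) : ℂ) ^ (i + 1)
        = (Real.exp (-(s * ((i + 1 : ℕ) * (1 / 2 ^ n)))) : ℂ) := by
      rw [← Complex.ofReal_pow, ← Real.exp_nat_mul]
      congr 2
      ring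
    rw [e, e]
    have hi : ((i : ℂ) + 1) ≠ 0 := by exact_mod_cast i.succ_ne_zero
    have h2 : (2 : ℂ) ^ n ≠ 0 := pow_ne_zero _ two_ne_zero
    push_cast
    field_simp
  · intro t ht
    have ht0 : t ≠ 0 := (Set.mem_Ioi.1 ht).ne'
    have hr : ContinuousAt (nthRoot N) t := Real.continuousAt_rpow_const _ _ (Or.inl ht0)
    refine ContinuousAt.continuousWithinAt (ContinuousAt.mul ?_ ?_)
    · refine Complex.continuous_ofReal.continuousAt.comp (ContinuousAt.div ?_ continuousAt_id ht0)
      fun_prop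
    · exact ((continuous_halfTransform hN hN2).tendsto _).comp (hr.mul_const μ)
  · intro t ht
    obtain ⟨b1, b2⟩ := exp_sub_exp_div_bounds (lam := lam) hnu ht
    rw [norm_mul, Complex.norm_real, Real.norm_of_nonneg b1, mul_right_comm]
    exact mul_le_mul b2 (norm_halfTransform_le hN hN2 _) (norm_nonneg _)
      (mul_nonneg hnu (Real.exp_pos _).le)

theorem negExponent_eq (N n : ℕ) (lam nu : ℝ) (i : ℕ) (μ : ℝ) :
    negExponent N n lam nu i μ = -posExponent N n lam nu i (-μ) := by
  rw [negExponent, posExponent, mul_neg]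
  ring

theorem norm_posExponent_le {N : ℕ} (hN : Even N) (hN2 : 2 ≤ N) (n : ℕ) {lam nu : ℝ} (hnu : 0 ≤ nu)
    (i : ℕ) (μ : ℝ) : ‖posExponent N n lam nu i μ‖
      ≤ (∫ x, ‖kernel N 1 x‖) * Real.exp (-(lam * (1 / 2 ^ n))) ^ (i + 1) := by
  rw [posExponent, norm_mul, mul_comm]
  refine mul_le_mul (norm_halfTransform_le hN hN2 _) ?_ (norm_nonneg _)
    (integral_nonneg fun _ => norm_nonneg _)
  rw [← Complex.ofReal_pow, ← Complex.ofReal_pow, ← Complex.ofReal_sub, Complex.norm_real,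
    Real.norm_eq_abs, abs_sub_comm, abs_of_nonneg]
  · linarith [pow_pos (Real.exp_pos (-((lam + nu) * (1 / 2 ^ n)))) (i + 1)]
  · refine sub_nonneg.2 (pow_le_pow_left₀ (Real.exp_pos _).le (Real.exp_le_exp.2 ?_) _)
    have : 0 ≤ nu * (1 / 2 ^ n) := by positivity
    linarith

theorem tsum_expCoeff_posExponent {N : ℕ} (hN : Even N) (hN2 : 2 ≤ N) (n : ℕ) {lam nu : ℝ}
    (hlam : 0 < lam) (hnu : 0 ≤ nu) (μ : ℝ) :
    (Summable fun k => ‖expCoeff (fun i => posExponent N n lam nu i μ) k‖) ∧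
      ∑' k, expCoeff (fun i => posExponent N n lam nu i μ) k
        = Complex.exp (∑' i : ℕ, posExponent N n lam nu i μ / (i + 1)) :=
  tsum_expCoeff (B := ∫ x, ‖kernel N 1 x‖) (a := Real.exp (-(lam * (1 / 2 ^ n))))
    (integral_nonneg fun _ => norm_nonneg _) (Real.exp_pos _).le
    (Real.exp_lt_one_iff.2 (neg_lt_zero.2 (mul_pos hlam (by positivity))))
    (fun i => norm_posExponent_le hN hN2 n hnu i μ)

theorem tsum_expCoeff_negExponent {N : ℕ} (hN : Even N) (hN2 : 2 ≤ N) (n : ℕ) {lam nu : ℝ}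
    (hlam : 0 < lam) (hnu : 0 ≤ nu) (μ : ℝ) :
    (Summable fun k => ‖expCoeff (fun i => negExponent N n lam nu i μ) k‖) ∧
      ∑' k, expCoeff (fun i => negExponent N n lam nu i μ) k
        = Complex.exp (∑' i : ℕ, negExponent N n lam nu i μ / (i + 1)) :=
  tsum_expCoeff (B := ∫ x, ‖kernel N 1 x‖) (a := Real.exp (-(lam * (1 / 2 ^ n))))
    (integral_nonneg fun _ => norm_nonneg _) (Real.exp_pos _).le
    (Real.exp_lt_one_iff.2 (neg_lt_zero.2 (mul_pos hlam (by positivity))))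
    (fun i => by
      rw [negExponent_eq, norm_neg]
      exact norm_posExponent_le hN hN2 n hnu i (-μ))

theorem tendsto_exp_posExponent {N : ℕ} (hN : Even N) (hN2 : 2 ≤ N) {lam nu : ℝ} (hlam : 0 < lam)
    (hnu : 0 ≤ nu) (μ : ℝ) :
    Tendsto (fun n => Complex.exp (∑' i : ℕ, posExponent N n lam nu i μ / (i + 1))) atTop
      (𝓝 (∏ θ ∈ rootsJ N, (θ * nthRoot N lam - Complex.I * μ)
        / (θ * nthRoot N (lam + nu) - Complex.I * μ))) := by
  have h := (tendsto_exponent hN hN2 hlam hnu μ).neg.cexp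
  rw [Complex.exp_neg, exp_logFactor hN hN2 hlam (by linarith), ← Finset.prod_inv_distrib] at h
  simp only [inv_div] at h
  refine h.congr fun n => ?_
  rw [← tsum_neg]
  congr 1
  refine tsum_congr fun i => ?_
  rw [posExponent]
  ring

theorem tendsto_exp_negExponent {N : ℕ} (hN : Even N) (hN2 : 2 ≤ N) {lam nu : ℝ} (hlam : 0 < lam)
    (hnu : 0 ≤ nu) (μ : ℝ) :
    Tendsto (fun n => Complex.exp (∑' i : ℕ, negExponent N n lam nu i μ / (i + 1))) atTop
      (𝓝 (∏ θ ∈ rootsK N, (θ * nthRoot N (lam + nu) - Complex.I * μ)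
        / (θ * nthRoot N lam - Complex.I * μ))) := by
  have h := (tendsto_exp_posExponent hN hN2 hlam hnu (-μ)).inv₀
    (Finset.prod_ne_zero_iff.2 fun θ hθ => div_ne_zero
      (rootsJ_sub_ne_zero hN2 hθ (nthRoot_pos N hlam) _)
      (rootsJ_sub_ne_zero hN2 hθ (nthRoot_pos N (by linarith)) _))
  rw [← Finset.prod_inv_distrib] at h
  simp only [inv_div, ← Complex.exp_neg] at h
  rw [rootsK_eq_image hN hN2, Finset.prod_image fun _ _ _ _ h => neg_injective h]
  have e (θ : ℂ) (y : ℝ) : -θ * y - Complex.I * μ = -(θ * y - Complex.I * (-μ : ℝ)) := by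
    push_cast
    ring
  simp only [e, neg_div_neg_eq]
  refine h.congr fun n => ?_
  rw [← tsum_neg]
  congr 1
  refine tsum_congr fun i => ?_
  rw [negExponent_eq, neg_div]

theorem tendsto_one_sub_exp_div (c : ℝ) :
    Tendsto (fun n : ℕ => (1 - Real.exp (-(c * (1 / 2 ^ n)))) / (1 / 2 ^ n)) atTop (𝓝 c) := by
  have hd : HasDerivAt (fun h : ℝ => Real.exp (-(c * h))) (-c) 0 := by
    simpa using ((hasDerivAt_id (0 : ℝ)).const_mul c).neg.exp
  have hs := hd.tendsto_slope_zero
  have h0 : Tendsto (fun n : ℕ => (1 : ℝ) / 2 ^ n) atTop (𝓝[≠] 0) := by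
    refine tendsto_nhdsWithin_iff.2 ⟨?_, Eventually.of_forall fun n => ?_⟩
    · simpa using tendsto_pow_atTop_nhds_zero_of_lt_one (r := (1 / 2 : ℝ)) (by norm_num) (by norm_num)
    · have : (0 : ℝ) < 1 / 2 ^ n := by positivity
      exact this.ne'
  have := (hs.comp h0).neg
  rw [neg_neg] at this
  refine this.congr fun n => ?_
  simp only [Function.comp_apply, zero_add, mul_zero, neg_zero, Real.exp_zero, smul_eq_mul]
  ring

theorem tendsto_exp_neg_div_two_pow (c : ℝ) :
    Tendsto (fun n : ℕ => Real.exp (-(c * (1 / 2 ^ n)))) atTop (𝓝 1) := by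
  have h : Tendsto (fun n : ℕ => (1 : ℝ) / 2 ^ n) atTop (𝓝 0) := by
    simpa using tendsto_pow_atTop_nhds_zero_of_lt_one (r := (1 / 2 : ℝ)) (by norm_num) (by norm_num)
  simpa using (h.const_mul c).neg.rexp

theorem tendsto_lastWeight_div {lam nu : ℝ} (hnu : 0 < nu) {s : ℝ} (hs : 0 < s) :
    Tendsto (fun n : ℕ => (1 - Real.exp (-(s * (1 / 2 ^ n)))) / s
      / (Real.exp (-(lam * (1 / 2 ^ n))) - Real.exp (-((lam + nu) * (1 / 2 ^ n))))) atTop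
      (𝓝 (1 / nu)) := by
  have h1 := (tendsto_one_sub_exp_div s).div_const s
  have h2 := (tendsto_one_sub_exp_div (lam + nu)).sub (tendsto_one_sub_exp_div lam)
  rw [add_sub_cancel_left] at h2
  have h3 := h1.div h2 hnu.ne'
  rw [div_self hs.ne'] at h3
  refine h3.congr fun n => ?_
  have : (0 : ℝ) < 1 / 2 ^ n := by positivity
  simp only [Pi.div_apply]
  rw [← sub_div, sub_sub_sub_cancel_left, div_right_comm _ _ s, div_div_div_cancel_right₀ this.ne']

theorem tameExpectation_laplaceFourierPiece {N : ℕ} (hN : Even N) (hN2 : 2 ≤ N) {lam nu : ℝ}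
    (hlam : 0 < lam) (hnu : 0 ≤ nu) (μ : ℝ) (n k : ℕ) :
    tameExpectation N n (laplaceFourierPiece lam μ nu n k)
      = (((1 - Real.exp (-((lam + nu) * (1 / 2 ^ n)))) / (lam + nu) : ℝ) : ℂ)
          * posTransform N n lam nu k μ
        + (((1 - Real.exp (-(lam * (1 / 2 ^ n)))) / lam : ℝ) : ℂ) * negTransform N n lam nu k μ := by
  rw [laplaceFourierPiece_eq hlam hnu, mul_exp_eq
    (cp := (((1 - Real.exp (-((lam + nu) * (1 / 2 ^ n)))) / (lam + nu) : ℝ) : ℂ))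
    (cn := (((1 - Real.exp (-(lam * (1 / 2 ^ n)))) / lam : ℝ) : ℂ))
    (fun x => (lastWeight lam nu (1 / 2 ^ n) x : ℂ))
    (fun x hx => by rw [lastWeight, weight_of_nonneg _ _ _ hx, rate, if_pos hx])
    (fun x hx => by rw [lastWeight, weight_of_neg _ _ _ hx, rate, if_neg (not_le.2 hx)])]
  exact tameExpectation_linear hN hN2 n hlam.le hnu k _ _ (measurable_posChar μ)
    (norm_posChar_le μ) (measurable_negChar μ) (norm_negChar_le μ)

/-- The series of pseudo-expectations at level `n` in closed form. -/
theorem hasSum_tameExpectation {N : ℕ} (hN : Even N) (hN2 : 2 ≤ N) {lam nu : ℝ}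
    (hlam : 0 < lam) (hnu : 0 < nu) (μ : ℝ) (n : ℕ) :
    (Summable fun k => ‖tameExpectation N n (laplaceFourierPiece lam μ nu n k)‖) ∧
    ∑' k, tameExpectation N n (laplaceFourierPiece lam μ nu n k)
      = (((1 - Real.exp (-((lam + nu) * (1 / 2 ^ n)))) / (lam + nu)
          / (Real.exp (-(lam * (1 / 2 ^ n))) - Real.exp (-((lam + nu) * (1 / 2 ^ n)))) : ℝ) : ℂ)
          * ((Real.exp (-(lam * (1 / 2 ^ n))) : ℂ) - (Real.exp (-((lam + nu) * (1 / 2 ^ n))) : ℂ)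
            * Complex.exp (∑' i : ℕ, posExponent N n lam nu i μ / (i + 1)))
        + (((1 - Real.exp (-(lam * (1 / 2 ^ n)))) / lam
          / (Real.exp (-(lam * (1 / 2 ^ n))) - Real.exp (-((lam + nu) * (1 / 2 ^ n)))) : ℝ) : ℂ)
          * ((Real.exp (-((lam + nu) * (1 / 2 ^ n))) : ℂ)
            * (Complex.exp (∑' i : ℕ, negExponent N n lam nu i μ / (i + 1)) - 1)) := by
  obtain ⟨sR, tR⟩ := tsum_expCoeff_posExponent hN hN2 n hlam hnu.le μ
  obtain ⟨sM, tM⟩ := tsum_expCoeff_negExponent hN hN2 n hlam hnu.le μ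
  set a : ℝ := Real.exp (-(lam * (1 / 2 ^ n))) with ha
  set b : ℝ := Real.exp (-((lam + nu) * (1 / 2 ^ n))) with hb
  have hab : 0 < a - b := by
    have : 0 < nu * (1 / 2 ^ n) := by positivity
    exact sub_pos.2 (Real.exp_lt_exp.2 (by linarith))
  have hab' : (a : ℂ) - b ≠ 0 := by exact_mod_cast hab.ne'
  have dlt (z : ℂ) : HasSum (fun k : ℕ => if k = 0 then z else 0) z := by
    simpa using hasSum_ite_eq (0 : ℕ) z
  have dltn (z : ℂ) : Summable fun k : ℕ => ‖if k = 0 then z else 0‖ := by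
    refine summable_of_ne_finset_zero (s := {0}) fun k hk => ?_
    rw [if_neg (by simpa using hk), norm_zero]
  have hR := sR.of_norm.hasSum
  have hM := sM.of_norm.hasSum
  rw [tR] at hR
  rw [tM] at hM
  have term (k : ℕ) : tameExpectation N n (laplaceFourierPiece lam μ nu n k)
      = (((1 - b) / (lam + nu) / (a - b) : ℝ) : ℂ) * ((if k = 0 then (a : ℂ) else 0)
          - (b : ℂ) * expCoeff (fun i => posExponent N n lam nu i μ) k)
        + (((1 - a) / lam / (a - b) : ℝ) : ℂ) * ((b : ℂ)
          * (expCoeff (fun i => negExponent N n lam nu i μ) k - if k = 0 then 1 else 0)) := by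
    obtain ⟨h1, h2⟩ := posTransform_negTransform_eq hN hN2 n hlam hnu k μ
    rw [tameExpectation_laplaceFourierPiece hN hN2 hlam hnu.le, ← ha, ← hb]
    rw [← ha, ← hb] at h1 h2
    rw [← h1, ← h2]
    simp only [Complex.ofReal_div _ (a - b), Complex.ofReal_sub a b, ← mul_assoc,
      div_mul_cancel₀ _ hab']
  simp only [term]
  refine ⟨?_, (((dlt _).sub (hR.mul_left _)).mul_left _ |>.add
    (((hM.sub (dlt 1)).mul_left _).mul_left _)).tsum_eq⟩
  have n1 : Summable fun k : ℕ => ‖(if k = 0 then (a : ℂ) else 0)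
      - (b : ℂ) * expCoeff (fun i => posExponent N n lam nu i μ) k‖ :=
    Summable.of_nonneg_of_le (fun _ => norm_nonneg _) (fun _ => norm_sub_le _ _)
      ((dltn _).add (by simpa only [norm_mul] using sR.mul_left ‖(b : ℂ)‖))
  have n2 : Summable fun k : ℕ =>
      ‖expCoeff (fun i => negExponent N n lam nu i μ) k - if k = 0 then 1 else 0‖ :=
    Summable.of_nonneg_of_le (fun _ => norm_nonneg _) (fun _ => norm_sub_le _ _) (sM.add (dltn 1))
  refine Summable.of_nonneg_of_le (fun _ => norm_nonneg _) (fun _ => norm_add_le _ _) ?_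
  simp only [norm_mul]
  exact (n1.mul_left _).add ((n2.mul_left _).mul_left _)

/-- The limit of the pseudo-expectations is the Fourier transform of the density. -/
theorem tendsto_tsum_tameExpectation {N : ℕ} (hN : Even N) (hN2 : 2 ≤ N) {lam nu : ℝ}
    (hlam : 0 < lam) (hnu : 0 < nu) (μ : ℝ) :
    Tendsto (fun n => ∑' k, tameExpectation N n (laplaceFourierPiece lam μ nu n k)) atTop
      (𝓝 (∫ x : ℝ, Complex.exp (Complex.I * μ * x) * (density N lam nu x : ℂ))) := by
  have hl := add_pos hlam hnu
  have c1 := (Complex.continuous_ofReal.tendsto _).comp (tendsto_lastWeight_div (lam := lam) hnu hl)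
  have c2 := (Complex.continuous_ofReal.tendsto _).comp
    (tendsto_lastWeight_div (lam := lam) hnu hlam)
  have ca := (Complex.continuous_ofReal.tendsto _).comp (tendsto_exp_neg_div_two_pow lam)
  have cb := (Complex.continuous_ofReal.tendsto _).comp (tendsto_exp_neg_div_two_pow (lam + nu))
  have hR := tendsto_exp_posExponent hN hN2 hlam hnu.le μ
  have hM := tendsto_exp_negExponent hN hN2 hlam hnu.le μ
  have h := (c1.mul (ca.sub (cb.mul hR))).add (c2.mul (cb.mul (hM.sub_const 1)))
  simp only [fun n => (hasSum_tameExpectation hN hN2 hlam hnu μ n).2]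
  convert! h using 2
  have hα := nthRoot_pos N hl
  have hβ := nthRoot_pos N hlam
  have fα := prod_roots_mul_sub_I hN hN2 (nthRoot N (lam + nu) : ℂ) μ
  have fβ := prod_roots_mul_sub_I hN hN2 (nthRoot N lam : ℂ) μ
  rw [← Complex.ofReal_pow, nthRoot_pow hN2 hl.le] at fα
  rw [← Complex.ofReal_pow, nthRoot_pow hN2 hlam.le] at fβ
  rw [fourier_density hN hN2 hlam hnu, Finset.prod_div_distrib, Finset.prod_div_distrib]
  have zJ : ∏ θ ∈ rootsJ N, (θ * nthRoot N (lam + nu) - Complex.I * μ) ≠ 0 :=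
    Finset.prod_ne_zero_iff.2 fun θ hθ => rootsJ_sub_ne_zero hN2 hθ hα μ
  have zK : ∏ θ ∈ rootsK N, (θ * nthRoot N lam - Complex.I * μ) ≠ 0 :=
    Finset.prod_ne_zero_iff.2 fun θ hθ => rootsK_sub_ne_zero hN2 hθ hβ μ
  have hnu' : (nu : ℂ) ≠ 0 := by exact_mod_cast hnu.ne'
  generalize (∏ θ ∈ rootsJ N, (θ * nthRoot N (lam + nu) - Complex.I * μ)) = Jα at *
  generalize (∏ θ ∈ rootsK N, (θ * nthRoot N lam - Complex.I * μ)) = Kβ at *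
  generalize (∏ θ ∈ rootsK N, (θ * nthRoot N (lam + nu) - Complex.I * μ)) = Kα at *
  generalize (∏ θ ∈ rootsJ N, (θ * nthRoot N lam - Complex.I * μ)) = Jβ at *
  push_cast at fα ⊢
  field_simp
  linear_combination fβ - fα

theorem isLaplaceDensity_density {N : ℕ} (hN : Even N) (hN2 : 2 ≤ N) {lam nu : ℝ}
    (hlam : 0 < lam) (hnu : 0 < nu) : IsLaplaceDensity N lam nu (density N lam nu) :=
  ⟨integrable_density hN2 hlam hnu, fun μ =>
    ⟨fun n => ∑' k, tameExpectation N n (laplaceFourierPiece lam μ nu n k), fun n =>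
      { tame := isTame_laplaceFourierPiece hlam hnu.le μ n
        series := hasSum_laplaceFourierPiece hlam hnu.le μ n
        summable := (hasSum_tameExpectation hN hN2 hlam hnu μ n).1
        expectation_eq := rfl },
      tendsto_tsum_tameExpectation hN hN2 hlam hnu μ⟩⟩

theorem IsLaplaceDensity.ae_eq {N : ℕ} {lam nu : ℝ} {g h : ℝ → ℝ} (hg : IsLaplaceDensity N lam nu g)
    (hh : IsLaplaceDensity N lam nu h) : h =ᵐ[volume] g := by
  refine ae_eq_of_fourier_eq hh.1 hg.1 fun μ => ?_
  obtain ⟨E, hE, tE⟩ := hg.2 μ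
  obtain ⟨E', hE', tE'⟩ := hh.2 μ
  have : E' = E := funext fun n => by rw [(hE n).expectation_eq, (hE' n).expectation_eq]
  rw [this] at tE'
  exact tendsto_nhds_unique tE' tE

end PseudoProcess
end

theorem mainTheorem3 (N : ℕ) (hN : Even N) (hN2 : 2 ≤ N) (lam nu : ℝ)
    (hlam : 0 < lam) (hnu : 0 < nu) :
    ∃ g : ℝ → ℝ,
      Continuous g ∧ PseudoProcess.IsLaplaceDensity N lam nu g ∧
      (∀ h : ℝ → ℝ, PseudoProcess.IsLaplaceDensity N lam nu h → h =ᵐ[volume] g) ∧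
      (∀ x : ℝ, 0 ≤ x →
        (g x : ℂ) = (PseudoProcess.prefactor N lam nu : ℂ) *
          ∑ θj ∈ PseudoProcess.rootsJ N, PseudoProcess.coeffA N θj * θj *
            (∑ θk ∈ PseudoProcess.rootsK N, PseudoProcess.coeffB N θk * θk /
              (θk * (PseudoProcess.nthRoot N lam : ℂ)
                - θj * (PseudoProcess.nthRoot N (lam + nu) : ℂ))) *
            Complex.exp (-(θj * (PseudoProcess.nthRoot N (lam + nu) : ℂ) * (x : ℂ)))) ∧
      (∀ x : ℝ, x ≤ 0 →
        (g x : ℂ) = (PseudoProcess.prefactor N lam nu : ℂ) *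
          ∑ θk ∈ PseudoProcess.rootsK N, PseudoProcess.coeffB N θk * θk *
            (∑ θj ∈ PseudoProcess.rootsJ N, PseudoProcess.coeffA N θj * θj /
              (θk * (PseudoProcess.nthRoot N lam : ℂ)
                - θj * (PseudoProcess.nthRoot N (lam + nu) : ℂ))) *
            Complex.exp (-(θk * (PseudoProcess.nthRoot N lam : ℂ) * (x : ℂ)))) :=
  ⟨PseudoProcess.density N lam nu, PseudoProcess.continuous_density N lam nu,
    PseudoProcess.isLaplaceDensity_density hN hN2 hlam hnu,
    fun _ hh => (PseudoProcess.isLaplaceDensity_density hN hN2 hlam hnu).ae_eq hh,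
    fun _ hx => PseudoProcess.density_of_nonneg hN2 lam nu hx,
    fun _ hx => PseudoProcess.density_of_nonpos hN2 lam nu hx⟩
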